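/- Let $k$ be a field of characteristic zero and $l\in\mathbb Z$. All graded spaces are $\mathbb Z$-graded, differentials have degree $-1$, $V[1]_j=V_{j+1}$, $\bar x$ is the degree of $x$, and the Koszul sign rule is used throughout, for permutations of tensor factors as well as for tensor products of maps: $(f\otimes g)(x\otimes y)=(-1)^{\bar g\bar x}f(x)\otimes g(y)$. Let $V$ be a chain complex over $k$ with an inner product $B:V^{\otimes 2}\to k[-l]$ of degree $l$ (a morphism of chain complexes, so $B(u,v)=0$ unless $\bar u+\bar v=l$) which is symmetric, $B(u,v)=(-1)^{\bar u\bar v}B(v,u)$, respectively antisymmetric, $B(u,v)=-(-1)^{\bar u\bar v}B(v,u)$. Let $\mathcal P$ be a twisted modular $\mathcal D$-operad, with $\mathcal D=\mathcal K^{\otimes 1-l}$ if $B$ is symmetric and $\mathcal D=\mathcal K^{\otimes -1-l}\mathcal L$ if $B$ is antisymmetric, where $\mathcal K(G)=Det(Edge(G))$ and $\mathcal L(G)=Det(Flag(G))\,Det^{-1}(Leg(G))$ for a stable graph $G$. Thus $\mathcal P$ consists of chain complexes $\mathcal P((n,b))$ with $\mathbb S_n$-action, zero unless $2b+n-2>0$,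 and of equivariant and associative compositions $\mu_G:\mathcal D(G)\otimes\bigotimes_{v}\mathcal P((n(v),b(v)))\to\mathcal P((n,b))$ along all stable graphs $G$ with $n$ marked legs and $b(G)=b$. Let $o^{\mathcal P}:\mathcal P((n_1+1,b_1))\otimes\mathcal P((n_2+1,b_2))\to\mathcal P((n_1+n_2,b_1+b_2))$ be the composition along the graph with two vertices and one edge, which joins the last flag $f$ of the first vertex to the first flag $f'$ of the second, and $\xi^{\mathcal P}:\mathcal P((n+2,b))\to\mathcal P((n,b+1))$ the composition along the graph with one vertex and one loop, joining the flags $f=n+1$ and $f'=n+2$; both are evaluated on the generator $e[1]^{\otimes 1-l}$, respectively $e[1]^{\otimes -1-l}\otimes(f[1]\wedge f'[1])$, of $\mathcal D(G)$, where $e$ is the edge, and have degree $l-1$. Let $o^{\mathcal E[V]}:V^{\otimes n_1+1}\otimes V^{\otimes n_2+1}\to V^{\otimes n_1+n_2}$ and $\xi^{\mathcal E[V]}:V^{\otimes n+2}\to V^{\otimes n}$ be the contractions of the same pairs of factors with $B$, of degree $-l$. Put $$F=\bigoplus_{n,b}\bigl(V^{\otimes n}\otimes\mathcal P((n,b))\bigr)^{\mathbb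 S_n},\qquad C(m_1,m_2)=\frac{1}{n_1!\,n_2!}\sum_{\sigma\in\mathbb S_{n_1+n_2}}\sigma\,(o^{\mathcal E[V]}\otimes o^{\mathcal P})(m_1\otimes m_2)$$ for $m_i\in(V^{\otimes n_i+1}\otimes\mathcal P((n_i+1,b_i)))^{\mathbb S_{n_i+1}}$, extended bilinearly to $F$, with $C=0$ if one of the arguments lies in a summand with $n=0$. The equation on $m=\sum_{n,b} m_{n,b}\in F_0$ describing algebras over the Feynman transform of $\mathcal P$ is $$(d_{\mathcal P}+d_V)m-(\xi^{\mathcal E[V]}\otimes\xi^{\mathcal P})m-\tfrac12\,C(m,m)=0 ,\qquad(*)$$ where the power of the formal variable $z$ which records $b$ is replaced by the index $b$, and where $\xi^{\mathcal E[V]}\otimes\xi^{\mathcal P}$ is zero on the summands with $n<2$. For homogeneous $m,m_1,m_2\in F$ put $$d\,m=(-1)^{\bar m+1}(d_V+d_{\mathcal P})m,\qquad \Delta m=(-1)^{\bar m}(\xi^{\mathcal E[V]}\otimes\xi^{\mathcal P})m,\qquad \{m_1,m_2\}=(-1)^{\bar m_1\bar m_2}C(m_1,m_2).$$ **Proposition.**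 The linear and the quadratic terms of $(*)$ are the components of a differential graded Lie algebra structure on $F[1]$, in the category of chain complexes. Precisely: 1. For $m\in F_0$ the left-hand side of $(*)$ equals $-\bigl(d\,m+\Delta m+\tfrac12\{m,m\}\bigr)$. 2. $d$ and $\Delta$ map $F_i$ to $F_{i-1}$ and $\{\cdot,\cdot\}$ maps $F_i\times F_j$ to $F_{i+j-1}$. 3. $\{\cdot,\cdot\}$ is an odd Lie bracket on $F$: $[m_1,m_2]=(-1)^{\bar m_2}\{m_1,m_2\}$ (with $\bar m_2$ the degree in $F$) is a graded Lie bracket of degree $0$ on $F[1]$. Each of $d$, $\Delta$ and $d+\Delta$ is a differential of degree $-1$ on $F[1]$ which is a derivation of $[\cdot,\cdot]$; in particular $d^2=\Delta^2=d\Delta+\Delta d=0$. So $(F[1],d,[\cdot,\cdot])$, $(F[1],\Delta,[\cdot,\cdot])$ and $(F[1],d+\Delta,[\cdot,\cdot])$ are differential graded Lie algebras. -/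

import Mathlib

open scoped TensorProduct DirectSum
open Function

universe u v w

noncomputable section

/-! ## Chain complexes (`ℤ`-graded, differential of degree `-1`) over a field -/

/-- A chain complex of `k`-vector spaces, written as a vector space which is the direct sum of its
homogeneous components `gr i`, with a differential of degree `-1`. -/
structure ChainCx (k : Type u) [Field k] where
  carrier : Type v
  [addCommGroup : AddCommGroup carrier]
  [module : Module k carrier]
  gr : ℤ → Submodule k carrier
  [decomp : DirectSum.Decomposition gr]
  d : carrier →ₗ[k] carrier
  d_mem : ∀ (i : ℤ) (x : carrier), x ∈ gr i → d x ∈ gr (i - 1)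
  d_d : ∀ x : carrier, d (d x) = 0

instance {k : Type u} [Field k] : CoeSort (ChainCx.{u, v} k) (Type v) := ⟨ChainCx.carrier⟩

attribute [instance] ChainCx.addCommGroup ChainCx.module ChainCx.decomp

namespace ChainCx

variable {k : Type u} [Field k]

/-- The projection of `X` onto the sum of its components of even degree (`a = 0`), respectively of
odd degree (`a = 1`). -/
def par (X : ChainCx.{u, v} k) (a : Fin 2) : X →ₗ[k] X :=
  (DirectSum.toModule k ℤ X fun i => if i % 2 = ((a : ℕ) : ℤ) then (X.gr i).subtype else 0) ∘ₗ
    (DirectSum.decomposeLinearEquiv X.gr).toLinearMap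

/-- The parity operator, which is `(-1) ^ i` on the component of degree `i`. -/
def sgn (X : ChainCx.{u, v} k) : X →ₗ[k] X := X.par 0 - X.par 1

end ChainCx

/-! ## Koszul signs and tensor powers -/

/-- The Koszul sign of a bijection `e` between linearly ordered finite sets, which permutes
homogeneous factors of degrees `deg i`: every pair of factors whose order is reversed contributes
`(-1) ^ (deg i * deg j)`. -/
def koszulSign {ι κ : Type} [Fintype ι] [LinearOrder ι] [LinearOrder κ] (e : ι ≃ κ)
    (deg : ι → ℤ) : ℤˣ :=
  ∏ q : ι × ι, if q.1 < q.2 ∧ e q.2 < e q.1 then (deg q.1 * deg q.2).negOnePow else 1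

section TensorPowers

variable {k : Type u} [Field k]

/-- `V ^ ⊗ ι` for a finite linearly ordered set `ι`. -/
abbrev TPow (V : ChainCx.{u, v} k) (ι : Type) : Type (max u v) := ⨂[k] (_ : ι), V

variable (V : ChainCx.{u, v} k)

/-- The symmetry isomorphism `V ^ ⊗ ι → V ^ ⊗ κ` of the symmetric monoidal category of graded vector
spaces attached to a bijection `e : ι ≃ κ`: the factor in position `i` is moved to position `e i`,
with the Koszul sign. -/
def koszulMap {ι κ : Type} [Fintype ι] [LinearOrder ι] [LinearOrder κ] (e : ι ≃ κ) :
    TPow V ι →ₗ[k] TPow V κ :=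
  ∑ ε : ι → Fin 2, koszulSign e (fun i => ((ε i : ℕ) : ℤ)) •
    ((PiTensorProduct.reindex k (fun _ : ι => (V : Type v)) e).toLinearMap ∘ₗ
      PiTensorProduct.map fun i => V.par (ε i))

/-- The differential of `V ^ ⊗ n`. -/
def tensD (n : ℕ) : TPow V (Fin n) →ₗ[k] TPow V (Fin n) :=
  ∑ i : Fin n, PiTensorProduct.map fun j =>
    if j < i then V.sgn else if j = i then V.d else LinearMap.id

/-- The projection of `V ^ ⊗ n` onto its even part (`c = 0`), respectively odd part (`c = 1`). -/
def tensPar (n : ℕ) (c : Fin 2) : TPow V (Fin n) →ₗ[k] TPow V (Fin n) :=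
  ∑ ε : Fin n → Fin 2, if ∑ i, ε i = c then PiTensorProduct.map fun i => V.par (ε i) else 0

/-- The operator on `V ^ ⊗ n` which is `(-1) ^ (q * i)` on the component of degree `i`. -/
def tensSgn (n : ℕ) (q : ℤ) : TPow V (Fin n) →ₗ[k] TPow V (Fin n) :=
  tensPar V n 0 + q.negOnePow • tensPar V n 1

/-- Concatenation of tensors; `⊕ₗ` is the disjoint union, the first summand coming first. -/
def concat (a b : ℕ) : TPow V (Fin a) ⊗[k] TPow V (Fin b) →ₗ[k] TPow V (Fin a ⊕ₗ Fin b) :=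
  (PiTensorProduct.reindex k (fun _ : Fin a ⊕ Fin b => (V : Type v)) toLex).toLinearMap ∘ₗ
    (PiTensorProduct.tmulEquiv (ι := Fin a) (ι₂ := Fin b) k (V : Type v)).toLinearMap

end TensorPowers

/-! ## Inner products of degree `l` and the endomorphism operad -/

/-- An inner product `B : V ⊗ V → k[-l]`, symmetric for `η = 1` and antisymmetric for `η = -1`:
a morphism of chain complexes (so `B (x, y) = 0` unless `deg x + deg y = l`) with
`B (x, y) = η (-1) ^ (deg x * deg y) B (y, x)`. -/
structure InnerProd {k : Type u} [Field k] (V : ChainCx.{u, v} k) (l : ℤ) (η : ℤˣ) where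
  form : V →ₗ[k] V →ₗ[k] k
  form_degree : ∀ (i j : ℤ) (x y : V), x ∈ V.gr i → y ∈ V.gr j → i + j ≠ l → form x y = 0
  form_d : ∀ (i : ℤ) (x y : V), x ∈ V.gr i → form (V.d x) y + i.negOnePow • form x (V.d y) = 0
  form_symm : ∀ (i j : ℤ) (x y : V), x ∈ V.gr i → y ∈ V.gr j →
    form x y = (η * (i * j).negOnePow) • form y x

/-- The identification of the flags of the graph with two vertices and one edge, the flags of the
two vertices being numbered by `1, …, n₁ + 1` and by `1, …, n₂ + 1`: the last flag of the first
vertex is `f` (`= inl false`), the first flag of the second vertex is `f'` (`= inl true`), and the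
other flags are, in order, the legs `1, …, n₁ + n₂`. -/
def pairFlags (n₁ n₂ : ℕ) : Fin (n₁ + 1) ⊕ Fin (n₂ + 1) ≃ Bool ⊕ Fin (n₁ + n₂) where
  toFun := Sum.elim
    (fun i => Fin.lastCases (motive := fun _ => Bool ⊕ Fin (n₁ + n₂)) (Sum.inl false)
      (fun i => Sum.inr (Fin.castAdd n₂ i)) i)
    (fun j => Fin.cases (motive := fun _ => Bool ⊕ Fin (n₁ + n₂)) (Sum.inl true)
      (fun j => Sum.inr (Fin.natAdd n₁ j)) j)
  invFun := Sum.elim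
    (fun c => bif c then Sum.inr 0 else Sum.inl (Fin.last n₁))
    (fun i => Fin.addCases (motive := fun _ => Fin (n₁ + 1) ⊕ Fin (n₂ + 1))
      (fun i => Sum.inl i.castSucc) (fun j => Sum.inr j.succ) i)
  left_inv := by
    rintro (i | j)
    · refine Fin.lastCases ?_ (fun i => ?_) i <;> simp
    · refine Fin.cases ?_ (fun j => ?_) j <;> simp
  right_inv := by
    rintro ((_ | _) | i)
    · simp
    · simp
    · refine Fin.addCases (fun i => ?_) (fun j => ?_) i <;> simp

/-- The identification of the flags of the graph with one vertex and one loop, the flags being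
numbered by `1, …, n + 2`: the flag `n + 1` is `f`, the flag `n + 2` is `f'` and the others are the
legs. -/
def loopFlags (n : ℕ) : Fin (n + 2) ≃ Bool ⊕ Fin n where
  toFun i := Fin.addCases (motive := fun _ => Bool ⊕ Fin n) (fun i => Sum.inr i)
    (fun j : Fin 2 => Sum.inl (decide (j = 1))) i
  invFun := Sum.elim (fun c => Fin.natAdd n (bif c then 1 else 0)) (fun i => Fin.castAdd 2 i)
  left_inv := by
    intro i
    refine Fin.addCases (fun i => ?_) (fun j => ?_) i
    · simp
    · fin_cases j <;> simp
  right_inv := by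
    rintro ((_ | _) | i) <;> simp

section Endomorphism

variable {k : Type u} [Field k] {V : ChainCx.{u, v} k} {l : ℤ} {η : ℤˣ} (B : InnerProd V l η)

/-- The contraction `V_f ⊗ V_f' ⊗ V ^ ⊗ n → V ^ ⊗ n` with `B`. -/
def contractFirst (n : ℕ) : TPow V (Bool ⊕ₗ Fin n) →ₗ[k] TPow V (Fin n) :=
  PiTensorProduct.lift
    { toFun := fun x : Bool ⊕ Fin n → V => B.form (x (Sum.inl false)) (x (Sum.inl true)) •
        PiTensorProduct.tprod k fun i => x (Sum.inr i)
      map_update_add' := by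
        intro inst x i a b
        rcases i with (_ | _) | j
        · simp [add_smul]
        · simp [add_smul]
        · simp [smul_add]
      map_update_smul' := by
        intro inst x i a b
        rcases i with (_ | _) | j
        · simp [mul_smul]
        · simp [mul_smul]
        · simp [smul_comm a] } ∘ₗ
  (PiTensorProduct.reindex k (fun _ : Bool ⊕ₗ Fin n => (V : Type v)) ofLex).toLinearMap

/-- The contraction `o^{ℰ[V]}` of the last factor of the first tensor with the first factor of the
second tensor, a map of degree `-l`. -/
def pairE (n₁ n₂ : ℕ) :
    TPow V (Fin (n₁ + 1)) ⊗[k] TPow V (Fin (n₂ + 1)) →ₗ[k] TPow V (Fin (n₁ + n₂)) :=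
  contractFirst B (n₁ + n₂) ∘ₗ
    koszulMap V ((ofLex.trans (pairFlags n₁ n₂)).trans toLex :
      (Fin (n₁ + 1) ⊕ₗ Fin (n₂ + 1)) ≃ (Bool ⊕ₗ Fin (n₁ + n₂))) ∘ₗ
    concat V (n₁ + 1) (n₂ + 1)

/-- The contraction `ξ^{ℰ[V]}` of the last two factors, a map of degree `-l`. -/
def loopE (n : ℕ) : TPow V (Fin (n + 2)) →ₗ[k] TPow V (Fin n) :=
  contractFirst B n ∘ₗ
    koszulMap V ((loopFlags n).trans toLex : Fin (n + 2) ≃ (Bool ⊕ₗ Fin n))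

end Endomorphism

/-! ## Stable graphs -/

/-- A stable graph `G` with `n` legs marked by `1, …, n` and with `b(G) = b`, together with an
ordering of the set of its vertices, an ordering of the flags at every vertex, an ordering of the
set of its edges and a direction of every edge.

The flags at the vertex `v` are `Fin (val v)`, so the set of all flags is `Σ v, Fin (val v)`, and
`glue` describes the involution: the flag `glue (inl i)` is the `i`-th leg, and
`glue (inr (e, false))`, `glue (inr (e, true))` are the source and the target flag of the edge
`e`. As `G` is connected, `dim H₁(|G|) = |Edge| - |Vert| + 1`. -/
structure StableGraph (n b : ℕ) where
  Vert : Type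
  [vertFintype : Fintype Vert]
  [vertOrder : LinearOrder Vert]
  Edge : Type
  [edgeFintype : Fintype Edge]
  [edgeOrder : LinearOrder Edge]
  val : Vert → ℕ
  gen : Vert → ℕ
  glue : Fin n ⊕ Edge × Bool ≃ Σ v : Vert, Fin (val v)
  stable : ∀ v, 2 < 2 * gen v + val v
  nonempty : Nonempty Vert
  connected : ∀ v v' : Vert, Relation.EqvGen
    (fun u u' => ∃ e, (glue (Sum.inr (e, false))).1 = u ∧ (glue (Sum.inr (e, true))).1 = u') v v'
  genus : b + Fintype.card Vert = (∑ v, gen v) + Fintype.card Edge + 1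

attribute [instance] StableGraph.vertFintype StableGraph.vertOrder StableGraph.edgeFintype
  StableGraph.edgeOrder

namespace StableGraph

/-- The graph `∗_{n,b}` with one vertex and no edges. -/
def corolla (n b : ℕ) (h : 2 < 2 * b + n) : StableGraph n b where
  Vert := Unit
  Edge := Empty
  val _ := n
  gen _ := b
  glue := (Equiv.sumEmpty _ _).trans (Equiv.uniqueSigma fun _ : Unit => Fin n).symm
  stable _ := h
  nonempty := inferInstance
  connected _ _ := Relation.EqvGen.refl _
  genus := by simp

/-- The graph with one vertex, carrying a loop directed from `f` to `f'`. -/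
def loop (n b : ℕ) (h : 2 < 2 * b + (n + 2)) : StableGraph n (b + 1) where
  Vert := Unit
  Edge := Unit
  val _ := n + 2
  gen _ := b
  glue := (((Equiv.sumCongr (Equiv.refl _) (Equiv.punitProd Bool)).trans
    (Equiv.sumComm _ _)).trans (loopFlags n).symm).trans
    (Equiv.uniqueSigma fun _ : Unit => Fin (n + 2)).symm
  stable _ := h
  nonempty := inferInstance
  connected _ _ := Relation.EqvGen.refl _
  genus := by simp

/-- The graph with two vertices, connected by an edge directed from `f` to `f'`. -/
def pair (n₁ n₂ b₁ b₂ : ℕ) (h₁ : 2 < 2 * b₁ + (n₁ + 1)) (h₂ : 2 < 2 * b₂ + (n₂ + 1)) :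
    StableGraph (n₁ + n₂) (b₁ + b₂) where
  Vert := Bool
  Edge := Unit
  val v := bif v then n₂ + 1 else n₁ + 1
  gen v := bif v then b₂ else b₁
  glue := (((Equiv.sumCongr (Equiv.refl _) (Equiv.punitProd Bool)).trans
    (Equiv.sumComm _ _)).trans (pairFlags n₁ n₂).symm).trans
    { toFun := Sum.elim (fun i => ⟨false, i⟩) (fun j => ⟨true, j⟩)
      invFun := fun q => match q with
        | ⟨false, i⟩ => Sum.inl i
        | ⟨true, j⟩ => Sum.inr j
      left_inv := by rintro (i | j) <;> rfl
      right_inv := by rintro ⟨_ | _, i⟩ <;> rfl }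
  stable v := by cases v <;> assumption
  nonempty := inferInstance
  connected v v' := by
    have h : Relation.EqvGen (fun u u' : Bool => u = false ∧ u' = true) false true :=
      Relation.EqvGen.rel _ _ ⟨rfl, rfl⟩
    have hm : ∀ u u' : Bool, Relation.EqvGen (fun u u' : Bool => u = false ∧ u' = true) u u' := by
      rintro (_ | _) (_ | _)
      exacts [Relation.EqvGen.refl _, h, Relation.EqvGen.symm _ _ h, Relation.EqvGen.refl _]
    refine Relation.EqvGen.mono ?_ v v' (hm v v')
    rintro u u' ⟨rfl, rfl⟩
    refine ⟨(), ?_, ?_⟩ <;> simp [pairFlags]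
  genus := by
    simp only [Fintype.card_bool, Fintype.univ_bool, Finset.mem_singleton, Bool.true_eq_false,
      not_false_eq_true, Finset.sum_insert, Finset.sum_singleton, cond_true, cond_false,
      Fintype.card_unit]
    omega

/-- Substitution of graphs `Gs v` into the vertices of a graph `H`: the graph `G` with a set `J` of
edges such that `G / J = H` and such that `Gs v` is the preimage of `v` under `G → G / J`. The
vertices are ordered lexicographically, and so are the edges, the edges of `H` coming first. -/
def subst {n b : ℕ} (H : StableGraph n b) (Gs : ∀ v : H.Vert, StableGraph (H.val v) (H.gen v)) :
    StableGraph n b where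
  Vert := Σₗ v : H.Vert, (Gs v).Vert
  Edge := H.Edge ⊕ₗ (Σₗ v : H.Vert, (Gs v).Edge)
  val x := (Gs (ofLex x).1).val (ofLex x).2
  gen x := (Gs (ofLex x).1).gen (ofLex x).2
  glue :=
    calc Fin n ⊕ (H.Edge ⊕ₗ (Σₗ v : H.Vert, (Gs v).Edge)) × Bool
      _ ≃ Fin n ⊕ (H.Edge ⊕ (Σ v : H.Vert, (Gs v).Edge)) × Bool :=
          Equiv.sumCongr (Equiv.refl _) (Equiv.prodCongr
            (ofLex.trans (Equiv.sumCongr (Equiv.refl _) ofLex)) (Equiv.refl _))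
      _ ≃ Fin n ⊕ (H.Edge × Bool ⊕ (Σ v : H.Vert, (Gs v).Edge) × Bool) :=
          Equiv.sumCongr (Equiv.refl _) (Equiv.sumProdDistrib _ _ _)
      _ ≃ (Fin n ⊕ H.Edge × Bool) ⊕ (Σ v : H.Vert, (Gs v).Edge) × Bool :=
          (Equiv.sumAssoc _ _ _).symm
      _ ≃ (Σ v : H.Vert, Fin (H.val v)) ⊕ (Σ v : H.Vert, (Gs v).Edge × Bool) :=
          Equiv.sumCongr H.glue (Equiv.sigmaProdDistrib _ _)
      _ ≃ Σ v : H.Vert, (Fin (H.val v) ⊕ (Gs v).Edge × Bool) :=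
          (Equiv.sigmaSumDistrib _ _).symm
      _ ≃ Σ v : H.Vert, Σ u : (Gs v).Vert, Fin ((Gs v).val u) :=
          Equiv.sigmaCongrRight fun v => (Gs v).glue
      _ ≃ Σ x : (Σ v : H.Vert, (Gs v).Vert), Fin ((Gs x.1).val x.2) :=
          (Equiv.sigmaAssoc fun v u => Fin ((Gs v).val u)).symm
      _ ≃ Σ x : (Σₗ v : H.Vert, (Gs v).Vert), Fin ((Gs (ofLex x).1).val (ofLex x).2) :=
          Equiv.sigmaCongrLeft' toLex
  stable x := (Gs (ofLex x).1).stable (ofLex x).2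
  nonempty := by
    obtain ⟨v⟩ := H.nonempty
    obtain ⟨u⟩ := (Gs v).nonempty
    exact ⟨toLex ⟨v, u⟩⟩
  connected := by
    set R : (Σₗ v : H.Vert, (Gs v).Vert) → (Σₗ v : H.Vert, (Gs v).Vert) → Prop := _
    change ∀ x y, Relation.EqvGen R x y
    have h1 : ∀ (v : H.Vert) (a a' : (Gs v).Vert),
        Relation.EqvGen R (toLex ⟨v, a⟩) (toLex ⟨v, a'⟩) := by
      intro v a a'
      induction (Gs v).connected a a' with
      | rel u u' h =>
        obtain ⟨e, rfl, rfl⟩ := h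
        exact Relation.EqvGen.rel _ _ ⟨toLex (Sum.inr (toLex ⟨v, e⟩)), rfl, rfl⟩
      | refl u => exact Relation.EqvGen.refl _
      | symm u u' _ ih => exact Relation.EqvGen.symm _ _ ih
      | trans u u' u'' _ _ ih ih' => exact Relation.EqvGen.trans _ _ _ ih ih'
    have h2 : ∀ (v v' : H.Vert), ∃ (a : (Gs v).Vert) (a' : (Gs v').Vert),
        Relation.EqvGen R (toLex ⟨v, a⟩) (toLex ⟨v', a'⟩) := by
      intro v v'
      induction H.connected v v' with
      | rel u u' h =>
        obtain ⟨e, rfl, rfl⟩ := h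
        exact ⟨_, _, Relation.EqvGen.rel _ _ ⟨toLex (Sum.inl e), rfl, rfl⟩⟩
      | refl u =>
        obtain ⟨a⟩ := (Gs u).nonempty
        exact ⟨a, a, Relation.EqvGen.refl _⟩
      | symm u u' _ ih =>
        obtain ⟨a, a', h⟩ := ih
        exact ⟨a', a, Relation.EqvGen.symm _ _ h⟩
      | trans u u' u'' _ _ ih ih' =>
        obtain ⟨a, a', h⟩ := ih
        obtain ⟨c, c', h'⟩ := ih'
        exact ⟨a, c', Relation.EqvGen.trans _ _ _ h (Relation.EqvGen.trans _ _ _ (h1 _ _ _) h')⟩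
    rintro ⟨v, a⟩ ⟨v', a'⟩
    obtain ⟨c, c', h⟩ := h2 v v'
    exact Relation.EqvGen.trans _ _ _ (h1 v a c) (Relation.EqvGen.trans _ _ _ h (h1 v' c' a'))
  genus := by
    have h := fun v => (Gs v).genus
    have hs := Finset.sum_congr (rfl : (Finset.univ : Finset H.Vert) = _) fun v _ => h v
    simp only [Finset.sum_add_distrib, Finset.sum_const, Finset.card_univ, smul_eq_mul,
      mul_one] at hs
    have hg := H.genus
    have e1 : (∑ x : (Σₗ v : H.Vert, (Gs v).Vert), (Gs (ofLex x).1).gen (ofLex x).2) =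
        ∑ v, ∑ u, (Gs v).gen u := by
      rw [← Fintype.sum_sigma']
      exact Fintype.sum_equiv ofLex _ _ fun _ => rfl
    rw [e1]
    simp only [Fintype.card_lex, Fintype.card_sum, Fintype.card_sigma]
    omega

/-- A bijection of the vertices, of the flags and of the edges of two graphs which preserves the
structure of the graph and the numbers `b(v)`, changes the marking of the legs by the permutation
`leg`, and reverses the direction of the edges `e` with `flip e = true`. -/
structure Iso {n b : ℕ} (G G' : StableGraph n b) where
  vert : G.Vert ≃ G'.Vert
  edge : G.Edge ≃ G'.Edge
  flip : G.Edge → Bool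
  leg : Equiv.Perm (Fin n)
  flag : ∀ v, Fin (G.val v) ≃ Fin (G'.val (vert v))
  gen_eq : ∀ v, G.gen v = G'.gen (vert v)
  glue_leg : ∀ i, G'.glue (Sum.inl (leg i)) =
    ⟨vert (G.glue (Sum.inl i)).1, flag _ (G.glue (Sum.inl i)).2⟩
  glue_edge : ∀ e c, G'.glue (Sum.inr (edge e, xor (flip e) c)) =
    ⟨vert (G.glue (Sum.inr (e, c))).1, flag _ (G.glue (Sum.inr (e, c))).2⟩

end StableGraph

/-! ## Twisted modular operads -/

/-- A stable `𝕊`-module: chain complexes `P((n,b))` with an action of `𝕊_n`, which vanish unless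
`2b + n - 2 > 0`. -/
structure StableSModule (k : Type u) [Field k] where
  obj : ℕ → ℕ → ChainCx.{u, w} k
  act : ∀ n b, Representation k (Equiv.Perm (Fin n)) (obj n b)
  act_mem : ∀ n b (σ : Equiv.Perm (Fin n)) (i : ℤ) (x : obj n b),
    x ∈ (obj n b).gr i → act n b σ x ∈ (obj n b).gr i
  act_d : ∀ n b (σ : Equiv.Perm (Fin n)) (x : obj n b),
    (obj n b).d (act n b σ x) = act n b σ ((obj n b).d x)
  unstable : ∀ n b, ¬ 2 < 2 * b + n → Subsingleton (obj n b)

namespace StableSModule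

variable {k : Type u} [Field k] (P : StableSModule.{u, w} k)

/-- The map `P((n,b)) → P((n',b'))` attached to a bijection `Fin n ≃ Fin n'` (so that `n = n'`),
when `b = b'`. -/
def transport {n n' b b' : ℕ} (e : Fin n ≃ Fin n') (h : b = b') : P.obj n b →ₗ[k] P.obj n' b' := by
  have hn : n = n' := Fin.equiv_iff_eq.1 ⟨e⟩
  subst hn
  subst h
  exact P.act n b e

end StableSModule

/-- The composition maps of a twisted modular operad, for the cocycle
`D(G) = ⨂_{e ∈ Edge(G)} L_e`, where the line `L_e` of the edge `e` is in degree `p` and is spanned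
by any of the two directions of `e`, which differ by the sign `η`; the tensor product over the set
of edges is the unordered one of the symmetric monoidal category of graded vector spaces.
With `e[1]` the generator of `Det({e})`, of degree `-1`:
* for `η = 1`, `L_e` is spanned by `e[1] ^ ⊗ (-p)`, so `D = 𝒦 ^ ⊗ (-p)`;
* for `η = -1`, `L_e` is spanned by `e[1] ^ ⊗ (-p - 2) ⊗ (s_e[1] ∧ t_e[1])`, where `s_e`, `t_e` are
  the two flags of `e`, so `D = 𝒦 ^ ⊗ (-p - 2) ℒ`.

An ordering and a direction of the edges of `G` determine a generator of the line `D(G)`, which has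
degree `p |Edge(G)|`; `comp G` is the map `μ_G : D(G) ⊗ P((G)) → P((n,b))` evaluated on this
generator. The axiom `comp_iso` contains both that `μ_G` is well defined on `D(G) ⊗ P((G))` (that it
does not depend on the orderings and the directions) and that it is equivariant. -/
structure TwistedModularOperad (k : Type u) [Field k] (p : ℤ) (η : ℤˣ) extends
    StableSModule.{u, w} k where
  comp : ∀ {n b : ℕ} (G : StableGraph n b),
    MultilinearMap k (fun v : G.Vert => obj (G.val v) (G.gen v)) (obj n b)
  comp_mem : ∀ {n b : ℕ} (G : StableGraph n b) (i : G.Vert → ℤ)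
    (x : ∀ v, obj (G.val v) (G.gen v)), (∀ v, x v ∈ (obj _ _).gr (i v)) →
      comp G x ∈ (obj n b).gr (p * Fintype.card G.Edge + ∑ v, i v)
  comp_d : ∀ {n b : ℕ} (G : StableGraph n b) (i : G.Vert → ℤ)
    (x : ∀ v, obj (G.val v) (G.gen v)), (∀ v, x v ∈ (obj _ _).gr (i v)) →
      (obj n b).d (comp G x) = ∑ v, (p * Fintype.card G.Edge + ∑ u with u < v, i u).negOnePow •
        comp G (update x v ((obj _ _).d (x v)))
  comp_corolla : ∀ (n b : ℕ) (h : 2 < 2 * b + n) (x : obj n b),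
    comp (StableGraph.corolla n b h) (fun _ => x) = x
  comp_iso : ∀ {n b : ℕ} (G G' : StableGraph n b) (φ : G.Iso G') (i : G.Vert → ℤ)
    (x : ∀ v, obj (G.val v) (G.gen v)) (x' : ∀ v, obj (G'.val v) (G'.gen v)),
    (∀ v, x v ∈ (obj _ _).gr (i v)) →
    (∀ v, x' (φ.vert v) = toStableSModule.transport (φ.flag v) (φ.gen_eq v) (x v)) →
      comp G' x' = (koszulSign φ.edge (fun _ => p) * (∏ e, if φ.flip e then η else 1) *
        koszulSign φ.vert i) • act n b φ.leg (comp G x)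
  comp_assoc : ∀ {n b : ℕ} (H : StableGraph n b)
    (Gs : ∀ v : H.Vert, StableGraph (H.val v) (H.gen v)) (i : ∀ v, (Gs v).Vert → ℤ)
    (x : ∀ v (a : (Gs v).Vert), obj ((Gs v).val a) ((Gs v).gen a)),
    (∀ v a, x v a ∈ (obj _ _).gr (i v a)) →
      comp (H.subst Gs) (fun q => x (ofLex q).1 (ofLex q).2) =
        (∑ v, (p * Fintype.card (Gs v).Edge) * ∑ u with u < v, ∑ a, i u a).negOnePow •
          comp H (fun v => comp (Gs v) (x v))

namespace TwistedModularOperad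

variable {k : Type u} [Field k] {p : ℤ} {η : ℤˣ} (P : TwistedModularOperad.{u, w} k p η)

/-- The composition `ξ^P` along the graph with one vertex and one loop, evaluated on the generator
of `D(G)` given by its only edge, directed from `f` to `f'`. -/
def loopP (n b : ℕ) : P.obj (n + 2) b →ₗ[k] P.obj n (b + 1) :=
  if h : 2 < 2 * b + (n + 2) then
    { toFun := fun x => P.comp (StableGraph.loop n b h) (fun _ => x)
      map_add' := fun x y => by
        have h' := fun z : P.obj (n + 2) b => (funext fun _ => rfl :
          update (fun _ : Unit => (0 : P.obj (n + 2) b)) () z = fun _ => z)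
        have := (P.comp (StableGraph.loop n b h)).map_update_add (fun _ => 0) () x y
        exact ((congrArg _ (h' _)).symm.trans this).trans
          (congrArg₂ (· + ·) (congrArg _ (h' x)) (congrArg _ (h' y)))
      map_smul' := fun c x => by
        have h' := fun z : P.obj (n + 2) b => (funext fun _ => rfl :
          update (fun _ : Unit => (0 : P.obj (n + 2) b)) () z = fun _ => z)
        have := (P.comp (StableGraph.loop n b h)).map_update_smul (fun _ => 0) () c x
        exact ((congrArg _ (h' _)).symm.trans this).trans (congrArg (c • ·) (congrArg _ (h' x))) }
  else 0

/-- The labelling of the two vertices of the graph `StableGraph.pair` by `x` and `y`. -/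
def pairLabel {n₁ n₂ b₁ b₂ : ℕ} (x : P.obj n₁ b₁) (y : P.obj n₂ b₂) :
    ∀ v : Bool, P.obj (bif v then n₂ else n₁) (bif v then b₂ else b₁)
  | false => x
  | true => y

/-- The composition `o^P` along the graph with two vertices and one edge, evaluated on the generator
of `D(G)` given by its only edge, directed from `f` to `f'`. -/
def pairP (n₁ n₂ b₁ b₂ : ℕ) :
    P.obj (n₁ + 1) b₁ →ₗ[k] P.obj (n₂ + 1) b₂ →ₗ[k] P.obj (n₁ + n₂) (b₁ + b₂) :=
  if h : 2 < 2 * b₁ + (n₁ + 1) ∧ 2 < 2 * b₂ + (n₂ + 1) then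
    let G := StableGraph.pair n₁ n₂ b₁ b₂ h.1 h.2
    have hx : ∀ x x' y, P.pairLabel x' y = update (P.pairLabel x y) false x' := fun x x' y => by
      funext v; cases v <;> rfl
    have hy : ∀ x y y', P.pairLabel x y' = update (P.pairLabel x y) true y' := fun x y y' => by
      funext v; cases v <;> rfl
    LinearMap.mk₂ k (fun x y => P.comp G (P.pairLabel x y))
      (fun x x' y => by
        have := (P.comp G).map_update_add (P.pairLabel 0 y) false x x'
        rw [hx 0 x y, hx 0 x' y, hx 0 (x + x') y]
        exact this)
      (fun c x y => by
        have := (P.comp G).map_update_smul (P.pairLabel 0 y) false c x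
        rw [hx 0 x y, hx 0 (c • x) y]
        exact this)
      (fun x y y' => by
        have := (P.comp G).map_update_add (P.pairLabel x 0) true y y'
        rw [hy x 0 y, hy x 0 y', hy x 0 (y + y')]
        exact this)
      (fun c x y => by
        have := (P.comp G).map_update_smul (P.pairLabel x 0) true c y
        rw [hy x 0 y, hy x 0 (c • y)]
        exact this)
  else 0

end TwistedModularOperad

/-! ## The graded vector space `F` and its operations -/

section Main

variable {k : Type u} [Field k] {l : ℤ} {η : ℤˣ} {V : ChainCx.{u, v} k}
  (B : InnerProd V l η) (P : TwistedModularOperad.{u, w} k (l - 1) η)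

variable (V) in
/-- `V ^ ⊗ n ⊗ P((n,b))`. -/
abbrev Term (n b : ℕ) : Type (max u v w) := TPow V (Fin n) ⊗[k] P.obj n b

variable (V) in
/-- `⨁_{n,b} V ^ ⊗ n ⊗ P((n,b))`. -/
abbrev Terms : Type (max u v w) := ⨁ q : ℕ × ℕ, Term V P q.1 q.2

variable (V) in
/-- The component of degree `i` of `V ^ ⊗ n ⊗ P((n,b))`. -/
def termGr (n b : ℕ) (i : ℤ) : Submodule k (Term V P n b) :=
  Submodule.span k {t | ∃ (x : Fin n → V) (y : P.obj n b) (deg : Fin n → ℤ) (j : ℤ),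
    (∀ m, x m ∈ V.gr (deg m)) ∧ y ∈ (P.obj n b).gr j ∧ (∑ m, deg m) + j = i ∧
      t = PiTensorProduct.tprod k x ⊗ₜ[k] y}

variable (V) in
/-- The diagonal action of `𝕊_n` on `V ^ ⊗ n ⊗ P((n,b))`. -/
def termAct (n b : ℕ) (σ : Equiv.Perm (Fin n)) : Term V P n b →ₗ[k] Term V P n b :=
  TensorProduct.map (koszulMap V σ) (P.act n b σ)

variable (V) in
/-- The component of degree `i` of `F = ⨁_{n,b} (V ^ ⊗ n ⊗ P((n,b))) ^ 𝕊_n`. -/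
def FGr (i : ℤ) : Submodule k (Terms V P) where
  carrier := {m | ∀ q : ℕ × ℕ, m q ∈ termGr V P q.1 q.2 i ∧ ∀ σ, termAct V P q.1 q.2 σ (m q) = m q}
  zero_mem' q := ⟨by simp, by simp⟩
  add_mem' ha hb q := ⟨by simpa using add_mem (ha q).1 (hb q).1, by
    intro σ; rw [DirectSum.add_apply, map_add, (ha q).2 σ, (hb q).2 σ]⟩
  smul_mem' c m ha q := ⟨by
    rw [DirectSum.smul_apply]; exact Submodule.smul_mem _ c (ha q).1, by
    intro σ; rw [DirectSum.smul_apply, map_smul, (ha q).2 σ]⟩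

variable (V) in
/-- `d_V + d_P` on `V ^ ⊗ n ⊗ P((n,b))`:
`x ⊗ y ↦ d x ⊗ y + (-1) ^ deg x • x ⊗ d y`. -/
def termD (n b : ℕ) : Term V P n b →ₗ[k] Term V P n b :=
  TensorProduct.map (tensD V n) LinearMap.id +
    TensorProduct.map (tensSgn V n 1) (P.obj n b).d

/-- `ξ^{ℰ[V]} ⊗ ξ^P : x ⊗ y ↦ (-1) ^ ((l - 1) * deg x) • ξ^{ℰ[V]} x ⊗ ξ^P y`; here `ξ^P` has degree
`l - 1`. -/
def termLoop (n b : ℕ) : Term V P (n + 2) b →ₗ[k] Term V P n (b + 1) :=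
  TensorProduct.map (loopE B n ∘ₗ tensSgn V (n + 2) (l - 1)) (P.loopP n b)

variable (V) in
/-- The symmetry isomorphism `(x₁ ⊗ y₁) ⊗ (x₂ ⊗ y₂) ↦ (-1) ^ (deg y₁ * deg x₂) •
(x₁ ⊗ x₂) ⊗ (y₁ ⊗ y₂)`. -/
def termSwap (n₁ n₂ b₁ b₂ : ℕ) : Term V P n₁ b₁ ⊗[k] Term V P n₂ b₂ →ₗ[k]
    (TPow V (Fin n₁) ⊗[k] TPow V (Fin n₂)) ⊗[k] (P.obj n₁ b₁ ⊗[k] P.obj n₂ b₂) :=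
  (TensorProduct.tensorTensorTensorComm k (TPow V (Fin n₁)) (P.obj n₁ b₁) (TPow V (Fin n₂))
    (P.obj n₂ b₂)).toLinearMap ∘ₗ
  ∑ a : Fin 2, ∑ c : Fin 2, (((a : ℕ) : ℤ) * ((c : ℕ) : ℤ)).negOnePow •
    TensorProduct.map (TensorProduct.map LinearMap.id ((P.obj n₁ b₁).par a))
      (TensorProduct.map (tensPar V n₂ c) LinearMap.id)

/-- `o^{ℰ[V]} ⊗ o^P : (x₁ ⊗ y₁) ⊗ (x₂ ⊗ y₂) ↦ (-1) ^ (deg y₁ * deg x₂ + (l - 1) * (deg x₁ + deg x₂)) •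
o^{ℰ[V]} (x₁ ⊗ x₂) ⊗ o^P (y₁ ⊗ y₂)`; here `o^P` has degree `l - 1`. -/
def termPair (n₁ n₂ b₁ b₂ : ℕ) : Term V P (n₁ + 1) b₁ ⊗[k] Term V P (n₂ + 1) b₂ →ₗ[k]
    Term V P (n₁ + n₂) (b₁ + b₂) :=
  TensorProduct.map
      (pairE B n₁ n₂ ∘ₗ TensorProduct.map (tensSgn V (n₁ + 1) (l - 1)) (tensSgn V (n₂ + 1) (l - 1)))
      (TensorProduct.lift (P.pairP n₁ n₂ b₁ b₂)) ∘ₗ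
    termSwap V P (n₁ + 1) (n₂ + 1) b₁ b₂

/-- The symmetrization `(1 / (n₁! n₂!)) ∑_σ σ (o^{ℰ[V]} ⊗ o^P)`. -/
def termPairSym (n₁ n₂ b₁ b₂ : ℕ) : Term V P (n₁ + 1) b₁ ⊗[k] Term V P (n₂ + 1) b₂ →ₗ[k]
    Term V P (n₁ + n₂) (b₁ + b₂) :=
  (((n₁.factorial : k) * (n₂.factorial : k))⁻¹ •
    ∑ σ : Equiv.Perm (Fin (n₁ + n₂)), termAct V P (n₁ + n₂) (b₁ + b₂) σ) ∘ₗ termPair B P n₁ n₂ b₁ b₂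

variable (V) in
/-- The inclusion of a summand into `⨁_{n,b} V ^ ⊗ n ⊗ P((n,b))`. -/
def incl (n b : ℕ) : Term V P n b →ₗ[k] Terms V P :=
  DirectSum.lof k (ℕ × ℕ) (fun q => Term V P q.1 q.2) (n, b)

variable (V) in
/-- `d_V + d_P` on `⨁_{n,b} V ^ ⊗ n ⊗ P((n,b))`. -/
def totalD : Terms V P →ₗ[k] Terms V P :=
  DirectSum.toModule k (ℕ × ℕ) (Terms V P) fun q => incl V P q.1 q.2 ∘ₗ termD V P q.1 q.2

/-- The restriction of `totalLoop` to a summand. -/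
def totalLoopAux : ∀ n b : ℕ, Term V P n b →ₗ[k] Terms V P
  | 0, _ => 0
  | 1, _ => 0
  | n + 2, b => incl V P n (b + 1) ∘ₗ termLoop B P n b

/-- `ξ^{ℰ[V]} ⊗ ξ^P` on `⨁_{n,b} V ^ ⊗ n ⊗ P((n,b))` (zero on the summands with `n < 2`). -/
def totalLoop : Terms V P →ₗ[k] Terms V P :=
  DirectSum.toModule k (ℕ × ℕ) (Terms V P) fun q => totalLoopAux B P q.1 q.2

/-- The restriction of `totalPair` to a pair of summands. -/
def totalPairAux : ∀ n₁ b₁ n₂ b₂ : ℕ, Term V P n₁ b₁ →ₗ[k] Term V P n₂ b₂ →ₗ[k] Terms V P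
  | 0, _, _, _ => 0
  | _ + 1, _, 0, _ => 0
  | n₁ + 1, b₁, n₂ + 1, b₂ =>
    (TensorProduct.mk k (Term V P (n₁ + 1) b₁) (Term V P (n₂ + 1) b₂)).compr₂
      (incl V P (n₁ + n₂) (b₁ + b₂) ∘ₗ termPairSym B P n₁ n₂ b₁ b₂)

/-- The bilinear extension of `(m₁, m₂) ↦ (1 / (n₁! n₂!)) ∑_σ σ (o^{ℰ[V]} ⊗ o^P) (m₁ ⊗ m₂)`, for
`m_i` in `V ^ ⊗ (n_i + 1) ⊗ P((n_i + 1,b_i))`, to `⨁_{n,b} V ^ ⊗ n ⊗ P((n,b))` (zero if one of the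
arguments lies in a summand with `n = 0`). -/
def totalPair : Terms V P →ₗ[k] Terms V P →ₗ[k] Terms V P :=
  DirectSum.toModule k (ℕ × ℕ) (Terms V P →ₗ[k] Terms V P) fun q₁ =>
    (DirectSum.toModule k (ℕ × ℕ) (Term V P q₁.1 q₁.2 →ₗ[k] Terms V P) fun q₂ =>
      (totalPairAux B P q₁.1 q₁.2 q₂.1 q₂.2).flip).flip

/-- The left-hand side of the equation on `m = ∑_{n,b} m_{n,b}` which describes the algebras over the
Feynman transform of `P`:
`(d_P + d_V) m - (B ⊗ ξ^P) m - 1/2 ∑ (1 / (n₁! n₂!)) ∑_σ σ (B ⊗ o^P) (m ⊗ m)`. -/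
def feynmanEq (m : Terms V P) : Terms V P :=
  totalD V P m - totalLoop B P m - (2⁻¹ : k) • totalPair B P m m

variable (V) in
/-- The differential `m ↦ (-1) ^ (deg m + 1) (d_V + d_P) m` on the component of degree `i`. -/
def diffD (i : ℤ) : Terms V P →ₗ[k] Terms V P := (i + 1).negOnePow • totalD V P

/-- The operator `Δ m = (-1) ^ deg m (ξ^{ℰ[V]} ⊗ ξ^P) m` on the component of degree `i`. -/
def bvDelta (i : ℤ) : Terms V P →ₗ[k] Terms V P := i.negOnePow • totalLoop B P

/-- The odd bracket `{m₁, m₂} = (-1) ^ (deg m₁ deg m₂) / (n₁! n₂!) ∑_σ σ (o^{ℰ[V]} ⊗ o^P) (m₁ ⊗ m₂)`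
on the components of degree `i` and `j`. -/
def oddBracket (i j : ℤ) : Terms V P →ₗ[k] Terms V P →ₗ[k] Terms V P :=
  (i * j).negOnePow • totalPair B P

end Main

/-! ## Differential graded Lie algebras -/

/-- The graded vector space with components `L j`, `j : ℤ` (subspaces of an ambient space `A`, used
only to compare elements), is a differential graded Lie algebra with the differential
`d j : L j → L (j - 1)` and the bracket `br i j : L i × L j → L (i + j)`. -/
structure IsDGLieAlgebra {k : Type u} [Field k] {A : Type v} [AddCommGroup A] [Module k A]
    (L : ℤ → Submodule k A) (d : ℤ → A →ₗ[k] A) (br : ℤ → ℤ → A →ₗ[k] A →ₗ[k] A) : Prop where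
  d_mem : ∀ (i : ℤ) (x : A), x ∈ L i → d i x ∈ L (i - 1)
  br_mem : ∀ (i j : ℤ) (x y : A), x ∈ L i → y ∈ L j → br i j x y ∈ L (i + j)
  d_d : ∀ (i : ℤ) (x : A), x ∈ L i → d (i - 1) (d i x) = 0
  antisymm : ∀ (i j : ℤ) (x y : A), x ∈ L i → y ∈ L j →
    br i j x y = -((i * j).negOnePow • br j i y x)
  jacobi : ∀ (i j m : ℤ) (x y z : A), x ∈ L i → y ∈ L j → z ∈ L m →
    br i (j + m) x (br j m y z) =
      br (i + j) m (br i j x y) z + (i * j).negOnePow • br j (i + m) y (br i m x z)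
  leibniz : ∀ (i j : ℤ) (x y : A), x ∈ L i → y ∈ L j →
    d (i + j) (br i j x y) = br (i - 1) j (d i x) y + i.negOnePow • br i (j - 1) x (d j y)

section Shift

variable {k : Type u} [Field k] {A : Type v} [AddCommGroup A] [Module k A]

/-- The shift `F[1]` of a graded vector space, `F[1]_j = F_{j+1}`. -/
def shiftGr (F : ℤ → Submodule k A) (j : ℤ) : Submodule k A := F (j + 1)

/-- An operator on `F`, given on every homogeneous component, as an operator on `F[1]`. -/
def shiftOp (d : ℤ → A →ₗ[k] A) (j : ℤ) : A →ₗ[k] A := d (j + 1)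

/-- The bracket `[x, y] = (-1) ^ deg y {x, y}` on `F[1]` attached to an odd bracket `{x, y}` (of
degree `-1`) on `F`, where `deg y` is the degree of `y` in `F`. -/
def shiftBracket (br : ℤ → ℤ → A →ₗ[k] A →ₗ[k] A) (i j : ℤ) : A →ₗ[k] A →ₗ[k] A :=
  (j + 1).negOnePow • br (i + 1) (j + 1)

end Shift

end

noncomputable section

/-! ## Signs -/

/-! Everything rests on one sign. Contracting a pair of flags acts on `V ^ ⊗ n` with degree `-l` and
on `P` with degree `l - 1`, hence on the tensor product with degree `-1`. If two edges are
contracted in the opposite order, the sign is `(-1) ^ l` on the first factor, because each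
contracted pair has total degree `l` (`contractTwo_swapEdges`). On the second factor it is `(-1) ^
(l - 1)`, because the line of an edge in the cocycle has degree `l - 1` (`comp_swapEdges`). The
product is `-1`: contractions along different edges anticommute. Reversing the direction of an edge
costs `η` on both factors and hence nothing in total, and a contraction anticommutes with `d_V +
d_P`.

To use this, contractions are defined for an arbitrary bijection `e` from the flags to `Bool ⊕ Fin
n`, where `Bool` is the set of the two ends of the edge (`termGlue`, `termSelfGlue`). Comparing two
ways of gluing then means comparing two bijections. On invariant elements the position of the edge
and the numbering of the legs become irrelevant after summing over permutations (`avg_termGlue_eq`,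
`termSelfGlue_eq`), so the standard identifications of the statement can be replaced by whichever is
convenient. Counting the permutations with a prescribed effect on one or two flags accounts for the
factorials (`totalPair_avg_incl`, `totalLoop_avg`).

The identities follow. `Δ² = 0` (`totalLoop_totalLoop`): exchanging two loops changes the sign, but
by invariance it changes nothing else. `Δ` is a derivation (`totalLoop_totalPair_incl`): the loop
added to a contraction of `s` with `t` has both ends on `s`, both on `t`, or one on each. The first
two kinds give the brackets with `Δ s` and `Δ t`. The third gives a double edge between `s` and `t`
and vanishes, since its two edges can be exchanged by permuting the flags of the invariant elements
`s` and `t`. Jacobi (`totalPair_jacobi`): a double bracket is a sum over trees with three vertices,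
grouped by the middle vertex (`nest`). Each tree arises twice, with its edges glued in the two
orders, and the two contributions cancel.

These statements concern the unsigned operations `totalD`, `totalLoop`, `totalPair`. The passage to
the signed operations on `F[1]` is formal (`isDGLieAlgebra_shift`). Characteristic zero serves to
divide by factorials and to conclude `x = 0` from `x = -x`. Most sign identities are settled by
passing to exponents in `ZMod 2`, where they are decidable. -/

theorem Int.negOnePow_eq_of_zmod {a b : ℤ} (h : (a : ZMod 2) = b) : a.negOnePow = b.negOnePow := by
  rw [Int.negOnePow_eq_iff]
  have := (ZMod.intCast_eq_intCast_iff_dvd_sub a b 2).1 h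
  have h2 : (2 : ℤ) ∣ a - b := by
    rw [← neg_sub]; exact (dvd_neg).2 (by exact_mod_cast this)
  exact even_iff_two_dvd.2 h2

theorem Int.negOnePow_mul_self' (a : ℤ) : a.negOnePow * a.negOnePow = 1 := by
  rw [← Int.negOnePow_add]; exact Int.negOnePow_even _ ⟨a, rfl⟩

theorem Int.negOnePow_sum {ι : Type*} (s : Finset ι) (f : ι → ℤ) :
    (∑ i ∈ s, f i).negOnePow = ∏ i ∈ s, (f i).negOnePow := by
  classical
  induction s using Finset.induction_on with
  | empty => simp
  | insert a s ha ih => rw [Finset.sum_insert ha, Finset.prod_insert ha, Int.negOnePow_add, ih]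

section UnitsSMul

variable {k : Type*} [Field k] {M N L : Type*} [AddCommGroup M] [Module k M] [AddCommGroup N]
  [Module k N] [AddCommGroup L] [Module k L]

theorem LinearMap.map_intUnits_smul (f : M →ₗ[k] N) (s : ℤˣ) (x : M) : f (s • x) = s • f x := by
  rw [Units.smul_def, Units.smul_def, map_zsmul]

theorem LinearMap.map_intUnits_smul₂ (f : M →ₗ[k] N →ₗ[k] L) (s : ℤˣ) (x : M) (y : N) :
    f (s • x) y = s • f x y := by
  rw [LinearMap.map_intUnits_smul, LinearMap.smul_apply]

theorem LinearMap.intUnits_smul_apply (f : M →ₗ[k] N) (s : ℤˣ) (x : M) : (s • f) x = s • f x := by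
  rw [Units.smul_def, Units.smul_def, LinearMap.smul_apply]

theorem intUnits_smul_zero (s : ℤˣ) : s • (0 : M) = 0 := by
  rw [Units.smul_def, smul_zero]

theorem intUnits_smul_add (s : ℤˣ) (x y : M) : s • (x + y) = s • x + s • y := by
  rw [Units.smul_def, smul_add]; rfl

theorem intUnits_neg_smul (s : ℤˣ) (x : M) : (-s) • x = -(s • x) := by
  rw [Units.smul_def, Units.val_neg, neg_smul]; rfl

theorem intUnits_one_smul (x : M) : (1 : ℤˣ) • x = x := by
  rw [Units.smul_def, Units.val_one, one_smul]

theorem intUnits_mul_smul (s t : ℤˣ) (x : M) : s • t • x = (s * t) • x := by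
  rw [Units.smul_def, Units.smul_def, Units.smul_def, Units.val_mul, mul_smul]

theorem intUnits_smul_sum (s : ℤˣ) {ι : Type*} (S : Finset ι) (f : ι → M) :
    s • ∑ i ∈ S, f i = ∑ i ∈ S, s • f i := by
  rw [Units.smul_def, Finset.smul_sum]; rfl

theorem intUnits_smul_smul (s : ℤˣ) (c : k) (x : M) : s • c • x = c • s • x := by
  rw [Units.smul_def, Units.smul_def, smul_comm]

theorem TensorProduct.intUnits_smul_tmul (s : ℤˣ) (x : M) (y : N) :
    (s • x) ⊗ₜ[k] y = s • (x ⊗ₜ[k] y) :=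
  LinearMap.map_intUnits_smul₂ (TensorProduct.mk k M N) s x y

theorem TensorProduct.tmul_intUnits_smul (s : ℤˣ) (x : M) (y : N) :
    x ⊗ₜ[k] (s • y) = s • (x ⊗ₜ[k] y) :=
  LinearMap.map_intUnits_smul (TensorProduct.mk k M N x) s y

theorem Submodule.intUnits_smul_mem (S : Submodule k M) (s : ℤˣ) {x : M} (hx : x ∈ S) :
    s • x ∈ S := by
  rw [Units.smul_def]; exact zsmul_mem hx _

theorem intUnits_smul_eq_cast_smul (s : ℤˣ) (x : M) : s • x = (((s : ℤ) : k)) • x := by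
  rw [Units.smul_def, Int.cast_smul_eq_zsmul]

end UnitsSMul

/-! ## The Koszul sign -/

section KoszulSign

variable {ι κ μ : Type} [Fintype ι] [LinearOrder ι] [LinearOrder κ] [LinearOrder μ]

/-- After reindexing along a bijection, the pairs that contribute to a Koszul sign are increasing
for the other order. Grouping the factors by unordered pairs makes two such products comparable
factor by factor. -/
theorem prod_prod_eq_prod_lt {M : Type*} [CommMonoid M] (h : ι × ι → M) (hd : ∀ i, h (i, i) = 1) :
    ∏ q, h q = ∏ q : ι × ι, if q.1 < q.2 then h q * h q.swap else 1 := by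
  have h1 : ∏ q, h q = ∏ q : ι × ι, (if q.1 < q.2 then h q else 1) *
      (if q.2 < q.1 then h q else 1) := by
    refine Finset.prod_congr rfl fun q _ => ?_
    rcases lt_trichotomy q.1 q.2 with hq | hq | hq
    · simp [hq, hq.not_gt]
    · have : q = (q.1, q.1) := Prod.ext rfl hq.symm
      rw [this]; simp [hd]
    · simp [hq, hq.not_gt]
  have h2 : (∏ q : ι × ι, if q.2 < q.1 then h q else 1) =
      ∏ q : ι × ι, if q.1 < q.2 then h q.swap else 1 :=
    Fintype.prod_equiv (Equiv.prodComm ι ι) _ _ fun q => by simp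
  rw [h1, Finset.prod_mul_distrib, h2, ← Finset.prod_mul_distrib]
  refine Finset.prod_congr rfl fun q _ => ?_
  split_ifs <;> simp

/-- A pair is reversed by a composite exactly when it is reversed by one of the two bijections and
not by the other. If both reverse it, its sign occurs twice and cancels. -/
theorem koszulSign_trans [Fintype κ] (e : ι ≃ κ) (f : κ ≃ μ) (deg : ι → ℤ) :
    koszulSign (e.trans f) deg = koszulSign e deg * koszulSign f (fun i => deg (e.symm i)) := by
  have h1 : koszulSign f (fun i => deg (e.symm i)) =
      ∏ q : ι × ι, if e q.1 < e q.2 ∧ f (e q.2) < f (e q.1) then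
        (deg q.1 * deg q.2).negOnePow else 1 :=
    (Fintype.prod_equiv (Equiv.prodCongr e e) _ _ fun q => by simp).symm
  rw [h1, prod_prod_eq_prod_lt (fun q : ι × ι => if e q.1 < e q.2 ∧ f (e q.2) < f (e q.1) then
        (deg q.1 * deg q.2).negOnePow else 1) (by simp), koszulSign, koszulSign,
    ← Finset.prod_mul_distrib]
  refine Finset.prod_congr rfl fun q _ => ?_
  by_cases hq : q.1 < q.2
  · have hne : e q.1 ≠ e q.2 := fun h => hq.ne (e.injective h)
    have hne' : f (e q.1) ≠ f (e q.2) := fun h => hne (f.injective h)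
    have hs := Int.negOnePow_mul_self' (deg q.1 * deg q.2)
    rcases hne.lt_or_gt with h | h <;> rcases hne'.lt_or_gt with h' | h' <;>
      simp [hq, h, h', h.not_gt, h'.not_gt, mul_comm (deg q.2), hs]
  · simp [hq]

theorem koszulSign_eq_one_of_strictMono (e : ι ≃ κ) (he : ∀ i j, i < j → e i < e j)
    (deg : ι → ℤ) : koszulSign e deg = 1 := by
  refine Finset.prod_eq_one fun q _ => if_neg ?_
  rintro ⟨h, h'⟩
  exact h'.not_gt (he _ _ h)

/-- This replaces the `Fin 2`-valued parities in `koszulMap` by actual degrees. -/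
theorem koszulSign_congr_deg (e : ι ≃ κ) {deg deg' : ι → ℤ}
    (h : ∀ i, ((deg i : ℤ) : ZMod 2) = deg' i) : koszulSign e deg = koszulSign e deg' := by
  refine Finset.prod_congr rfl fun q _ => ?_
  rw [Int.negOnePow_eq_of_zmod (a := deg q.1 * deg q.2) (b := deg' q.1 * deg' q.2)]
  push_cast
  rw [h, h]

/-- Changing the degree of the factor `i` by one changes the Koszul sign by the sign of moving an
odd element past the factors whose order relative to `i` is reversed. -/
theorem koszulSign_update (e : ι ≃ κ) (deg : ι → ℤ) (i : ι) :
    koszulSign e (update deg i (deg i - 1)) * (∑ j with e j < e i, deg j).negOnePow =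
      koszulSign e deg * (∑ j with j < i, deg j).negOnePow := by
  -- `T` collects `(-1) ^ deg j` over the `j` whose order relative to `i` is reversed. It is the
  -- quotient of the two Koszul signs, since `(deg i - 1) * deg j` and `deg i * deg j` differ by
  -- `deg j`.
  set T : ℤˣ := ∏ j : ι, if (j < i ∧ e i < e j) ∨ (i < j ∧ e j < e i) then (deg j).negOnePow else 1
  have h1 : koszulSign e (update deg i (deg i - 1)) = koszulSign e deg * T := by
    have hT : T = ∏ q : ι × ι, (if q.1 = i then (if q.1 < q.2 ∧ e q.2 < e q.1 then
          (deg q.2).negOnePow else 1) else 1) *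
          (if q.2 = i then (if q.1 < q.2 ∧ e q.2 < e q.1 then
          (deg q.1).negOnePow else 1) else 1) := by
      rw [Finset.prod_mul_distrib, Fintype.prod_prod_type, Fintype.prod_prod_type_right]
      simp only [Finset.prod_ite_irrel, Finset.prod_const_one, Finset.prod_ite_eq',
        Finset.mem_univ, if_true]
      rw [← Finset.prod_mul_distrib]
      refine Finset.prod_congr rfl fun j _ => ?_
      rcases lt_trichotomy j i with h | h | h
      · simp [h, h.not_gt]
      · simp [h]
      · simp [h, h.not_gt]
    rw [hT, koszulSign, koszulSign, ← Finset.prod_mul_distrib]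
    refine Finset.prod_congr rfl fun q _ => ?_
    by_cases hq : q.1 < q.2 ∧ e q.2 < e q.1
    · simp only [if_pos hq]
      by_cases ha : q.1 = i
      · have hb : q.2 ≠ i := fun hb => hq.1.ne (ha.trans hb.symm)
        rw [update_of_ne hb, ha, update_self, if_pos rfl, if_neg hb, mul_one,
          ← Int.negOnePow_add]
        refine Int.negOnePow_eq_of_zmod ?_
        push_cast
        generalize (deg i : ZMod 2) = a
        generalize (deg q.2 : ZMod 2) = b
        revert a b; decide
      · by_cases hb : q.2 = i
        · rw [update_of_ne ha, hb, update_self, if_neg ha, if_pos rfl, one_mul,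
            ← Int.negOnePow_add]
          refine Int.negOnePow_eq_of_zmod ?_
          push_cast
          generalize (deg i : ZMod 2) = a
          generalize (deg q.1 : ZMod 2) = b
          revert a b; decide
        · rw [update_of_ne ha, update_of_ne hb, if_neg ha, if_neg hb, mul_one, mul_one]
    · simp [if_neg hq]
  -- The set of `j` before `i` in the source and the set of `j` before `i` in the target differ
  -- exactly by the reversed pairs, which `T` accounts for.
  have h2 : T * (∑ j with e j < e i, deg j).negOnePow = (∑ j with j < i, deg j).negOnePow := by
    rw [Int.negOnePow_sum, Int.negOnePow_sum, Finset.prod_filter, Finset.prod_filter,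
      ← Finset.prod_mul_distrib]
    refine Finset.prod_congr rfl fun j _ => ?_
    rcases lt_trichotomy j i with h | h | h
    · have hne : e j ≠ e i := fun hh => h.ne (e.injective hh)
      rcases hne.lt_or_gt with h' | h' <;> simp [h, h', h.not_gt, h'.not_gt]
    · simp [h]
    · have hne : e j ≠ e i := fun hh => h.ne' (e.injective hh)
      rcases hne.lt_or_gt with h' | h' <;>
        simp [h, h', h.not_gt, h'.not_gt]
  rw [h1, mul_assoc, h2]

end KoszulSign

/-! ### Koszul signs of bijections between ordered disjoint unions -/

section LexSums

variable {α β γ δ : Type}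

/-- A bijection of disjoint unions as a bijection of the lexicographically ordered unions. -/
abbrev lexEquiv (e : α ⊕ β ≃ γ ⊕ δ) : α ⊕ₗ β ≃ γ ⊕ₗ δ := (ofLex.trans e).trans toLex

variable [Fintype α] [Fintype β]

theorem prod_lexSum_pairs {M : Type*} [CommMonoid M] (h : (α ⊕ₗ β) × (α ⊕ₗ β) → M) :
    ∏ q, h q = ((∏ q : α × α, h (toLex (Sum.inl q.1), toLex (Sum.inl q.2))) *
      ∏ q : α × β, h (toLex (Sum.inl q.1), toLex (Sum.inr q.2))) *
      ((∏ q : β × α, h (toLex (Sum.inr q.1), toLex (Sum.inl q.2))) *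
      ∏ q : β × β, h (toLex (Sum.inr q.1), toLex (Sum.inr q.2))) := by
  have h1 : ∏ q, h q = ∏ q : (α ⊕ β) × (α ⊕ β), h (toLex q.1, toLex q.2) :=
    (Fintype.prod_equiv (Equiv.prodCongr toLex toLex) _ _ fun _ => rfl).symm
  rw [h1]
  simp only [Fintype.prod_prod_type, Fintype.prod_sum_type, Finset.prod_mul_distrib]
  exact mul_mul_mul_comm _ _ _ _

variable [LinearOrder α] [LinearOrder β] [LinearOrder γ] [LinearOrder δ]

/-- A pair with one element in each block is never reversed, so only the two blocks contribute. -/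
theorem koszulSign_sumCongr (e : α ≃ γ) (f : β ≃ δ) (deg : α ⊕ₗ β → ℤ) :
    koszulSign (lexEquiv (Equiv.sumCongr e f)) deg =
      koszulSign e (fun i => deg (toLex (Sum.inl i))) *
        koszulSign f (fun i => deg (toLex (Sum.inr i))) := by
  rw [koszulSign, prod_lexSum_pairs]
  simp [koszulSign]

/-- Every mixed pair is reversed and no pair inside a block is, so the exponent is a product of two
sums of degrees. -/
theorem koszulSign_sumComm (deg : α ⊕ₗ β → ℤ) :
    koszulSign (lexEquiv (Equiv.sumComm α β)) deg =
      ((∑ i, deg (toLex (Sum.inl i))) * ∑ j, deg (toLex (Sum.inr j))).negOnePow := by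
  rw [koszulSign, prod_lexSum_pairs]
  simp [Finset.sum_mul_sum, Int.negOnePow_sum, Fintype.prod_prod_type, fun {ι : Type} [LinearOrder ι] (x y : ι) => (not_and.2 fun h => lt_asymm h : ¬ (x < y ∧ y < x))]

theorem koszulSign_sumLexAssoc [Fintype γ] (deg : (α ⊕ₗ β) ⊕ₗ γ → ℤ) :
    koszulSign (OrderIso.sumLexAssoc α β γ).toEquiv deg = 1 :=
  koszulSign_eq_one_of_strictMono _ (fun _ _ h => (OrderIso.sumLexAssoc α β γ).strictMono h) deg

end LexSums

/-! ## Homogeneous elements of tensor powers -/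

section Homogeneous

variable {k : Type u} [Field k]

/-- The parity of an integer. -/
def parity (i : ℤ) : Fin 2 := ⟨(i % 2).toNat, by omega⟩

theorem val_parity (i : ℤ) : ((parity i : ℕ) : ℤ) = i % 2 := by
  simp only [parity]; omega

theorem parity_add (i j : ℤ) : parity (i + j) = parity i + parity j := by
  apply Fin.ext
  have h := val_parity (i + j)
  have hi := val_parity i
  have hj := val_parity j
  rw [Fin.val_add]
  omega

theorem parity_sum {ι : Type*} (s : Finset ι) (f : ι → ℤ) :
    ∑ i ∈ s, parity (f i) = parity (∑ i ∈ s, f i) :=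
  (map_sum (⟨⟨parity, rfl⟩, parity_add⟩ : ℤ →+ Fin 2) f s).symm

theorem intCast_parity (i : ℤ) : ((((parity i : Fin 2) : ℕ) : ℤ) : ZMod 2) = i := by
  rw [val_parity]
  exact (ZMod.intCast_eq_intCast_iff' _ _ 2).2 (by simp)

theorem emod_two_eq_iff_parity (i : ℤ) (a : Fin 2) : i % 2 = ((a : ℕ) : ℤ) ↔ a = parity i := by
  rw [← val_parity, Fin.ext_iff]; omega

namespace ChainCx

variable (X : ChainCx.{u, v} k)

theorem par_of_mem {i : ℤ} {x : X} (hx : x ∈ X.gr i) (a : Fin 2) :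
    X.par a x = if a = parity i then x else 0 := by
  have h : DirectSum.decompose X.gr x = DirectSum.of (fun j => X.gr j) i ⟨x, hx⟩ :=
    DirectSum.decompose_of_mem _ hx
  simp only [par, LinearMap.comp_apply, LinearEquiv.coe_coe,
    DirectSum.decomposeLinearEquiv_apply, h]
  rw [← DirectSum.lof_eq_of k, DirectSum.toModule_lof]
  by_cases ha : a = parity i
  · rw [if_pos ((emod_two_eq_iff_parity i a).2 ha), if_pos ha]; rfl
  · rw [if_neg (mt (emod_two_eq_iff_parity i a).1 ha), if_neg ha]; rfl

theorem sgn_of_mem {i : ℤ} {x : X} (hx : x ∈ X.gr i) : X.sgn x = i.negOnePow • x := by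
  rw [sgn, LinearMap.sub_apply, par_of_mem X hx, par_of_mem X hx]
  rcases Int.even_or_odd i with h | h
  · have : parity i = 0 := ((emod_two_eq_iff_parity i 0).1 (by simpa using Int.even_iff.1 h)).symm
    rw [this, Int.negOnePow_even _ h]; simp
  · have : parity i = 1 := ((emod_two_eq_iff_parity i 1).1 (by simpa using Int.odd_iff.1 h)).symm
    rw [this, Int.negOnePow_odd _ h]; simp

end ChainCx

variable (V : ChainCx.{u, v} k)

/-- The component of degree `a` of `V ^ ⊗ ι`. -/
def tensGr (ι : Type) [Fintype ι] (a : ℤ) : Submodule k (TPow V ι) :=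
  Submodule.span k {t | ∃ (x : ι → V) (deg : ι → ℤ), (∀ i, x i ∈ V.gr (deg i)) ∧
    ∑ i, deg i = a ∧ t = PiTensorProduct.tprod k x}

variable {V}

theorem tprod_mem_tensGr {ι : Type} [Fintype ι] {x : ι → V} {deg : ι → ℤ}
    (hx : ∀ i, x i ∈ V.gr (deg i)) {a : ℤ} (ha : ∑ i, deg i = a) :
    PiTensorProduct.tprod k x ∈ tensGr V ι a :=
  Submodule.subset_span ⟨x, deg, hx, ha, rfl⟩

theorem tensGr_le_iff {ι : Type} [Fintype ι] {a : ℤ} {S : Submodule k (TPow V ι)} :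
    tensGr V ι a ≤ S ↔ ∀ (x : ι → V) (deg : ι → ℤ), (∀ i, x i ∈ V.gr (deg i)) →
      ∑ i, deg i = a → PiTensorProduct.tprod k x ∈ S := by
  rw [tensGr, Submodule.span_le]
  exact ⟨fun h x deg hx ha => h ⟨x, deg, hx, ha, rfl⟩,
    fun h t ⟨x, deg, hx, ha, ht⟩ => ht ▸ h x deg hx ha⟩

/-- Maps with Koszul signs have a simple formula only on decomposable tensors with homogeneous
factors. As these span, identities between linear maps need only be checked on them. -/
theorem tensGr_ext {ι : Type} [Fintype ι] {a : ℤ} {M : Type*} [AddCommGroup M] [Module k M]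
    {f g : TPow V ι →ₗ[k] M} (h : ∀ (x : ι → V) (deg : ι → ℤ), (∀ i, x i ∈ V.gr (deg i)) →
      ∑ i, deg i = a → f (PiTensorProduct.tprod k x) = g (PiTensorProduct.tprod k x))
    {t : TPow V ι} (ht : t ∈ tensGr V ι a) : f t = g t :=
  (tensGr_le_iff (S := LinearMap.eqLocus f g)).2 h ht

theorem tensGr_map {ι κ : Type} [Fintype ι] [Fintype κ] {a b : ℤ} {f : TPow V ι →ₗ[k] TPow V κ}
    (h : ∀ (x : ι → V) (deg : ι → ℤ), (∀ i, x i ∈ V.gr (deg i)) →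
      ∑ i, deg i = a → f (PiTensorProduct.tprod k x) ∈ tensGr V κ b)
    {t : TPow V ι} (ht : t ∈ tensGr V ι a) : f t ∈ tensGr V κ b :=
  (tensGr_le_iff (S := (tensGr V κ b).comap f)).2 h ht

/-- All but one of the products of parity projections annihilate a given homogeneous decomposable
tensor, so the sums defining `koszulMap` and `tensPar` collapse to a single term. -/
theorem map_par_tprod {ι : Type} [Fintype ι] {x : ι → V} {deg : ι → ℤ}
    (hx : ∀ i, x i ∈ V.gr (deg i)) (ε : ι → Fin 2) :
    PiTensorProduct.map (fun i => V.par (ε i)) (PiTensorProduct.tprod k x) =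
      if ε = fun i => parity (deg i) then PiTensorProduct.tprod k x else 0 := by
  rw [PiTensorProduct.map_tprod]
  split_ifs with h
  · congr 1; funext i; rw [ChainCx.par_of_mem V (hx i), if_pos (congrFun h i)]
  · obtain ⟨i, hi⟩ := Function.ne_iff.1 h
    exact MultilinearMap.map_coord_zero _ i (by rw [ChainCx.par_of_mem V (hx i), if_neg hi])

theorem koszulMap_tprod {ι κ : Type} [Fintype ι] [LinearOrder ι] [LinearOrder κ] (e : ι ≃ κ)
    {x : ι → V} {deg : ι → ℤ} (hx : ∀ i, x i ∈ V.gr (deg i)) :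
    koszulMap V e (PiTensorProduct.tprod k x) =
      koszulSign e deg • PiTensorProduct.tprod k fun i => x (e.symm i) := by
  rw [koszulMap, LinearMap.sum_apply, Finset.sum_eq_single fun i => parity (deg i)]
  · rw [LinearMap.intUnits_smul_apply, LinearMap.comp_apply, map_par_tprod hx, if_pos rfl,
      koszulSign_congr_deg e fun i => intCast_parity (deg i)]
    congr 1
    exact PiTensorProduct.reindex_tprod e x
  · intro ε _ hε
    rw [LinearMap.intUnits_smul_apply, LinearMap.comp_apply, map_par_tprod hx, if_neg hε, map_zero,
      intUnits_smul_zero]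
  · simp

theorem koszulMap_mem {ι κ : Type} [Fintype ι] [LinearOrder ι] [Fintype κ] [LinearOrder κ]
    (e : ι ≃ κ) {a : ℤ} {t : TPow V ι} (ht : t ∈ tensGr V ι a) :
    koszulMap V e t ∈ tensGr V κ a := by
  refine tensGr_map (fun x deg hx ha => ?_) ht
  rw [koszulMap_tprod e hx]
  refine Submodule.intUnits_smul_mem _ _ (tprod_mem_tensGr (fun i => hx (e.symm i)) ?_)
  rw [← ha]; exact Equiv.sum_comp e.symm deg

theorem koszulMap_trans {ι κ μ : Type} [Fintype ι] [LinearOrder ι] [Fintype κ] [LinearOrder κ]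
    [LinearOrder μ] (e : ι ≃ κ) (f : κ ≃ μ) {a : ℤ} {t : TPow V ι} (ht : t ∈ tensGr V ι a) :
    koszulMap V (e.trans f) t = koszulMap V f (koszulMap V e t) := by
  refine tensGr_ext (g := koszulMap V f ∘ₗ koszulMap V e) (fun x deg hx _ => ?_) ht
  rw [LinearMap.comp_apply, koszulMap_tprod _ hx, koszulMap_tprod _ hx,
    LinearMap.map_intUnits_smul, koszulMap_tprod f fun i => hx (e.symm i), smul_smul,
    koszulSign_trans]
  rfl

theorem tensPar_of_mem {n : ℕ} {a : ℤ} {t : TPow V (Fin n)} (ht : t ∈ tensGr V (Fin n) a)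
    (c : Fin 2) : tensPar V n c t = if c = parity a then t else 0 := by
  have : tensPar V n c t = ((if c = parity a then LinearMap.id else 0) :
      TPow V (Fin n) →ₗ[k] TPow V (Fin n)) t := by
    refine tensGr_ext (fun x deg hx ha => ?_) ht
    rw [tensPar, LinearMap.sum_apply, Finset.sum_eq_single fun i => parity (deg i)]
    · rw [parity_sum, ha]
      by_cases h : c = parity a
      · rw [if_pos h.symm, if_pos h, map_par_tprod hx, if_pos rfl]; rfl
      · rw [if_neg (Ne.symm h), if_neg h]
    · intro ε _ hε
      split_ifs
      · rw [map_par_tprod hx, if_neg hε]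
      · rfl
    · simp
  rw [this]; split_ifs <;> rfl

theorem tensSgn_of_mem {n : ℕ} {a : ℤ} {t : TPow V (Fin n)} (ht : t ∈ tensGr V (Fin n) a)
    (q : ℤ) : tensSgn V n q t = (q * a).negOnePow • t := by
  rw [tensSgn, LinearMap.add_apply, LinearMap.intUnits_smul_apply, tensPar_of_mem ht,
    tensPar_of_mem ht]
  rcases Int.even_or_odd a with h | h
  · have h0 : parity a = 0 := ((emod_two_eq_iff_parity a 0).1 (by simpa using Int.even_iff.1 h)).symm
    rw [h0, Int.negOnePow_even _ (h.mul_left q), if_pos rfl, if_neg (by decide),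
      intUnits_smul_zero, add_zero, intUnits_one_smul]
  · have h0 : parity a = 1 := ((emod_two_eq_iff_parity a 1).1 (by simpa using Int.odd_iff.1 h)).symm
    rw [h0, Int.negOnePow_eq_iff (q * a) q |>.2 (by
      obtain ⟨c, rfl⟩ := h; exact ⟨q * c, by ring⟩)]
    simp

theorem concat_tprod (a b : ℕ) (x : Fin a → V) (y : Fin b → V) :
    concat V a b (PiTensorProduct.tprod k x ⊗ₜ PiTensorProduct.tprod k y) =
      PiTensorProduct.tprod k fun i : Fin a ⊕ₗ Fin b => Sum.elim x y (ofLex i) := by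
  rw [concat, LinearMap.comp_apply, LinearEquiv.coe_coe, LinearEquiv.coe_coe,
    PiTensorProduct.tmulEquiv_apply]
  exact PiTensorProduct.reindex_tprod _ _

end Homogeneous

/-! ## Contractions along arbitrary identifications of flags -/

/-- Exchange of the last two of three summands. -/
def swapLastSum (α β γ : Type) : (α ⊕ β) ⊕ γ ≃ (α ⊕ γ) ⊕ β :=
  (Equiv.sumAssoc α β γ).trans
    ((Equiv.sumCongr (Equiv.refl α) (Equiv.sumComm β γ)).trans (Equiv.sumAssoc α γ β).symm)

/-- Exchange of the two edges. -/
def swapEdges (γ : Type) : Bool ⊕ (Bool ⊕ γ) ≃ Bool ⊕ (Bool ⊕ γ) :=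
  (Equiv.sumAssoc Bool Bool γ).symm.trans
    ((Equiv.sumCongr (Equiv.sumComm Bool Bool) (Equiv.refl γ)).trans (Equiv.sumAssoc Bool Bool γ))

/-- Reversal of the direction of the edge. -/
def flipEdge (γ : Type) : Bool ⊕ γ ≃ Bool ⊕ γ := Equiv.sumCongr Equiv.boolNot (Equiv.refl γ)

section Nested

variable {α β γ δ ε : Type}

/-- The flags of two nested gluings; the outer edge comes second. -/
def nestFlags (e' : α ⊕ β ≃ Bool ⊕ δ) (e : δ ⊕ γ ≃ Bool ⊕ ε) :
    (α ⊕ β) ⊕ γ ≃ Bool ⊕ (Bool ⊕ ε) :=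
  (Equiv.sumCongr e' (Equiv.refl γ)).trans
    ((Equiv.sumAssoc Bool δ γ).trans (Equiv.sumCongr (Equiv.refl Bool) e))

/-- The flags of a gluing followed by a gluing of two flags of the result. -/
def thenLoopFlags (e : α ≃ Bool ⊕ δ) (e' : δ ≃ Bool ⊕ ε) : α ≃ Bool ⊕ (Bool ⊕ ε) :=
  e.trans (Equiv.sumCongr (Equiv.refl Bool) e')

/-- The flags of the gluing of two flags of the first factor, followed by the gluing of the two
factors. -/
def loopThenFlags (e' : α ≃ Bool ⊕ δ) (e : δ ⊕ γ ≃ Bool ⊕ ε) : α ⊕ γ ≃ Bool ⊕ (Bool ⊕ ε) :=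
  (Equiv.sumCongr e' (Equiv.refl γ)).trans
    ((Equiv.sumAssoc Bool δ γ).trans (Equiv.sumCongr (Equiv.refl Bool) e))

end Nested

section Contractions

variable {k : Type u} [Field k] {V : ChainCx.{u, v} k} {l : ℤ} {η : ℤˣ} (B : InnerProd V l η)

/-- Contraction of two tensors along an identification of the flags. -/
def glueE {n₁ n₂ n : ℕ} (e : Fin n₁ ⊕ Fin n₂ ≃ Bool ⊕ Fin n) :
    TPow V (Fin n₁) ⊗[k] TPow V (Fin n₂) →ₗ[k] TPow V (Fin n) :=
  contractFirst B n ∘ₗ koszulMap V (lexEquiv e) ∘ₗ concat V n₁ n₂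

/-- Contraction of two factors of a tensor along an identification of the flags. -/
def selfGlueE {m n : ℕ} (e : Fin m ≃ Bool ⊕ Fin n) : TPow V (Fin m) →ₗ[k] TPow V (Fin n) :=
  contractFirst B n ∘ₗ koszulMap V (e.trans toLex : Fin m ≃ Bool ⊕ₗ Fin n)

variable {B}

theorem contractFirst_tprod (n : ℕ) (x : Bool ⊕ₗ Fin n → V) :
    contractFirst B n (PiTensorProduct.tprod k x) =
      B.form (x (toLex (Sum.inl false))) (x (toLex (Sum.inl true))) •
        PiTensorProduct.tprod k fun i => x (toLex (Sum.inr i)) := by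
  rw [contractFirst, LinearMap.comp_apply, LinearEquiv.coe_coe, PiTensorProduct.reindex_tprod,
    PiTensorProduct.lift.tprod]
  rfl

/-- Either the contracted factors have total degree `l` or the value of `B` is zero, so a
contraction lowers the degree by exactly `l`. -/
theorem form_smul_mem_tensGr {n : ℕ} {x : Bool ⊕ Fin n → V} {deg : Bool ⊕ Fin n → ℤ}
    (hx : ∀ i, x i ∈ V.gr (deg i)) {a : ℤ} (ha : ∑ i, deg i = a) :
    (B.form (x (Sum.inl false)) (x (Sum.inl true)) •
      PiTensorProduct.tprod k fun i => x (Sum.inr i)) ∈ tensGr V (Fin n) (a - l) := by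
  by_cases h : deg (Sum.inl false) + deg (Sum.inl true) = l
  · refine Submodule.smul_mem _ _ (tprod_mem_tensGr (fun i => hx (Sum.inr i)) ?_)
    rw [← ha, ← h]
    simp [Fintype.sum_sum_type]; ring
  · rw [B.form_degree _ _ _ _ (hx _) (hx _) h, zero_smul]; exact zero_mem _

/-! ### Contractions of decomposable tensors -/

section Eval

variable {n₁ n₂ n : ℕ} {x : Fin n₁ → V} {y : Fin n₂ → V} {dx : Fin n₁ → ℤ} {dy : Fin n₂ → ℤ}

theorem sumElim_mem_gr {α β : Type} {x : α → V} {y : β → V} {dx : α → ℤ} {dy : β → ℤ}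
    (hx : ∀ i, x i ∈ V.gr (dx i)) (hy : ∀ i, y i ∈ V.gr (dy i)) (q : α ⊕ β) :
    Sum.elim x y q ∈ V.gr (Sum.elim dx dy q) := by
  cases q
  exacts [hx _, hy _]

theorem glueE_tprod (hx : ∀ i, x i ∈ V.gr (dx i)) (hy : ∀ i, y i ∈ V.gr (dy i))
    (e : Fin n₁ ⊕ Fin n₂ ≃ Bool ⊕ Fin n) :
    glueE B e (PiTensorProduct.tprod k x ⊗ₜ PiTensorProduct.tprod k y) =
      koszulSign (lexEquiv e) (fun q => Sum.elim dx dy (ofLex q)) •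
        B.form (Sum.elim x y (e.symm (Sum.inl false))) (Sum.elim x y (e.symm (Sum.inl true))) •
          PiTensorProduct.tprod k fun i => Sum.elim x y (e.symm (Sum.inr i)) := by
  rw [glueE, LinearMap.comp_apply, LinearMap.comp_apply, concat_tprod,
    koszulMap_tprod (lexEquiv e) (deg := fun q => Sum.elim dx dy (ofLex q))
      (fun q => sumElim_mem_gr hx hy (ofLex q)),
    LinearMap.map_intUnits_smul, contractFirst_tprod]
  rfl

theorem selfGlueE_tprod (hx : ∀ i, x i ∈ V.gr (dx i)) (e : Fin n₁ ≃ Bool ⊕ Fin n) :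
    selfGlueE B e (PiTensorProduct.tprod k x) =
      koszulSign (e.trans toLex : Fin n₁ ≃ Bool ⊕ₗ Fin n) dx •
        B.form (x (e.symm (Sum.inl false))) (x (e.symm (Sum.inl true))) •
          PiTensorProduct.tprod k fun i => x (e.symm (Sum.inr i)) := by
  rw [selfGlueE, LinearMap.comp_apply, koszulMap_tprod _ hx, LinearMap.map_intUnits_smul,
    contractFirst_tprod]
  rfl

theorem glueE_mem (e : Fin n₁ ⊕ Fin n₂ ≃ Bool ⊕ Fin n) {a b : ℤ} {s : TPow V (Fin n₁)}
    {t : TPow V (Fin n₂)} (hs : s ∈ tensGr V (Fin n₁) a) (ht : t ∈ tensGr V (Fin n₂) b) :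
    glueE B e (s ⊗ₜ t) ∈ tensGr V (Fin n) (a + b - l) := by
  refine (tensGr_le_iff (S := (tensGr V (Fin n) (a + b - l)).comap
    (glueE B e ∘ₗ (TensorProduct.mk k _ _).flip t))).2 (fun x dx hx hax => ?_) hs
  refine (tensGr_le_iff (S := (tensGr V (Fin n) (a + b - l)).comap
    (glueE B e ∘ₗ TensorProduct.mk k _ _ (PiTensorProduct.tprod k x)))).2
      (fun y dy hy hby => ?_) ht
  change glueE B e (PiTensorProduct.tprod k x ⊗ₜ PiTensorProduct.tprod k y) ∈
    tensGr V (Fin n) (a + b - l)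
  rw [glueE_tprod hx hy]
  refine Submodule.intUnits_smul_mem _ _ (form_smul_mem_tensGr
    (x := fun q => Sum.elim x y (e.symm q)) (deg := fun q => Sum.elim dx dy (e.symm q))
    (fun q => sumElim_mem_gr hx hy _) ?_)
  rw [Equiv.sum_comp e.symm (Sum.elim dx dy), Fintype.sum_sum_type]
  simp [hax, hby]

theorem selfGlueE_mem (e : Fin n₁ ≃ Bool ⊕ Fin n) {a : ℤ} {s : TPow V (Fin n₁)}
    (hs : s ∈ tensGr V (Fin n₁) a) : selfGlueE B e s ∈ tensGr V (Fin n) (a - l) := by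
  refine tensGr_map (fun x dx hx ha => ?_) hs
  rw [selfGlueE_tprod hx]
  refine Submodule.intUnits_smul_mem _ _ (form_smul_mem_tensGr
    (x := fun q => x (e.symm q)) (deg := fun q => dx (e.symm q)) (fun q => hx _) ?_)
  rw [Equiv.sum_comp e.symm dx, ha]

end Eval

/-- Equality of two bilinear operations on homogeneous tensors can be checked on decomposable
tensors. -/
theorem tensGr_ext₂ {ι κ : Type} [Fintype ι] [Fintype κ] {a b : ℤ} {M : Type*} [AddCommGroup M]
    [Module k M] {f g : TPow V ι →ₗ[k] TPow V κ →ₗ[k] M}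
    (h : ∀ (x : ι → V) (y : κ → V) (dx : ι → ℤ) (dy : κ → ℤ), (∀ i, x i ∈ V.gr (dx i)) →
      (∀ i, y i ∈ V.gr (dy i)) → ∑ i, dx i = a → ∑ i, dy i = b →
      f (PiTensorProduct.tprod k x) (PiTensorProduct.tprod k y) =
        g (PiTensorProduct.tprod k x) (PiTensorProduct.tprod k y))
    {s : TPow V ι} {t : TPow V κ} (hs : s ∈ tensGr V ι a) (ht : t ∈ tensGr V κ b) :
    f s t = g s t :=
  tensGr_ext (f := f.flip t) (g := g.flip t) (fun x dx hx hax =>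
    tensGr_ext (f := f (PiTensorProduct.tprod k x)) (g := g (PiTensorProduct.tprod k x))
      (fun y dy hy hby => h x y dx dy hx hy hax hby) ht) hs

/-- The contraction of the factors of a decomposable tensor along two edges. -/
def contractTwo (B : InnerProd V l η) {ι : Type} [Fintype ι] [LinearOrder ι] {n : ℕ}
    (E : ι ≃ Bool ⊕ (Bool ⊕ Fin n)) (deg : ι → ℤ) (x : ι → V) : TPow V (Fin n) :=
  koszulSign (κ := Bool ⊕ₗ (Bool ⊕ₗ Fin n)) E deg •
    (B.form (x (E.symm (Sum.inl false))) (x (E.symm (Sum.inl true))) *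
      B.form (x (E.symm (Sum.inr (Sum.inl false)))) (x (E.symm (Sum.inr (Sum.inl true))))) •
        PiTensorProduct.tprod k fun i => x (E.symm (Sum.inr (Sum.inr i)))

theorem contractTwo_trans {ι κ : Type} [Fintype ι] [LinearOrder ι] [Fintype κ] [LinearOrder κ]
    {n : ℕ} (π : ι ≃ κ) (E : κ ≃ Bool ⊕ (Bool ⊕ Fin n)) (deg : ι → ℤ) (x : ι → V) :
    contractTwo B (π.trans E) deg x = koszulSign π deg •
      contractTwo B E (fun i => deg (π.symm i)) fun i => x (π.symm i) := by
  rw [contractTwo, contractTwo, intUnits_mul_smul]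
  congr 1
  exact koszulSign_trans (μ := Bool ⊕ₗ (Bool ⊕ₗ Fin n)) π E deg

/-- Up to reassociation, which preserves the order, this is the transposition of two blocks with two
factors each. -/
theorem koszulSign_swapEdges {n : ℕ} (deg : Bool ⊕ (Bool ⊕ Fin n) → ℤ) :
    koszulSign (ι := Bool ⊕ₗ (Bool ⊕ₗ Fin n)) (κ := Bool ⊕ₗ (Bool ⊕ₗ Fin n))
      (swapEdges (Fin n)) deg =
      ((deg (Sum.inl false) + deg (Sum.inl true)) *
        (deg (Sum.inr (Sum.inl false)) + deg (Sum.inr (Sum.inl true)))).negOnePow := by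
  have h1 := koszulSign_trans (OrderIso.sumLexAssoc Bool Bool (Fin n)).symm.toEquiv
    ((lexEquiv (Equiv.sumCongr (lexEquiv (Equiv.sumComm Bool Bool)) (Equiv.refl (Fin n)))).trans
      (OrderIso.sumLexAssoc Bool Bool (Fin n)).toEquiv) deg
  have h2 := koszulSign_eq_one_of_strictMono
    (OrderIso.sumLexAssoc Bool Bool (Fin n)).symm.toEquiv
    (fun _ _ h => (OrderIso.sumLexAssoc Bool Bool (Fin n)).symm.strictMono h) deg
  rw [h2, one_mul, koszulSign_trans, koszulSign_sumLexAssoc, mul_one, koszulSign_sumCongr,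
    koszulSign_sumComm, koszulSign_eq_one_of_strictMono (Equiv.refl (Fin n)) (fun _ _ h => h),
    mul_one] at h1
  refine Eq.trans h1 ?_
  rw [Fintype.sum_bool, Fintype.sum_bool, add_comm (deg (Sum.inl false)),
    add_comm (deg (Sum.inr (Sum.inl false)))]
  rfl

/-- If both values of `B` are nonzero, each pair has total degree `l` and the block transposition
has sign `(-1) ^ (l * l) = (-1) ^ l`. Otherwise both sides vanish. -/
theorem contractTwo_swapEdges {ι : Type} [Fintype ι] [LinearOrder ι] {n : ℕ}
    (E : ι ≃ Bool ⊕ (Bool ⊕ Fin n)) {deg : ι → ℤ} {x : ι → V} (hx : ∀ i, x i ∈ V.gr (deg i)) :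
    contractTwo B (E.trans (swapEdges (Fin n))) deg x = l.negOnePow • contractTwo B E deg x := by
  rw [contractTwo, contractTwo]
  change _ • (B.form (x (E.symm (Sum.inr (Sum.inl false)))) (x (E.symm (Sum.inr (Sum.inl true)))) *
      B.form (x (E.symm (Sum.inl false))) (x (E.symm (Sum.inl true)))) •
        PiTensorProduct.tprod k (fun i => x (E.symm (Sum.inr (Sum.inr i)))) = _
  by_cases h1 : deg (E.symm (Sum.inl false)) + deg (E.symm (Sum.inl true)) = l
  · by_cases h2 : deg (E.symm (Sum.inr (Sum.inl false))) +
        deg (E.symm (Sum.inr (Sum.inl true))) = l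
    · have h3 := koszulSign_trans (κ := Bool ⊕ₗ (Bool ⊕ₗ Fin n))
        (μ := Bool ⊕ₗ (Bool ⊕ₗ Fin n)) E (swapEdges (Fin n)) deg
      have h4 := koszulSign_swapEdges (n := n) fun i => deg (E.symm i)
      rw [h1, h2] at h4
      rw [mul_comm (B.form (x (E.symm (Sum.inr (Sum.inl false)))) _), intUnits_mul_smul,
        mul_comm l.negOnePow]
      refine congrArg₂ (· • ·) ?_ rfl
      exact h3.trans (congrArg _ (h4.trans (Int.negOnePow_mul_self l)))
    · rw [B.form_degree _ _ _ _ (hx _) (hx _) h2]; simp [intUnits_smul_zero]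
  · rw [B.form_degree _ _ _ _ (hx _) (hx _) h1]; simp [intUnits_smul_zero]

/-! ### Koszul signs of two successive gluings -/

section KoszulSignNested

variable {α β γ δ ε : Type} [Fintype α] [Fintype β] [Fintype γ] [Fintype δ]
  [LinearOrder α] [LinearOrder β] [LinearOrder γ] [LinearOrder δ] [LinearOrder ε]

/-- Besides `e'` and `e` the bijection is composed of identities and order preserving
reassociations. Hence the sign is that of the inner gluing times that of the outer one, the latter
taken with the degrees of the flags which survive the former. -/
theorem koszulSign_nestFlags (e' : α ⊕ β ≃ Bool ⊕ δ) (e : δ ⊕ γ ≃ Bool ⊕ ε)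
    (deg : (α ⊕ₗ β) ⊕ₗ γ → ℤ) :
    koszulSign (ι := (α ⊕ₗ β) ⊕ₗ γ) (κ := Bool ⊕ₗ (Bool ⊕ₗ ε)) (nestFlags e' e) deg =
      koszulSign (lexEquiv e') (fun q => deg (toLex (Sum.inl q))) *
        koszulSign (lexEquiv e) (fun q => deg (toLex (Sum.map
          (fun i => (lexEquiv e').symm (toLex (Sum.inr i))) id (ofLex q)))) := by
  have h := koszulSign_trans (lexEquiv (Equiv.sumCongr (lexEquiv e') (Equiv.refl γ)))
    ((OrderIso.sumLexAssoc Bool δ γ).toEquiv.trans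
      (lexEquiv (Equiv.sumCongr (Equiv.refl Bool) (lexEquiv e)))) deg
  rw [koszulSign_trans (OrderIso.sumLexAssoc Bool δ γ).toEquiv, koszulSign_sumLexAssoc, one_mul,
    koszulSign_sumCongr, koszulSign_eq_one_of_strictMono (Equiv.refl γ) (fun _ _ h => h), mul_one,
    koszulSign_sumCongr,
    koszulSign_eq_one_of_strictMono (Equiv.refl Bool) (fun _ _ h => h), one_mul] at h
  refine h.trans (congrArg₂ _ rfl (congrArg _ (funext ?_)))
  rintro (q | q) <;> rfl

theorem koszulSign_thenLoopFlags (e : α ≃ Bool ⊕ δ) (e' : δ ≃ Bool ⊕ ε) (deg : α → ℤ) :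
    koszulSign (κ := Bool ⊕ₗ (Bool ⊕ₗ ε)) (thenLoopFlags e e') deg =
      koszulSign (e.trans toLex : α ≃ Bool ⊕ₗ δ) deg *
        koszulSign (e'.trans toLex : δ ≃ Bool ⊕ₗ ε) (fun q => deg (e.symm (Sum.inr q))) := by
  have h := koszulSign_trans (e.trans toLex : α ≃ Bool ⊕ₗ δ)
    (lexEquiv (Equiv.sumCongr (Equiv.refl Bool) (e'.trans toLex : δ ≃ Bool ⊕ₗ ε))) deg
  rw [koszulSign_sumCongr,
    koszulSign_eq_one_of_strictMono (Equiv.refl Bool) (fun _ _ h => h), one_mul] at h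
  exact h

theorem koszulSign_loopThenFlags (e' : α ≃ Bool ⊕ δ) (e : δ ⊕ γ ≃ Bool ⊕ ε)
    (deg : α ⊕ₗ γ → ℤ) :
    koszulSign (ι := α ⊕ₗ γ) (κ := Bool ⊕ₗ (Bool ⊕ₗ ε)) (loopThenFlags e' e) deg =
      koszulSign (e'.trans toLex : α ≃ Bool ⊕ₗ δ) (fun q => deg (toLex (Sum.inl q))) *
        koszulSign (lexEquiv e) (fun q => deg (toLex (Sum.map
          (fun i => e'.symm (Sum.inr i)) id (ofLex q)))) := by
  have h := koszulSign_trans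
    (lexEquiv (Equiv.sumCongr (e'.trans toLex : α ≃ Bool ⊕ₗ δ) (Equiv.refl γ)))
    ((OrderIso.sumLexAssoc Bool δ γ).toEquiv.trans
      (lexEquiv (Equiv.sumCongr (Equiv.refl Bool) (lexEquiv e)))) deg
  rw [koszulSign_trans (OrderIso.sumLexAssoc Bool δ γ).toEquiv, koszulSign_sumLexAssoc, one_mul,
    koszulSign_sumCongr, koszulSign_eq_one_of_strictMono (Equiv.refl γ) (fun _ _ h => h), mul_one,
    koszulSign_sumCongr,
    koszulSign_eq_one_of_strictMono (Equiv.refl Bool) (fun _ _ h => h), one_mul] at h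
  refine h.trans (congrArg₂ _ rfl (congrArg _ (funext ?_)))
  rintro (q | q) <;> rfl

theorem koszulSign_swapLastSum (deg : (α ⊕ₗ β) ⊕ₗ γ → ℤ) :
    koszulSign (ι := (α ⊕ₗ β) ⊕ₗ γ) (κ := (α ⊕ₗ γ) ⊕ₗ β) (swapLastSum α β γ) deg =
      ((∑ i, deg (toLex (Sum.inl (toLex (Sum.inr i))))) *
        ∑ i, deg (toLex (Sum.inr i))).negOnePow := by
  have h := koszulSign_trans (OrderIso.sumLexAssoc α β γ).toEquiv
    ((lexEquiv (Equiv.sumCongr (Equiv.refl α) (lexEquiv (Equiv.sumComm β γ)))).trans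
      (OrderIso.sumLexAssoc α γ β).symm.toEquiv) deg
  rw [koszulSign_sumLexAssoc, one_mul, koszulSign_trans _ (OrderIso.sumLexAssoc α γ β).symm.toEquiv,
    koszulSign_eq_one_of_strictMono (OrderIso.sumLexAssoc α γ β).symm.toEquiv
    (fun _ _ h => (OrderIso.sumLexAssoc α γ β).symm.strictMono h), mul_one, koszulSign_sumCongr,
    koszulSign_eq_one_of_strictMono (Equiv.refl α) (fun _ _ h => h), one_mul,
    koszulSign_sumComm] at h
  exact h

end KoszulSignNested

/-! ### Two successive contractions as one contraction along two edges -/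

section EvalTwo

theorem sumElim_sumMap {A α β γ : Type*} (f : α → β) (x : β → A) (y : γ → A) (q : α ⊕ γ) :
    Sum.elim x y (Sum.map f id q) = Sum.elim (fun i => x (f i)) y q := by
  rcases q with q | q <;> rfl

theorem smul_form_smul_form {M : Type*} [AddCommGroup M] [Module k M] (s t : ℤˣ) (a b : k) (z : M) :
    s • a • t • b • z = (s * t) • (a * b) • z := by
  rw [← intUnits_mul_smul, ← intUnits_smul_smul, mul_smul]

variable {n₁ n₂ n₃ m n : ℕ} {x : Fin n₁ → V} {y : Fin n₂ → V} {z : Fin n₃ → V}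
  {dx : Fin n₁ → ℤ} {dy : Fin n₂ → ℤ} {dz : Fin n₃ → ℤ}
  (hx : ∀ i, x i ∈ V.gr (dx i)) (hy : ∀ i, y i ∈ V.gr (dy i)) (hz : ∀ i, z i ∈ V.gr (dz i))
include hx

/-- In the form `contractTwo` the order of the two contractions is part of a bijection of flags, so
two orders can be compared by comparing bijections. The next three lemmas do the same for the other
combinations of gluings. -/
theorem selfGlueE_selfGlueE_tprod (e : Fin n₁ ≃ Bool ⊕ Fin m) (e' : Fin m ≃ Bool ⊕ Fin n) :
    selfGlueE B e' (selfGlueE B e (PiTensorProduct.tprod k x)) =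
      contractTwo B (thenLoopFlags e e') dx x := by
  rw [selfGlueE_tprod hx, LinearMap.map_intUnits_smul, map_smul,
    selfGlueE_tprod (fun i => hx (e.symm (Sum.inr i))), smul_form_smul_form]
  exact congrArg₂ (· • ·) (koszulSign_thenLoopFlags e e' dx).symm rfl

include hy

theorem selfGlueE_glueE_tprod (e : Fin n₁ ⊕ Fin n₂ ≃ Bool ⊕ Fin m) (e' : Fin m ≃ Bool ⊕ Fin n) :
    selfGlueE B e' (glueE B e (PiTensorProduct.tprod k x ⊗ₜ PiTensorProduct.tprod k y)) =
      contractTwo B (ι := Fin n₁ ⊕ₗ Fin n₂) (thenLoopFlags e e') (Sum.elim dx dy)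
        (Sum.elim x y) := by
  have h := koszulSign_thenLoopFlags (α := Fin n₁ ⊕ₗ Fin n₂) e e' (Sum.elim dx dy)
  rw [glueE_tprod hx hy, LinearMap.map_intUnits_smul, map_smul,
    selfGlueE_tprod (fun i => sumElim_mem_gr hx hy (e.symm (Sum.inr i))), smul_form_smul_form]
  exact congrArg₂ (· • ·) h.symm rfl

theorem glueE_selfGlueE_tprod (e' : Fin n₁ ≃ Bool ⊕ Fin m) (e : Fin m ⊕ Fin n₂ ≃ Bool ⊕ Fin n) :
    glueE B e (selfGlueE B e' (PiTensorProduct.tprod k x) ⊗ₜ PiTensorProduct.tprod k y) =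
      contractTwo B (ι := Fin n₁ ⊕ₗ Fin n₂) (loopThenFlags e' e) (Sum.elim dx dy)
        (Sum.elim x y) := by
  have h := koszulSign_loopThenFlags e' e (Sum.elim dx dy)
  have hE : ∀ q : Bool ⊕ Fin n, (loopThenFlags e' e).symm (Sum.inr q) =
      Sum.map (fun i => e'.symm (Sum.inr i)) id (e.symm q) := by
    intro q
    change (Equiv.sumCongr e' (Equiv.refl (Fin n₂))).symm
        ((Equiv.sumAssoc Bool (Fin m) (Fin n₂)).symm (Sum.inr (e.symm q))) = _
    rcases e.symm q with q | q <;> rfl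
  have hE' : ∀ q : Bool ⊕ Fin n, Sum.elim (fun i => x (e'.symm (Sum.inr i))) y (e.symm q) =
      Sum.elim x y ((loopThenFlags e' e).symm (Sum.inr q)) := fun q => by
    rw [hE, sumElim_sumMap]
  rw [selfGlueE_tprod hx, TensorProduct.intUnits_smul_tmul, ← TensorProduct.smul_tmul',
    LinearMap.map_intUnits_smul, map_smul,
    glueE_tprod (fun i => hx (e'.symm (Sum.inr i))) hy, smul_form_smul_form]
  simp only [hE']
  refine congrArg₂ (· • ·) (Eq.trans ?_ h.symm) rfl
  refine congrArg₂ _ rfl (congrArg _ (funext ?_))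
  rintro (q | q) <;> rfl

include hz

theorem glueE_glueE_tprod (e' : Fin n₁ ⊕ Fin n₂ ≃ Bool ⊕ Fin m)
    (e : Fin m ⊕ Fin n₃ ≃ Bool ⊕ Fin n) :
    glueE B e (glueE B e' (PiTensorProduct.tprod k x ⊗ₜ PiTensorProduct.tprod k y) ⊗ₜ
        PiTensorProduct.tprod k z) =
      contractTwo B (ι := (Fin n₁ ⊕ₗ Fin n₂) ⊕ₗ Fin n₃) (nestFlags e' e)
        (Sum.elim (Sum.elim dx dy) dz) (Sum.elim (Sum.elim x y) z) := by
  have h := koszulSign_nestFlags e' e (Sum.elim (Sum.elim dx dy) dz)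
  have hE : ∀ q : Bool ⊕ Fin n, (nestFlags e' e).symm (Sum.inr q) =
      Sum.map (fun i => e'.symm (Sum.inr i)) id (e.symm q) := by
    intro q
    change (Equiv.sumCongr e' (Equiv.refl (Fin n₃))).symm
        ((Equiv.sumAssoc Bool (Fin m) (Fin n₃)).symm (Sum.inr (e.symm q))) = _
    rcases e.symm q with q | q <;> rfl
  have hE' : ∀ q : Bool ⊕ Fin n,
      Sum.elim (fun i => Sum.elim x y (e'.symm (Sum.inr i))) z (e.symm q) =
      Sum.elim (Sum.elim x y) z ((nestFlags e' e).symm (Sum.inr q)) := fun q => by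
    rw [hE, sumElim_sumMap]
  rw [glueE_tprod hx hy, TensorProduct.intUnits_smul_tmul, ← TensorProduct.smul_tmul',
    LinearMap.map_intUnits_smul, map_smul,
    glueE_tprod (fun i => sumElim_mem_gr hx hy (e'.symm (Sum.inr i))) hz, smul_form_smul_form]
  simp only [hE']
  refine congrArg₂ (· • ·) (Eq.trans ?_ h.symm) rfl
  refine congrArg₂ _ rfl (congrArg _ (funext ?_))
  rintro (q | q) <;> rfl

end EvalTwo

end Contractions

/-! ## Relations between contractions -/

section ContractOne

variable {k : Type u} [Field k] {V : ChainCx.{u, v} k} {l : ℤ} {η : ℤˣ} {B : InnerProd V l η}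

/-- The contraction of the factors of a decomposable tensor along one edge. -/
def contractOne (B : InnerProd V l η) {ι : Type} [Fintype ι] [LinearOrder ι] {n : ℕ}
    (E : ι ≃ Bool ⊕ Fin n) (deg : ι → ℤ) (x : ι → V) : TPow V (Fin n) :=
  koszulSign (κ := Bool ⊕ₗ Fin n) E deg •
    B.form (x (E.symm (Sum.inl false))) (x (E.symm (Sum.inl true))) •
      PiTensorProduct.tprod k fun i => x (E.symm (Sum.inr i))

theorem contractOne_trans {ι κ : Type} [Fintype ι] [LinearOrder ι] [Fintype κ] [LinearOrder κ]
    {n : ℕ} (π : ι ≃ κ) (E : κ ≃ Bool ⊕ Fin n) (deg : ι → ℤ) (x : ι → V) :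
    contractOne B (π.trans E) deg x = koszulSign π deg •
      contractOne B E (fun i => deg (π.symm i)) fun i => x (π.symm i) := by
  rw [contractOne, contractOne, intUnits_mul_smul]
  congr 1
  exact koszulSign_trans (μ := Bool ⊕ₗ Fin n) π E deg

theorem koszulSign_flipEdge {n : ℕ} (deg : Bool ⊕ₗ Fin n → ℤ) :
    koszulSign (lexEquiv (flipEdge (Fin n))) deg =
      (deg (toLex (Sum.inl false)) * deg (toLex (Sum.inl true))).negOnePow := by
  rw [flipEdge, koszulSign_sumCongr,
    koszulSign_eq_one_of_strictMono (Equiv.refl (Fin n)) (fun _ _ h => h), mul_one, koszulSign]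
  simp [Fintype.prod_prod_type]

/-- Transposing the two contracted factors produces a Koszul sign which cancels the one in the
graded symmetry of `B`; only `η` remains. -/
theorem contractOne_flipEdge {ι : Type} [Fintype ι] [LinearOrder ι] {n : ℕ}
    (E : ι ≃ Bool ⊕ Fin n) {deg : ι → ℤ} {x : ι → V} (hx : ∀ i, x i ∈ V.gr (deg i)) :
    contractOne B (E.trans (flipEdge (Fin n))) deg x = η • contractOne B E deg x := by
  have h3 := koszulSign_trans (κ := Bool ⊕ₗ Fin n)
        (μ := Bool ⊕ₗ Fin n) E (lexEquiv (flipEdge (Fin n))) deg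
  rw [koszulSign_flipEdge] at h3
  have h4 := B.form_symm _ _ _ _ (hx (E.symm (Sum.inl true))) (hx (E.symm (Sum.inl false)))
  rw [contractOne, contractOne]
  change _ • B.form (x (E.symm (Sum.inl true))) (x (E.symm (Sum.inl false))) •
        PiTensorProduct.tprod k (fun i => x (E.symm (Sum.inr i))) = _
  rw [h4, intUnits_mul_smul, Units.smul_def (η * _), ← Int.cast_smul_eq_zsmul k, smul_eq_mul,
    mul_smul, ← intUnits_smul_eq_cast_smul, intUnits_mul_smul]
  refine congrArg₂ (· • ·) ?_ rfl
  refine (congrArg (· * _) h3).trans ?_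
  change _ * (deg (E.symm (Sum.inl false)) * deg (E.symm (Sum.inl true))).negOnePow * _ = _
  rw [mul_comm (deg (E.symm (Sum.inl true)))]
  generalize (deg (E.symm (Sum.inl false)) * deg (E.symm (Sum.inl true))).negOnePow = c
  rw [mul_comm η c, mul_assoc, ← mul_assoc c, Int.units_mul_self, one_mul, mul_comm]

theorem koszulMap_contractOne {ι : Type} [Fintype ι] [LinearOrder ι] {n n' : ℕ}
    (E : ι ≃ Bool ⊕ Fin n) (g : Fin n ≃ Fin n') {deg : ι → ℤ} {x : ι → V}
    (hx : ∀ i, x i ∈ V.gr (deg i)) :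
    koszulMap V g (contractOne B E deg x) =
      contractOne B (E.trans (Equiv.sumCongr (Equiv.refl Bool) g)) deg x := by
  have h3 := koszulSign_trans (κ := Bool ⊕ₗ Fin n) (μ := Bool ⊕ₗ Fin n') E
    (lexEquiv (Equiv.sumCongr (Equiv.refl Bool) g)) deg
  rw [koszulSign_sumCongr, koszulSign_eq_one_of_strictMono (Equiv.refl Bool) (fun _ _ h => h),
    one_mul] at h3
  rw [contractOne, LinearMap.map_intUnits_smul, map_smul,
    koszulMap_tprod g (fun i => hx (E.symm (Sum.inr i))), ← intUnits_smul_smul,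
    intUnits_mul_smul]
  exact congrArg₂ (· • ·) h3.symm rfl

end ContractOne

/-! ### Naturality, symmetry and commutation of contractions -/

section Relations

variable {k : Type u} [Field k] {V : ChainCx.{u, v} k} {l : ℤ} {η : ℤˣ} {B : InnerProd V l η}
  {n₁ n₂ n₃ m m' n : ℕ}

theorem glueE_tprod_eq_contractOne {x : Fin n₁ → V} {y : Fin n₂ → V} {dx : Fin n₁ → ℤ}
    {dy : Fin n₂ → ℤ} (hx : ∀ i, x i ∈ V.gr (dx i)) (hy : ∀ i, y i ∈ V.gr (dy i))
    (e : Fin n₁ ⊕ Fin n₂ ≃ Bool ⊕ Fin n) :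
    glueE B e (PiTensorProduct.tprod k x ⊗ₜ PiTensorProduct.tprod k y) =
      contractOne B (ι := Fin n₁ ⊕ₗ Fin n₂) e (Sum.elim dx dy) (Sum.elim x y) :=
  glueE_tprod hx hy e

theorem selfGlueE_tprod_eq_contractOne {x : Fin m → V} {dx : Fin m → ℤ}
    (hx : ∀ i, x i ∈ V.gr (dx i)) (e : Fin m ≃ Bool ⊕ Fin n) :
    selfGlueE B e (PiTensorProduct.tprod k x) = contractOne B e dx x :=
  selfGlueE_tprod hx e

/-- `glueE` as a bilinear map. -/
def glueE₂ (B : InnerProd V l η) (e : Fin n₁ ⊕ Fin n₂ ≃ Bool ⊕ Fin n) :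
    TPow V (Fin n₁) →ₗ[k] TPow V (Fin n₂) →ₗ[k] TPow V (Fin n) :=
  (TensorProduct.mk k _ _).compr₂ (glueE B e)

theorem glueE₂_apply (e : Fin n₁ ⊕ Fin n₂ ≃ Bool ⊕ Fin n) (s : TPow V (Fin n₁))
    (t : TPow V (Fin n₂)) : glueE₂ B e s t = glueE B e (s ⊗ₜ t) := rfl

variable {a b c : ℤ} {s : TPow V (Fin n₁)} {t : TPow V (Fin n₂)} {r : TPow V (Fin n₃)}

theorem koszulMap_glueE (e : Fin n₁ ⊕ Fin n₂ ≃ Bool ⊕ Fin m) (g : Fin m ≃ Fin n)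
    (hs : s ∈ tensGr V (Fin n₁) a) (ht : t ∈ tensGr V (Fin n₂) b) :
    koszulMap V g (glueE B e (s ⊗ₜ t)) =
      glueE B (e.trans (Equiv.sumCongr (Equiv.refl Bool) g)) (s ⊗ₜ t) := by
  refine tensGr_ext₂ (f := (glueE₂ B e).compr₂ (koszulMap V g))
    (g := glueE₂ B (e.trans (Equiv.sumCongr (Equiv.refl Bool) g)))
    (fun x y dx dy hx hy _ _ => ?_) hs ht
  rw [LinearMap.compr₂_apply, glueE₂_apply, glueE₂_apply, glueE_tprod_eq_contractOne hx hy,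
    glueE_tprod_eq_contractOne hx hy]
  exact koszulMap_contractOne (ι := Fin n₁ ⊕ₗ Fin n₂) _ _ fun q => sumElim_mem_gr hx hy q

theorem koszulMap_selfGlueE (e : Fin n₁ ≃ Bool ⊕ Fin m) (g : Fin m ≃ Fin n)
    (hs : s ∈ tensGr V (Fin n₁) a) :
    koszulMap V g (selfGlueE B e s) =
      selfGlueE B (e.trans (Equiv.sumCongr (Equiv.refl Bool) g)) s := by
  refine tensGr_ext (f := koszulMap V g ∘ₗ selfGlueE B e) (fun x dx hx _ => ?_) hs
  rw [LinearMap.comp_apply, selfGlueE_tprod_eq_contractOne hx, selfGlueE_tprod_eq_contractOne hx,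
    koszulMap_contractOne _ _ hx]

theorem selfGlueE_koszulMap (g : Fin n₁ ≃ Fin m) (e : Fin m ≃ Bool ⊕ Fin n)
    (hs : s ∈ tensGr V (Fin n₁) a) :
    selfGlueE B e (koszulMap V g s) = selfGlueE B (g.trans e) s := by
  refine tensGr_ext (f := selfGlueE B e ∘ₗ koszulMap V g) (fun x dx hx _ => ?_) hs
  rw [LinearMap.comp_apply, koszulMap_tprod g hx, LinearMap.map_intUnits_smul,
    selfGlueE_tprod_eq_contractOne (fun i => hx (g.symm i)), selfGlueE_tprod_eq_contractOne hx,
    contractOne_trans]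

theorem glueE_koszulMap (g : Fin n₁ ≃ Fin m) (g' : Fin n₂ ≃ Fin m')
    (e : Fin m ⊕ Fin m' ≃ Bool ⊕ Fin n) (hs : s ∈ tensGr V (Fin n₁) a)
    (ht : t ∈ tensGr V (Fin n₂) b) :
    glueE B e (koszulMap V g s ⊗ₜ koszulMap V g' t) =
      glueE B ((Equiv.sumCongr g g').trans e) (s ⊗ₜ t) := by
  refine tensGr_ext₂ (f := (glueE₂ B e).compl₁₂ (koszulMap V g) (koszulMap V g'))
    (g := glueE₂ B ((Equiv.sumCongr g g').trans e)) (fun x y dx dy hx hy _ _ => ?_) hs ht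
  have h := contractOne_trans (B := B) (ι := Fin n₁ ⊕ₗ Fin n₂) (κ := Fin m ⊕ₗ Fin m')
    (lexEquiv (Equiv.sumCongr g g')) e (Sum.elim dx dy) (Sum.elim x y)
  have h' := koszulSign_sumCongr g g' (Sum.elim dx dy)
  rw [LinearMap.compl₁₂_apply, koszulMap_tprod g hx, koszulMap_tprod g' hy,
    LinearMap.map_intUnits_smul, LinearMap.map_intUnits_smul₂, intUnits_mul_smul, glueE₂_apply,
    glueE₂_apply, glueE_tprod_eq_contractOne hx hy,
    glueE_tprod_eq_contractOne (fun i => hx (g.symm i)) (fun i => hy (g'.symm i))]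
  refine Eq.trans ?_ (h.trans (congrArg₂ (· • ·) h' rfl)).symm
  refine congrArg₂ (· • ·) (mul_comm _ _) ?_
  refine congrArg₂ (contractOne B (ι := Fin m ⊕ₗ Fin m') e) (funext ?_) (funext ?_)
  all_goals rintro (q | q) <;> rfl

theorem selfGlueE_flipEdge (e : Fin n₁ ≃ Bool ⊕ Fin n) (hs : s ∈ tensGr V (Fin n₁) a) :
    selfGlueE B (e.trans (flipEdge (Fin n))) s = η • selfGlueE B e s := by
  rw [← LinearMap.intUnits_smul_apply]
  refine tensGr_ext (fun x dx hx _ => ?_) hs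
  rw [LinearMap.intUnits_smul_apply, selfGlueE_tprod_eq_contractOne hx,
    selfGlueE_tprod_eq_contractOne hx, contractOne_flipEdge _ hx]

/-- Exchanging the tensors costs the Koszul sign `(-1) ^ (a * b)`. The edge would then run
backwards, and turning it around costs `η`. -/
theorem glueE_sumComm (e : Fin n₂ ⊕ Fin n₁ ≃ Bool ⊕ Fin n) (hs : s ∈ tensGr V (Fin n₁) a)
    (ht : t ∈ tensGr V (Fin n₂) b) :
    glueE B (((Equiv.sumComm _ _).trans e).trans (flipEdge (Fin n))) (s ⊗ₜ t) =
      (η * (a * b).negOnePow) • glueE B e (t ⊗ₜ s) := by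
  refine (tensGr_ext₂ (f := glueE₂ B (((Equiv.sumComm _ _).trans e).trans (flipEdge (Fin n))))
    (g := (η * (a * b).negOnePow) • (glueE₂ B e).flip)
    (fun x y dx dy hx hy ha hb => ?_) hs ht).trans ?_
  · have h := contractOne_trans (B := B) (ι := Fin n₁ ⊕ₗ Fin n₂) (κ := Fin n₂ ⊕ₗ Fin n₁)
      (lexEquiv (Equiv.sumComm _ _)) e (Sum.elim dx dy) (Sum.elim x y)
    have h' := koszulSign_sumComm (α := Fin n₁) (β := Fin n₂) (Sum.elim dx dy)
    rw [LinearMap.intUnits_smul_apply, LinearMap.intUnits_smul_apply,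
      LinearMap.flip_apply, glueE₂_apply, glueE₂_apply, glueE_tprod_eq_contractOne hx hy,
      ← intUnits_mul_smul]
    refine (contractOne_flipEdge (ι := Fin n₁ ⊕ₗ Fin n₂) _
      (fun q => sumElim_mem_gr hx hy q)).trans ?_
    refine congrArg (η • ·) (h.trans ?_)
    rw [glueE_tprod_eq_contractOne hy hx, ← ha, ← hb]
    refine congrArg₂ (· • ·) h' ?_
    refine congrArg₂ (contractOne B (ι := Fin n₂ ⊕ₗ Fin n₁) e) (funext ?_) (funext ?_)
    all_goals rintro (q | q) <;> rfl
  · rw [LinearMap.intUnits_smul_apply, LinearMap.intUnits_smul_apply]; rfl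

/-- The hypothesis `h` says that both sides contract the same two pairs of flags, in opposite order,
and number the surviving flags alike. The sign is that of `contractTwo_swapEdges`. The same type of
hypothesis governs the next three lemmas. -/
theorem selfGlueE_selfGlueE {e : Fin n₁ ≃ Bool ⊕ Fin m} {e' : Fin m ≃ Bool ⊕ Fin n}
    {f : Fin n₁ ≃ Bool ⊕ Fin m'} {f' : Fin m' ≃ Bool ⊕ Fin n}
    (h : thenLoopFlags f f' = (thenLoopFlags e e').trans (swapEdges (Fin n)))
    (hs : s ∈ tensGr V (Fin n₁) a) :
    selfGlueE B f' (selfGlueE B f s) = l.negOnePow • selfGlueE B e' (selfGlueE B e s) := by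
  rw [← LinearMap.comp_apply (selfGlueE B e'), ← LinearMap.intUnits_smul_apply]
  refine tensGr_ext (f := selfGlueE B f' ∘ₗ selfGlueE B f) (fun x dx hx _ => ?_) hs
  rw [LinearMap.intUnits_smul_apply, LinearMap.comp_apply, LinearMap.comp_apply,
    selfGlueE_selfGlueE_tprod hx, selfGlueE_selfGlueE_tprod hx, h, contractTwo_swapEdges _ hx]

theorem selfGlueE_glueE {e : Fin n₁ ⊕ Fin n₂ ≃ Bool ⊕ Fin m} {e' : Fin m ≃ Bool ⊕ Fin n}
    {f : Fin n₁ ⊕ Fin n₂ ≃ Bool ⊕ Fin m'} {f' : Fin m' ≃ Bool ⊕ Fin n}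
    (h : thenLoopFlags f f' = (thenLoopFlags e e').trans (swapEdges (Fin n)))
    (hs : s ∈ tensGr V (Fin n₁) a) (ht : t ∈ tensGr V (Fin n₂) b) :
    selfGlueE B f' (glueE B f (s ⊗ₜ t)) =
      l.negOnePow • selfGlueE B e' (glueE B e (s ⊗ₜ t)) := by
  rw [← LinearMap.intUnits_smul_apply]
  refine tensGr_ext₂ (f := (glueE₂ B f).compr₂ (selfGlueE B f'))
    (g := (glueE₂ B e).compr₂ (l.negOnePow • selfGlueE B e')) (fun x y dx dy hx hy _ _ => ?_) hs ht
  rw [LinearMap.compr₂_apply, LinearMap.compr₂_apply, LinearMap.intUnits_smul_apply, glueE₂_apply,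
    glueE₂_apply, selfGlueE_glueE_tprod hx hy, selfGlueE_glueE_tprod hx hy]
  exact (congrArg (fun E => contractTwo B (ι := Fin n₁ ⊕ₗ Fin n₂) E _ _) h).trans
    (contractTwo_swapEdges (ι := Fin n₁ ⊕ₗ Fin n₂) _ fun q => sumElim_mem_gr hx hy q)

theorem selfGlueE_glueE_eq_glueE_selfGlueE {e : Fin n₁ ⊕ Fin n₂ ≃ Bool ⊕ Fin m}
    {e' : Fin m ≃ Bool ⊕ Fin n} {f' : Fin n₁ ≃ Bool ⊕ Fin m'}
    {f : Fin m' ⊕ Fin n₂ ≃ Bool ⊕ Fin n}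
    (h : loopThenFlags f' f = (thenLoopFlags e e').trans (swapEdges (Fin n)))
    (hs : s ∈ tensGr V (Fin n₁) a) (ht : t ∈ tensGr V (Fin n₂) b) :
    glueE B f (selfGlueE B f' s ⊗ₜ t) =
      l.negOnePow • selfGlueE B e' (glueE B e (s ⊗ₜ t)) := by
  rw [← LinearMap.intUnits_smul_apply]
  refine tensGr_ext₂ (f := (glueE₂ B f).comp (selfGlueE B f'))
    (g := (glueE₂ B e).compr₂ (l.negOnePow • selfGlueE B e')) (fun x y dx dy hx hy _ _ => ?_) hs ht
  rw [LinearMap.comp_apply, LinearMap.compr₂_apply, LinearMap.intUnits_smul_apply, glueE₂_apply,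
    glueE₂_apply, selfGlueE_glueE_tprod hx hy, glueE_selfGlueE_tprod hx hy]
  exact (congrArg (fun E => contractTwo B (ι := Fin n₁ ⊕ₗ Fin n₂) E _ _) h).trans
    (contractTwo_swapEdges (ι := Fin n₁ ⊕ₗ Fin n₂) _ fun q => sumElim_mem_gr hx hy q)

/-- Both sides glue `t` and `r` to intermediate results starting from `s`, in opposite order. The
exchange of the edges gives `(-1) ^ l`, and moving `t` past `r` gives `(-1) ^ (b * c)`. -/
theorem glueE_glueE {e' : Fin n₁ ⊕ Fin n₂ ≃ Bool ⊕ Fin m} {e : Fin m ⊕ Fin n₃ ≃ Bool ⊕ Fin n}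
    {f' : Fin n₁ ⊕ Fin n₃ ≃ Bool ⊕ Fin m'} {f : Fin m' ⊕ Fin n₂ ≃ Bool ⊕ Fin n}
    (h : (swapLastSum _ _ _).trans (nestFlags f' f) = (nestFlags e' e).trans (swapEdges (Fin n)))
    (hs : s ∈ tensGr V (Fin n₁) a) (ht : t ∈ tensGr V (Fin n₂) b)
    (hr : r ∈ tensGr V (Fin n₃) c) :
    glueE B f (glueE B f' (s ⊗ₜ r) ⊗ₜ t) =
      (l + b * c).negOnePow • glueE B e (glueE B e' (s ⊗ₜ t) ⊗ₜ r) := by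
  -- The first tensor is decomposable here while the other two vary; the reduction of a general `s`
  -- to this case comes last.
  have key : ∀ (x : Fin n₁ → V) (dx : Fin n₁ → ℤ), (∀ i, x i ∈ V.gr (dx i)) →
      glueE B f (glueE B f' (PiTensorProduct.tprod k x ⊗ₜ r) ⊗ₜ t) =
      (l + b * c).negOnePow • glueE B e (glueE B e' (PiTensorProduct.tprod k x ⊗ₜ t) ⊗ₜ r) := by
    intro x dx hx
    rw [← LinearMap.intUnits_smul_apply]
    refine tensGr_ext₂
      (f := (glueE₂ B f ∘ₗ glueE₂ B f' (PiTensorProduct.tprod k x)).flip)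
      (g := ((glueE₂ B e).compr₂ ((l + b * c).negOnePow • LinearMap.id)) ∘ₗ
        glueE₂ B e' (PiTensorProduct.tprod k x))
      (fun y z dy dz hy hz hb hc => ?_) ht hr
    have h1 := contractTwo_trans (B := B) (ι := (Fin n₁ ⊕ₗ Fin n₂) ⊕ₗ Fin n₃)
      (κ := (Fin n₁ ⊕ₗ Fin n₃) ⊕ₗ Fin n₂) (swapLastSum _ _ _) (nestFlags f' f)
      (Sum.elim (Sum.elim dx dy) dz) (Sum.elim (Sum.elim x y) z)
    have h2 := koszulSign_swapLastSum (α := Fin n₁) (β := Fin n₂) (γ := Fin n₃)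
      (Sum.elim (Sum.elim dx dy) dz)
    have h3 := contractTwo_swapEdges (B := B) (ι := (Fin n₁ ⊕ₗ Fin n₂) ⊕ₗ Fin n₃)
      (nestFlags e' e) fun q => sumElim_mem_gr (fun q => sumElim_mem_gr hx hy q) hz q
    replace h3 := (congrArg (fun E => contractTwo B (ι := (Fin n₁ ⊕ₗ Fin n₂) ⊕ₗ Fin n₃) E
      (Sum.elim (Sum.elim dx dy) dz) (Sum.elim (Sum.elim x y) z)) h).trans h3
    have h4 := glueE_glueE_tprod (B := B) hx hz hy f' f
    have h5 : glueE B f (glueE B f' (PiTensorProduct.tprod k x ⊗ₜ PiTensorProduct.tprod k z) ⊗ₜ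
        PiTensorProduct.tprod k y) = (b * c).negOnePow • contractTwo B
          (ι := (Fin n₁ ⊕ₗ Fin n₂) ⊕ₗ Fin n₃) ((swapLastSum _ _ _).trans (nestFlags f' f))
          (Sum.elim (Sum.elim dx dy) dz) (Sum.elim (Sum.elim x y) z) := by
      have h6 : koszulSign (ι := (Fin n₁ ⊕ₗ Fin n₂) ⊕ₗ Fin n₃)
          (κ := (Fin n₁ ⊕ₗ Fin n₃) ⊕ₗ Fin n₂) (swapLastSum (Fin n₁) (Fin n₂) (Fin n₃))
            (Sum.elim (Sum.elim dx dy) dz) = (b * c).negOnePow := by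
        rw [← hb, ← hc]; exact h2
      rw [h4]
      refine Eq.trans ?_ (congrArg _ h1).symm
      refine Eq.trans ?_ (congrArg _ (congrArg₂ (· • ·) h6.symm rfl))
      rw [intUnits_mul_smul, Int.negOnePow_mul_self', intUnits_one_smul]
      refine congrArg₂ (contractTwo B (ι := (Fin n₁ ⊕ₗ Fin n₃) ⊕ₗ Fin n₂) (nestFlags f' f))
        (funext ?_) (funext ?_)
      all_goals rintro ((q | q) | q) <;> rfl
    refine h5.trans ?_
    refine (congrArg _ h3).trans ?_
    rw [LinearMap.comp_apply, LinearMap.compr₂_apply, LinearMap.intUnits_smul_apply, glueE₂_apply,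
      glueE₂_apply, glueE_glueE_tprod hx hy hz, Int.negOnePow_add, intUnits_mul_smul,
      mul_comm l.negOnePow]
    rfl
  refine Eq.trans (tensGr_ext (f := (glueE₂ B f).flip t ∘ₗ (glueE₂ B f').flip r)
    (g := (l + b * c).negOnePow • ((glueE₂ B e).flip r ∘ₗ (glueE₂ B e').flip t))
    (fun x dx hx _ => ?_) hs) ?_
  · rw [LinearMap.intUnits_smul_apply]; exact key x dx hx
  · rw [LinearMap.intUnits_smul_apply]; rfl

end Relations

/-! ## The differential of tensor powers -/

section TensorDifferential

variable {k : Type u} [Field k] (V : ChainCx.{u, v} k)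

/-- The differential of `V ^ ⊗ ι`. -/
def tensDiff (ι : Type) [Fintype ι] [LinearOrder ι] : TPow V ι →ₗ[k] TPow V ι :=
  ∑ i : ι, PiTensorProduct.map fun j =>
    if j < i then V.sgn else if j = i then V.d else LinearMap.id

theorem tensD_eq (n : ℕ) : tensD V n = tensDiff V (Fin n) := rfl

variable {V}

section

variable {ι κ : Type} [Fintype ι] [LinearOrder ι] [Fintype κ] [LinearOrder κ]

/-- The sum of the degrees of the factors in front of the factor `i`. -/
def degBelow (deg : ι → ℤ) (i : ι) : ℤ := ∑ j with j < i, deg j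

/-- Application of the differential to the factor `i`. -/
def diffAt (x : ι → V) (i : ι) : ι → V := update x i (V.d (x i))

omit [Fintype ι] in
theorem diffAt_self (x : ι → V) (i : ι) : diffAt x i i = V.d (x i) := update_self _ _ _

omit [Fintype ι] in
theorem diffAt_of_ne (x : ι → V) {i j : ι} (h : j ≠ i) : diffAt x i j = x j := update_of_ne h _ _

theorem tensDiff_tprod {x : ι → V} {deg : ι → ℤ} (hx : ∀ i, x i ∈ V.gr (deg i)) :
    tensDiff V ι (PiTensorProduct.tprod k x) = ∑ i, (degBelow deg i).negOnePow •
      PiTensorProduct.tprod k (diffAt x i) := by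
  rw [tensDiff, LinearMap.sum_apply]
  refine Finset.sum_congr rfl fun i _ => ?_
  rw [PiTensorProduct.map_tprod, intUnits_smul_eq_cast_smul (k := k), degBelow, Int.negOnePow_sum,
    Finset.prod_filter]
  -- On the homogeneous factors in front of `i` the operator `V.sgn` is a scalar; multilinearity
  -- collects these scalars into one sign.
  have h := MultilinearMap.map_smul_univ (PiTensorProduct.tprod k)
    (fun j => ((((if j < i then (deg j).negOnePow else 1 : ℤˣ) : ℤ)) : k))
    (update x i (V.d (x i)))
  have h2 : ((((∏ j, if j < i then (deg j).negOnePow else 1 : ℤˣ) : ℤˣ) : ℤ) : k) =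
      ∏ j, ((((if j < i then (deg j).negOnePow else 1 : ℤˣ) : ℤ)) : k) := by
    push_cast; rfl
  rw [h2, diffAt, ← h]
  congr 1
  funext j
  rw [← intUnits_smul_eq_cast_smul]
  rcases lt_trichotomy j i with hj | hj | hj
  · rw [if_pos hj, if_pos hj, update_of_ne hj.ne, ChainCx.sgn_of_mem V (hx j)]
  · subst hj
    rw [if_neg (lt_irrefl _), if_neg (lt_irrefl _), if_pos rfl, update_self, intUnits_one_smul]
  · rw [if_neg hj.not_gt, if_neg hj.not_gt, if_neg hj.ne', update_of_ne hj.ne', intUnits_one_smul]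
    rfl

omit [Fintype ι] in
theorem diffAt_mem {x : ι → V} {deg : ι → ℤ} (hx : ∀ i, x i ∈ V.gr (deg i)) (i j : ι) :
    diffAt x i j ∈ V.gr (update deg i (deg i - 1) j) := by
  by_cases h : j = i
  · subst h; rw [diffAt_self, update_self]; exact V.d_mem _ _ (hx _)
  · rw [diffAt_of_ne x h, update_of_ne h]; exact hx j

theorem sum_update_sub_one (deg : ι → ℤ) (i : ι) :
    ∑ j, update deg i (deg i - 1) j = ∑ j, deg j - 1 := by
  rw [Finset.sum_update_of_mem (Finset.mem_univ i), ← Finset.add_sum_erase _ _ (Finset.mem_univ i),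
    Finset.sdiff_singleton_eq_erase]
  ring

theorem tensDiff_mem {a : ℤ} {t : TPow V ι} (ht : t ∈ tensGr V ι a) :
    tensDiff V ι t ∈ tensGr V ι (a - 1) := by
  refine tensGr_map (fun x deg hx ha => ?_) ht
  rw [tensDiff_tprod hx]
  refine sum_mem fun i _ => Submodule.intUnits_smul_mem _ _
    (tprod_mem_tensGr (diffAt_mem hx i) ?_)
  rw [sum_update_sub_one, ha]

/-- The term which differentiates the factor `i` is matched with the one which differentiates `e i`
after the permutation; `koszulSign_update` says that their signs agree. -/
theorem koszulMap_tensDiff (e : ι ≃ κ) {a : ℤ} {t : TPow V ι} (ht : t ∈ tensGr V ι a) :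
    koszulMap V e (tensDiff V ι t) = tensDiff V κ (koszulMap V e t) := by
  refine tensGr_ext (f := koszulMap V e ∘ₗ tensDiff V ι) (g := tensDiff V κ ∘ₗ koszulMap V e)
    (fun x deg hx _ => ?_) ht
  rw [LinearMap.comp_apply, LinearMap.comp_apply, tensDiff_tprod hx, koszulMap_tprod e hx,
    LinearMap.map_intUnits_smul, map_sum, tensDiff_tprod fun i => hx (e.symm i),
    intUnits_smul_sum]
  refine Fintype.sum_equiv e _ _ fun i => ?_
  rw [LinearMap.map_intUnits_smul, koszulMap_tprod e (diffAt_mem hx i), intUnits_mul_smul,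
    intUnits_mul_smul]
  have h1 : degBelow (fun j => deg (e.symm j)) (e i) = ∑ j with e j < e i, deg j := by
    rw [degBelow, Finset.sum_filter, Finset.sum_filter]
    exact (Fintype.sum_equiv e _ _ fun j => by simp).symm
  have h2 := koszulSign_update e deg i
  refine congrArg₂ (· • ·) ?_ (congrArg _ (funext fun j => ?_))
  · rw [h1, degBelow]
    have h3 := Int.negOnePow_mul_self' (∑ j with e j < e i, deg j)
    have h4 := Int.negOnePow_mul_self' (∑ j with j < i, deg j)
    calc _ = (∑ j with j < i, deg j).negOnePow *
          (koszulSign e (update deg i (deg i - 1)) * (∑ j with e j < e i, deg j).negOnePow) *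
            (∑ j with e j < e i, deg j).negOnePow := by rw [mul_assoc, mul_assoc, h3, mul_one]
      _ = ((∑ j with j < i, deg j).negOnePow * (∑ j with j < i, deg j).negOnePow) *
            koszulSign e deg * (∑ j with e j < e i, deg j).negOnePow := by rw [h2]; ac_rfl
      _ = _ := by rw [h4, one_mul]
  · by_cases h : j = e i
    · subst h; rw [diffAt_self, Equiv.symm_apply_apply, diffAt_self]
    · rw [diffAt_of_ne _ h, diffAt_of_ne]
      rintro rfl; simp at h

/-- Differentiating the same factor twice gives zero, and differentiating two different factors in
the two orders gives opposite terms. Thus the double sum equals its own negative. -/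
theorem tensDiff_tensDiff [CharZero k] {a : ℤ} {t : TPow V ι} (ht : t ∈ tensGr V ι a) :
    tensDiff V ι (tensDiff V ι t) = 0 := by
  refine tensGr_ext (f := tensDiff V ι ∘ₗ tensDiff V ι) (g := 0) (fun x deg hx _ => ?_) ht
  rw [LinearMap.comp_apply, tensDiff_tprod hx, map_sum, LinearMap.zero_apply]
  set T : ι → ι → TPow V ι := fun i j => (degBelow deg i).negOnePow •
    (degBelow (update deg i (deg i - 1)) j).negOnePow • PiTensorProduct.tprod k
      (diffAt (diffAt x i) j) with hT
  have h1 : ∑ i, tensDiff V ι ((degBelow deg i).negOnePow •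
      PiTensorProduct.tprod k (diffAt x i)) = ∑ i, ∑ j, T i j :=
    Finset.sum_congr rfl fun i _ => by
      rw [LinearMap.map_intUnits_smul, tensDiff_tprod (diffAt_mem hx i), intUnits_smul_sum]
  have hd : ∀ i, T i i = 0 := fun i => by
    rw [hT]
    dsimp only
    rw [MultilinearMap.map_coord_zero _ i (by rw [diffAt_self, diffAt_self, V.d_d]),
      intUnits_smul_zero, intUnits_smul_zero]
  have hlt : ∀ i j, i < j → T i j = -T j i := fun i j hij => by
    rw [hT]
    dsimp only
    have e0 : diffAt (diffAt x i) j = diffAt (diffAt x j) i := by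
      simp only [diffAt]
      rw [update_of_ne hij.ne', update_of_ne hij.ne, update_comm hij.ne]
    rw [e0, intUnits_mul_smul,
      intUnits_mul_smul, ← intUnits_neg_smul]
    -- If the earlier factor is differentiated first, the total degree in front of the later one has
    -- dropped by one. In the other order nothing changes in front of the earlier factor. This is
    -- the source of the minus sign.
    have e1 : degBelow (update deg i (deg i - 1)) j = degBelow deg j - 1 := by
      rw [degBelow, degBelow, Finset.sum_update_of_mem (by simpa using hij),
        ← Finset.add_sum_erase _ _ (show i ∈ Finset.univ.filter (· < j) by simpa using hij),
        Finset.sdiff_singleton_eq_erase]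
      ring
    have e2 : degBelow (update deg j (deg j - 1)) i = degBelow deg i :=
      Finset.sum_update_of_notMem (by simpa using hij.le) _ _
    rw [e1, e2, Int.negOnePow_sub, Int.negOnePow_one]
    refine congrArg₂ (· • ·) ?_ rfl
    simp [mul_comm]
  have hT' : ∀ i j, T i j = -T j i := fun i j => by
    rcases lt_trichotomy i j with h | h | h
    · exact hlt i j h
    · subst h; rw [hd, neg_zero]
    · rw [hlt j i h, neg_neg]
  rw [h1]
  have h2 : ∑ i, ∑ j, T i j = -∑ i, ∑ j, T i j := by
    conv_lhs => rw [Finset.sum_comm]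
    rw [← Finset.sum_neg_distrib]
    refine Finset.sum_congr rfl fun i _ => ?_
    rw [← Finset.sum_neg_distrib]
    exact Finset.sum_congr rfl fun j _ => hT' j i
  have h3 : (2 : k) • ∑ i, ∑ j, T i j = 0 := by
    rw [two_smul]
    nth_rw 2 [h2]
    exact add_neg_cancel _
  exact (smul_eq_zero.1 h3).resolve_left two_ne_zero

end

/-! ### Contractions are chain maps of degree `-l` -/

variable {l : ℤ} {η : ℤˣ} {B : InnerProd V l η}

theorem concat_tensDiff {n₁ n₂ : ℕ} {a b : ℤ} {s : TPow V (Fin n₁)} {t : TPow V (Fin n₂)}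
    (hs : s ∈ tensGr V (Fin n₁) a) (ht : t ∈ tensGr V (Fin n₂) b) :
    tensDiff V (Fin n₁ ⊕ₗ Fin n₂) (concat V n₁ n₂ (s ⊗ₜ t)) =
      concat V n₁ n₂ (tensDiff V (Fin n₁) s ⊗ₜ t) +
        a.negOnePow • concat V n₁ n₂ (s ⊗ₜ tensDiff V (Fin n₂) t) := by
  set c : TPow V (Fin n₁) →ₗ[k] TPow V (Fin n₂) →ₗ[k] TPow V (Fin n₁ ⊕ₗ Fin n₂) :=
    (TensorProduct.mk k _ _).compr₂ (concat V n₁ n₂) with hc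
  refine (tensGr_ext₂ (f := c.compr₂ (tensDiff V (Fin n₁ ⊕ₗ Fin n₂)))
    (g := c ∘ₗ tensDiff V (Fin n₁) + a.negOnePow • (c.compl₂ (tensDiff V (Fin n₂))))
    (fun x y dx dy hx hy ha _ => ?_) hs ht).trans ?_
  · rw [LinearMap.compr₂_apply, LinearMap.add_apply, LinearMap.add_apply,
      LinearMap.intUnits_smul_apply, LinearMap.intUnits_smul_apply, LinearMap.comp_apply,
      LinearMap.compl₂_apply, tensDiff_tprod hx, tensDiff_tprod hy, map_sum, map_sum,
      LinearMap.sum_apply, intUnits_smul_sum]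
    change tensDiff V (Fin n₁ ⊕ₗ Fin n₂) (concat V n₁ n₂
      (PiTensorProduct.tprod k x ⊗ₜ PiTensorProduct.tprod k y)) = _
    rw [concat_tprod, tensDiff_tprod (deg := fun q => Sum.elim dx dy (ofLex q))
      fun q => sumElim_mem_gr hx hy (ofLex q)]
    have hsum : ∀ {M : Type max u v} [AddCommMonoid M] (f : Fin n₁ ⊕ₗ Fin n₂ → M), ∑ q, f q =
        ∑ i, f (toLex (Sum.inl i)) + ∑ i, f (toLex (Sum.inr i)) := fun f =>
      (Fintype.sum_equiv ofLex _ (fun q => f (toLex q)) fun _ => rfl).trans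
        (Fintype.sum_sum_type _)
    have hsumZ : ∀ (f : Fin n₁ ⊕ₗ Fin n₂ → ℤ), ∑ q, f q =
        ∑ i, f (toLex (Sum.inl i)) + ∑ i, f (toLex (Sum.inr i)) := fun f =>
      (Fintype.sum_equiv ofLex _ (fun q => f (toLex q)) fun _ => rfl).trans
        (Fintype.sum_sum_type _)
    rw [hsum]
    refine congrArg₂ _ (Finset.sum_congr rfl fun i _ => ?_) (Finset.sum_congr rfl fun i _ => ?_)
    · rw [LinearMap.map_intUnits_smul₂]
      refine congrArg₂ (· • ·) (congrArg _ ?_) ?_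
      · rw [degBelow, degBelow, Finset.sum_filter, Finset.sum_filter, hsumZ]
        simp
      · refine Eq.trans ?_ (concat_tprod _ _ _ _).symm
        congr 1
        funext q
        rcases q with q | q
        · by_cases h : q = i
          · subst h; exact (diffAt_self (ι := Fin n₁ ⊕ₗ Fin n₂) _ _).trans (diffAt_self x q).symm
          · exact (diffAt_of_ne (ι := Fin n₁ ⊕ₗ Fin n₂) _
              (fun hh => h (Sum.inl_injective hh))).trans (diffAt_of_ne x h).symm
        · exact diffAt_of_ne (ι := Fin n₁ ⊕ₗ Fin n₂) _ (by rintro ⟨⟩)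
    · rw [LinearMap.map_intUnits_smul, intUnits_mul_smul, ← Int.negOnePow_add]
      refine congrArg₂ (· • ·) (congrArg _ ?_) ?_
      · rw [degBelow, degBelow, Finset.sum_filter, Finset.sum_filter, hsumZ]
        simp [ha]
      · refine Eq.trans ?_ (concat_tprod _ _ _ _).symm
        congr 1
        funext q
        rcases q with q | q
        · exact diffAt_of_ne (ι := Fin n₁ ⊕ₗ Fin n₂) _ (by rintro ⟨⟩)
        · by_cases h : q = i
          · subst h; exact (diffAt_self (ι := Fin n₁ ⊕ₗ Fin n₂) _ _).trans (diffAt_self y q).symm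
          · exact (diffAt_of_ne (ι := Fin n₁ ⊕ₗ Fin n₂) _
              (fun hh => h (Sum.inr_injective hh))).trans (diffAt_of_ne y h).symm
  · rw [LinearMap.add_apply, LinearMap.add_apply,
      LinearMap.intUnits_smul_apply, LinearMap.intUnits_smul_apply]
    rfl

/-- The two terms which differentiate a contracted factor cancel because `B` is a chain map
(`form_d`). In each of the others the differential passes the contracted pair, of total degree `l`
unless `B` vanishes on it, which gives `(-1) ^ l`. -/
theorem contractFirst_tensDiff {n : ℕ} {a : ℤ} {t : TPow V (Bool ⊕ₗ Fin n)}
    (ht : t ∈ tensGr V (Bool ⊕ₗ Fin n) a) :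
    tensDiff V (Fin n) (contractFirst B n t) =
      l.negOnePow • contractFirst B n (tensDiff V (Bool ⊕ₗ Fin n) t) := by
  refine (tensGr_ext (f := tensDiff V (Fin n) ∘ₗ contractFirst B n)
    (g := l.negOnePow • (contractFirst B n ∘ₗ tensDiff V (Bool ⊕ₗ Fin n)))
    (fun x deg hx _ => ?_) ht).trans (LinearMap.intUnits_smul_apply _ _ _)
  rw [LinearMap.intUnits_smul_apply, LinearMap.comp_apply, LinearMap.comp_apply,
    contractFirst_tprod, map_smul, tensDiff_tprod fun i => hx (toLex (Sum.inr i)),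
    tensDiff_tprod hx, map_sum]
  have hsum : ∀ {M : Type max u v} [AddCommMonoid M] (f : Bool ⊕ₗ Fin n → M), ∑ q, f q =
      (f (toLex (Sum.inl true)) + f (toLex (Sum.inl false))) + ∑ i, f (toLex (Sum.inr i)) :=
    fun f => ((Fintype.sum_equiv ofLex _ (fun q => f (toLex q)) fun _ => rfl).trans
      (Fintype.sum_sum_type _)).trans (by rw [Fintype.sum_bool])
  have hsumZ : ∀ (f : Bool ⊕ₗ Fin n → ℤ), ∑ q, f q =
      (f (toLex (Sum.inl true)) + f (toLex (Sum.inl false))) + ∑ i, f (toLex (Sum.inr i)) :=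
    fun f => ((Fintype.sum_equiv ofLex _ (fun q => f (toLex q)) fun _ => rfl).trans
      (Fintype.sum_sum_type _)).trans (by rw [Fintype.sum_bool])
  have hb : ∀ c : Bool, (fun i => diffAt x (toLex (Sum.inl c)) (toLex (Sum.inr i))) = fun i => x (toLex (Sum.inr i)) := fun c =>
    funext fun i => diffAt_of_ne _ (by rintro ⟨⟩)
  have h0 : (contractFirst B n) ((degBelow deg (toLex (Sum.inl true))).negOnePow •
        PiTensorProduct.tprod k (diffAt x (toLex (Sum.inl true)))) +
      (contractFirst B n) ((degBelow deg (toLex (Sum.inl false))).negOnePow •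
        PiTensorProduct.tprod k
          (diffAt x (toLex (Sum.inl false)))) = 0 := by
    have hd := B.form_d _ (x (toLex (Sum.inl false))) (x (toLex (Sum.inl true))) (hx _)
    have e1 : degBelow deg (toLex (Sum.inl true) : Bool ⊕ₗ Fin n) =
        deg (toLex (Sum.inl false)) := by
      rw [degBelow, Finset.sum_filter, hsumZ]; simp
    have e2 : degBelow deg (toLex (Sum.inl false) : Bool ⊕ₗ Fin n) = 0 := by
      rw [degBelow, Finset.sum_filter, hsumZ]; simp
    rw [LinearMap.map_intUnits_smul, LinearMap.map_intUnits_smul, contractFirst_tprod,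
      contractFirst_tprod, hb, hb, e1, e2, diffAt_self, diffAt_self,
      diffAt_of_ne _ (by rintro ⟨⟩), diffAt_of_ne _ (by rintro ⟨⟩), Int.negOnePow_zero,
      intUnits_one_smul, intUnits_smul_eq_cast_smul (k := k), smul_smul, ← add_smul,
      add_comm]
    rw [Units.smul_def, zsmul_eq_mul] at hd
    rw [hd, zero_smul]
  rw [hsum, h0, zero_add, Finset.smul_sum, intUnits_smul_sum]
  refine Finset.sum_congr rfl fun i _ => ?_
  have e3 : degBelow deg (toLex (Sum.inr i) : Bool ⊕ₗ Fin n) =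
      deg (toLex (Sum.inl false)) + deg (toLex (Sum.inl true)) +
        degBelow (fun j => deg (toLex (Sum.inr j))) i := by
    rw [degBelow, degBelow, Finset.sum_filter, Finset.sum_filter, hsumZ]; simp [add_comm]
  have e4 : (fun j => diffAt x (toLex (Sum.inr i)) (toLex (Sum.inr j))) =
      diffAt (fun j => x (toLex (Sum.inr j))) i := by
    funext j
    by_cases h : j = i
    · subst h; rw [diffAt_self, diffAt_self]
    · rw [diffAt_of_ne _ h]
      exact diffAt_of_ne (ι := Bool ⊕ₗ Fin n) _ fun hh => h (Sum.inr_injective hh)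
  rw [LinearMap.map_intUnits_smul, contractFirst_tprod, e3, e4, diffAt_of_ne _ (by rintro ⟨⟩),
    diffAt_of_ne _ (by rintro ⟨⟩), ← intUnits_smul_smul]
  by_cases h : deg (toLex (Sum.inl false)) + deg (toLex (Sum.inl true)) = l
  · rw [h, intUnits_mul_smul, Int.negOnePow_add, ← mul_assoc, Int.negOnePow_mul_self', one_mul]
  · rw [B.form_degree _ _ _ _ (hx _) (hx _) h, zero_smul, intUnits_smul_zero, intUnits_smul_zero,
      intUnits_smul_zero]

theorem concat_mem {n₁ n₂ : ℕ} {a b : ℤ} {s : TPow V (Fin n₁)} {t : TPow V (Fin n₂)}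
    (hs : s ∈ tensGr V (Fin n₁) a) (ht : t ∈ tensGr V (Fin n₂) b) :
    concat V n₁ n₂ (s ⊗ₜ t) ∈ tensGr V (Fin n₁ ⊕ₗ Fin n₂) (a + b) := by
  refine (tensGr_le_iff (S := (tensGr V (Fin n₁ ⊕ₗ Fin n₂) (a + b)).comap
    (concat V n₁ n₂ ∘ₗ (TensorProduct.mk k _ _).flip t))).2 (fun x dx hx hax => ?_) hs
  refine (tensGr_le_iff (S := (tensGr V (Fin n₁ ⊕ₗ Fin n₂) (a + b)).comap
    (concat V n₁ n₂ ∘ₗ TensorProduct.mk k _ _ (PiTensorProduct.tprod k x)))).2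
      (fun y dy hy hby => ?_) ht
  change concat V n₁ n₂ (PiTensorProduct.tprod k x ⊗ₜ PiTensorProduct.tprod k y) ∈
    tensGr V (Fin n₁ ⊕ₗ Fin n₂) (a + b)
  rw [concat_tprod]
  refine tprod_mem_tensGr (deg := fun q => Sum.elim dx dy (ofLex q))
    (fun q => sumElim_mem_gr hx hy (ofLex q)) ?_
  rw [← hax, ← hby]
  exact (Fintype.sum_equiv ofLex _ (Sum.elim dx dy) fun _ => rfl).trans (Fintype.sum_sum_type _)

theorem tensD_glueE {n₁ n₂ n : ℕ} (e : Fin n₁ ⊕ Fin n₂ ≃ Bool ⊕ Fin n) {a b : ℤ}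
    {s : TPow V (Fin n₁)} {t : TPow V (Fin n₂)} (hs : s ∈ tensGr V (Fin n₁) a)
    (ht : t ∈ tensGr V (Fin n₂) b) :
    tensD V n (glueE B e (s ⊗ₜ t)) = l.negOnePow • (glueE B e (tensD V n₁ s ⊗ₜ t) +
      a.negOnePow • glueE B e (s ⊗ₜ tensD V n₂ t)) := by
  rw [tensD_eq, tensD_eq, tensD_eq, glueE, LinearMap.comp_apply, LinearMap.comp_apply,
    contractFirst_tensDiff (koszulMap_mem _ (concat_mem hs ht)),
    ← koszulMap_tensDiff _ (concat_mem hs ht), concat_tensDiff hs ht, map_add, map_add,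
    LinearMap.map_intUnits_smul, LinearMap.map_intUnits_smul]
  rfl

theorem tensD_selfGlueE {m n : ℕ} (e : Fin m ≃ Bool ⊕ Fin n) {a : ℤ}
    {s : TPow V (Fin m)} (hs : s ∈ tensGr V (Fin m) a) :
    tensD V n (selfGlueE B e s) = l.negOnePow • selfGlueE B e (tensD V m s) := by
  have hs' : koszulMap V (e.trans toLex : Fin m ≃ Bool ⊕ₗ Fin n) s ∈
    tensGr V (Bool ⊕ₗ Fin n) a := koszulMap_mem _ hs
  rw [tensD_eq, tensD_eq, selfGlueE, LinearMap.comp_apply, LinearMap.comp_apply,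
    contractFirst_tensDiff hs', koszulMap_tensDiff _ hs]

end TensorDifferential

/-! ## Graphs with one edge -/

/-- The two ends of the edge lie on the first, respectively on the second factor. -/
def JoinsFactors {α β γ : Type} (e : α ⊕ β ≃ Bool ⊕ γ) : Prop :=
  (∃ i, e (Sum.inl i) = Sum.inl false) ∧ ∃ j, e (Sum.inr j) = Sum.inl true

/-- The flags of a graph with two vertices. -/
def twoVertexFlags (n₁ n₂ : ℕ) : Fin n₁ ⊕ Fin n₂ ≃ Σ v : Bool, Fin (bif v then n₂ else n₁) where
  toFun := Sum.elim (fun i => ⟨false, i⟩) (fun j => ⟨true, j⟩)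
  invFun := fun q => match q with
    | ⟨false, i⟩ => Sum.inl i
    | ⟨true, j⟩ => Sum.inr j
  left_inv := by rintro (i | j) <;> rfl
  right_inv := by rintro ⟨_ | _, i⟩ <;> rfl

theorem card_of_joinEquiv {n₁ n₂ n : ℕ} (e : Fin n₁ ⊕ Fin n₂ ≃ Bool ⊕ Fin n) :
    n₁ + n₂ = n + 2 := by
  have := Fintype.card_congr e
  simp only [Fintype.card_sum, Fintype.card_fin, Fintype.card_bool] at this
  omega

theorem card_of_loopEquiv {m n : ℕ} (e : Fin m ≃ Bool ⊕ Fin n) : m = n + 2 := by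
  have := Fintype.card_congr e
  simp only [Fintype.card_sum, Fintype.card_fin, Fintype.card_bool] at this
  omega

namespace StableGraph

/-- The graph with one vertex and one loop, with an arbitrary identification of the flags. -/
def loopGraph {m n b b' : ℕ} (e : Fin m ≃ Bool ⊕ Fin n) (hb : b + 1 = b') (h : 2 < 2 * b + m) :
    StableGraph n b' where
  Vert := Unit
  Edge := Unit
  val _ := m
  gen _ := b
  glue := (((Equiv.sumCongr (Equiv.refl _) (Equiv.punitProd Bool)).trans
    (Equiv.sumComm _ _)).trans e.symm).trans (Equiv.uniqueSigma fun _ : Unit => Fin m).symm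
  stable _ := h
  nonempty := inferInstance
  connected _ _ := Relation.EqvGen.refl _
  genus := by simp [← hb]

/-- The graph with two vertices and one edge, with an arbitrary identification of the flags. -/
def pairGraph {n₁ n₂ n b₁ b₂ b : ℕ} (e : Fin n₁ ⊕ Fin n₂ ≃ Bool ⊕ Fin n) (he : JoinsFactors e)
    (hb : b₁ + b₂ = b) (h₁ : 2 < 2 * b₁ + n₁) (h₂ : 2 < 2 * b₂ + n₂) : StableGraph n b where
  Vert := Bool
  Edge := Unit
  val v := bif v then n₂ else n₁
  gen v := bif v then b₂ else b₁
  glue := (((Equiv.sumCongr (Equiv.refl _) (Equiv.punitProd Bool)).trans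
    (Equiv.sumComm _ _)).trans e.symm).trans (twoVertexFlags n₁ n₂)
  stable v := by cases v <;> assumption
  nonempty := inferInstance
  connected v v' := by
    have h : Relation.EqvGen (fun u u' : Bool => u = false ∧ u' = true) false true :=
      Relation.EqvGen.rel _ _ ⟨rfl, rfl⟩
    have hm : ∀ u u' : Bool, Relation.EqvGen (fun u u' : Bool => u = false ∧ u' = true) u u' := by
      rintro (_ | _) (_ | _)
      exacts [Relation.EqvGen.refl _, h, Relation.EqvGen.symm _ _ h, Relation.EqvGen.refl _]
    refine Relation.EqvGen.mono ?_ v v' (hm v v')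
    rintro u u' ⟨rfl, rfl⟩
    obtain ⟨⟨i, hi⟩, j, hj⟩ := he
    refine ⟨(), ?_, ?_⟩
    · change (twoVertexFlags n₁ n₂ (e.symm (Sum.inl false))).1 = false
      rw [← hi, Equiv.symm_apply_apply]; rfl
    · change (twoVertexFlags n₁ n₂ (e.symm (Sum.inl true))).1 = true
      rw [← hj, Equiv.symm_apply_apply]; rfl
  genus := by
    simp only [Fintype.card_bool, Fintype.univ_bool, Finset.mem_singleton, Bool.true_eq_false,
      not_false_eq_true, Finset.sum_insert, Finset.sum_singleton, cond_true, cond_false,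
      Fintype.card_unit]
    omega

end StableGraph

section GlueP

variable {k : Type u} [Field k] {p : ℤ} {η : ℤˣ} (P : TwistedModularOperad.{u, w} k p η)

theorem StableSModule.transport_refl (Q : StableSModule.{u, w} k) {n b : ℕ} (x : Q.obj n b) :
    Q.transport (Equiv.refl (Fin n)) rfl x = x := by
  change Q.act n b 1 x = x
  rw [map_one]; rfl

/-- The composition along the graph with two vertices and one edge. -/
def glueP {n₁ n₂ n : ℕ} (e : Fin n₁ ⊕ Fin n₂ ≃ Bool ⊕ Fin n) (b₁ b₂ b : ℕ) :
    P.obj n₁ b₁ →ₗ[k] P.obj n₂ b₂ →ₗ[k] P.obj n b :=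
  open Classical in
  -- The value is zero when the data do not define a stable graph. Keeping `b` as a variable,
  -- instead of the expression `b₁ + b₂`, avoids transports between components of `P`.
  if h : (JoinsFactors e ∧ b₁ + b₂ = b) ∧ 2 < 2 * b₁ + n₁ ∧ 2 < 2 * b₂ + n₂ then
    let G := StableGraph.pairGraph e h.1.1 h.1.2 h.2.1 h.2.2
    have hx : ∀ x x' y, P.pairLabel x' y = update (P.pairLabel x y) false x' := fun x x' y => by
      funext v; cases v <;> rfl
    have hy : ∀ x y y', P.pairLabel x y' = update (P.pairLabel x y) true y' := fun x y y' => by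
      funext v; cases v <;> rfl
    LinearMap.mk₂ k (fun x y => P.comp G (P.pairLabel x y))
      (fun x x' y => by
        have := (P.comp G).map_update_add (P.pairLabel 0 y) false x x'
        rw [hx 0 x y, hx 0 x' y, hx 0 (x + x') y]
        exact this)
      (fun c x y => by
        have := (P.comp G).map_update_smul (P.pairLabel 0 y) false c x
        rw [hx 0 x y, hx 0 (c • x) y]
        exact this)
      (fun x y y' => by
        have := (P.comp G).map_update_add (P.pairLabel x 0) true y y'
        rw [hy x 0 y, hy x 0 y', hy x 0 (y + y')]
        exact this)
      (fun c x y => by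
        have := (P.comp G).map_update_smul (P.pairLabel x 0) true c y
        rw [hy x 0 y, hy x 0 (c • y)]
        exact this)
  else 0

/-- The composition along the graph with one vertex and one loop. -/
def selfGlueP {m n : ℕ} (e : Fin m ≃ Bool ⊕ Fin n) (b b' : ℕ) : P.obj m b →ₗ[k] P.obj n b' :=
  if h : b + 1 = b' ∧ 2 < 2 * b + m then
    { toFun := fun x => P.comp (StableGraph.loopGraph e h.1 h.2) (fun _ => x)
      map_add' := fun x y => by
        have h' := fun z : P.obj m b => (funext fun _ => rfl :
          update (fun _ : Unit => (0 : P.obj m b)) () z = fun _ => z)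
        have := (P.comp (StableGraph.loopGraph e h.1 h.2)).map_update_add (fun _ => 0) () x y
        exact ((congrArg _ (h' _)).symm.trans this).trans
          (congrArg₂ (· + ·) (congrArg _ (h' x)) (congrArg _ (h' y)))
      map_smul' := fun c x => by
        have h' := fun z : P.obj m b => (funext fun _ => rfl :
          update (fun _ : Unit => (0 : P.obj m b)) () z = fun _ => z)
        have := (P.comp (StableGraph.loopGraph e h.1 h.2)).map_update_smul (fun _ => 0) () c x
        exact ((congrArg _ (h' _)).symm.trans this).trans (congrArg (c • ·) (congrArg _ (h' x))) }
  else 0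

theorem joinsFactors_pairFlags (n₁ n₂ : ℕ) : JoinsFactors (pairFlags n₁ n₂) :=
  ⟨⟨Fin.last n₁, by simp [pairFlags]⟩, ⟨0, by simp [pairFlags]⟩⟩

variable {P}

section

variable {n₁ n₂ m n b₁ b₂ b b' : ℕ}

theorem glueP_apply {e : Fin n₁ ⊕ Fin n₂ ≃ Bool ⊕ Fin n} (he : JoinsFactors e)
    (hb : b₁ + b₂ = b) (h₁ : 2 < 2 * b₁ + n₁) (h₂ : 2 < 2 * b₂ + n₂) (x : P.obj n₁ b₁)
    (y : P.obj n₂ b₂) :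
    glueP P e b₁ b₂ b x y = P.comp (StableGraph.pairGraph e he hb h₁ h₂) (P.pairLabel x y) := by
  rw [glueP, dif_pos ⟨⟨he, hb⟩, h₁, h₂⟩]; rfl

theorem selfGlueP_apply (e : Fin m ≃ Bool ⊕ Fin n) (hb : b + 1 = b') (h : 2 < 2 * b + m)
    (x : P.obj m b) :
    selfGlueP P e b b' x = P.comp (StableGraph.loopGraph e hb h) (fun _ => x) := by
  rw [selfGlueP, dif_pos ⟨hb, h⟩]; rfl

theorem pairP_eq (n₁ n₂ b₁ b₂ : ℕ) :
    P.pairP n₁ n₂ b₁ b₂ = glueP P (pairFlags n₁ n₂) b₁ b₂ (b₁ + b₂) := by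
  by_cases h : 2 < 2 * b₁ + (n₁ + 1) ∧ 2 < 2 * b₂ + (n₂ + 1)
  · ext x y
    rw [glueP_apply (joinsFactors_pairFlags _ _) rfl h.1 h.2, TwistedModularOperad.pairP,
      dif_pos h]
    change P.comp (StableGraph.pair n₁ n₂ b₁ b₂ h.1 h.2) (P.pairLabel x y) = _
    -- The two graphs differ only in the way `glue` is written and in the proof of connectedness, so
    -- it suffices to substitute along an equality of the gluing maps.
    have key : ∀ (g g' : Fin (n₁ + n₂) ⊕ Unit × Bool ≃
        Σ v : Bool, Fin (bif v then n₂ + 1 else n₁ + 1)) (hg : g = g') c c',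
        P.comp (n := n₁ + n₂) (b := b₁ + b₂) ⟨Bool, Unit, _, fun v => bif v then b₂ else b₁, g,
          (StableGraph.pair n₁ n₂ b₁ b₂ h.1 h.2).stable,
          (StableGraph.pair n₁ n₂ b₁ b₂ h.1 h.2).nonempty, c,
          (StableGraph.pair n₁ n₂ b₁ b₂ h.1 h.2).genus⟩ (P.pairLabel x y) =
        P.comp ⟨Bool, Unit, _, fun v => bif v then b₂ else b₁, g',
          (StableGraph.pair n₁ n₂ b₁ b₂ h.1 h.2).stable,
          (StableGraph.pair n₁ n₂ b₁ b₂ h.1 h.2).nonempty, c',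
          (StableGraph.pair n₁ n₂ b₁ b₂ h.1 h.2).genus⟩ (P.pairLabel x y) := by
      rintro g _ rfl c c'; rfl
    exact key (StableGraph.pair n₁ n₂ b₁ b₂ h.1 h.2).glue (StableGraph.pairGraph (pairFlags n₁ n₂)
      (joinsFactors_pairFlags n₁ n₂) (rfl : b₁ + b₂ = _) h.1 h.2).glue
      (Equiv.ext fun q => rfl) (StableGraph.pair n₁ n₂ b₁ b₂ h.1 h.2).connected
      (StableGraph.pairGraph (pairFlags n₁ n₂) (joinsFactors_pairFlags n₁ n₂)
        (rfl : b₁ + b₂ = _) h.1 h.2).connected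
  · rw [TwistedModularOperad.pairP, dif_neg h, glueP, dif_neg fun h' => h h'.2]

theorem loopP_eq (n b : ℕ) : P.loopP n b = selfGlueP P (loopFlags n) b (b + 1) := by
  by_cases h : 2 < 2 * b + (n + 2)
  · ext x
    rw [selfGlueP_apply _ rfl h, TwistedModularOperad.loopP, dif_pos h]
    rfl
  · rw [TwistedModularOperad.loopP, dif_neg h, selfGlueP, dif_neg fun h' => h h'.2]

theorem eq_zero_of_unstable (h : ¬ 2 < 2 * b + n) (x : P.obj n b) : x = 0 :=
  haveI := P.unstable n b h
  Subsingleton.elim _ _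

theorem pairLabel_mem {i j : ℤ} {x : P.obj n₁ b₁} {y : P.obj n₂ b₂} (hx : x ∈ (P.obj n₁ b₁).gr i)
    (hy : y ∈ (P.obj n₂ b₂).gr j) (v : Bool) :
    P.pairLabel x y v ∈ (P.obj (bif v then n₂ else n₁) (bif v then b₂ else b₁)).gr
      (bif v then j else i) := by
  cases v
  exacts [hx, hy]

theorem glueP_mem (e : Fin n₁ ⊕ Fin n₂ ≃ Bool ⊕ Fin n) {i j : ℤ} {x : P.obj n₁ b₁}
    {y : P.obj n₂ b₂} (hx : x ∈ (P.obj n₁ b₁).gr i) (hy : y ∈ (P.obj n₂ b₂).gr j) :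
    glueP P e b₁ b₂ b x y ∈ (P.obj n b).gr (p + i + j) := by
  by_cases h : (JoinsFactors e ∧ b₁ + b₂ = b) ∧ 2 < 2 * b₁ + n₁ ∧ 2 < 2 * b₂ + n₂
  · rw [glueP_apply h.1.1 h.1.2 h.2.1 h.2.2]
    have := P.comp_mem (StableGraph.pairGraph e h.1.1 h.1.2 h.2.1 h.2.2)
      (fun v : Bool => bif v then j else i) (P.pairLabel x y) (pairLabel_mem hx hy)
    convert this using 2
    change _ = p * ((Fintype.card Unit : ℕ) : ℤ) + ∑ v : Bool, (bif v then j else i)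
    rw [Fintype.sum_bool]; simp; ring
  · rw [glueP, dif_neg h]; exact zero_mem _

theorem selfGlueP_mem (e : Fin m ≃ Bool ⊕ Fin n) {i : ℤ} {x : P.obj m b}
    (hx : x ∈ (P.obj m b).gr i) : selfGlueP P e b b' x ∈ (P.obj n b').gr (p + i) := by
  by_cases h : b + 1 = b' ∧ 2 < 2 * b + m
  · rw [selfGlueP_apply e h.1 h.2]
    have := P.comp_mem (StableGraph.loopGraph e h.1 h.2) (fun _ => i) (fun _ => x) fun _ => hx
    convert this using 2
    change _ = p * ((Fintype.card Unit : ℕ) : ℤ) + ∑ v : Unit, i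
    simp
  · rw [selfGlueP, dif_neg h]; exact zero_mem _

theorem d_glueP (e : Fin n₁ ⊕ Fin n₂ ≃ Bool ⊕ Fin n) {i j : ℤ} {x : P.obj n₁ b₁}
    {y : P.obj n₂ b₂} (hx : x ∈ (P.obj n₁ b₁).gr i) (hy : y ∈ (P.obj n₂ b₂).gr j) :
    (P.obj n b).d (glueP P e b₁ b₂ b x y) =
      p.negOnePow • (glueP P e b₁ b₂ b ((P.obj n₁ b₁).d x) y +
        i.negOnePow • glueP P e b₁ b₂ b x ((P.obj n₂ b₂).d y)) := by
  by_cases h : (JoinsFactors e ∧ b₁ + b₂ = b) ∧ 2 < 2 * b₁ + n₁ ∧ 2 < 2 * b₂ + n₂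
  · rw [glueP_apply h.1.1 h.1.2 h.2.1 h.2.2, glueP_apply h.1.1 h.1.2 h.2.1 h.2.2,
      glueP_apply h.1.1 h.1.2 h.2.1 h.2.2]
    have := P.comp_d (StableGraph.pairGraph e h.1.1 h.1.2 h.2.1 h.2.2)
      (fun v : Bool => bif v then j else i) (P.pairLabel x y) (pairLabel_mem hx hy)
    rw [this]
    refine (Fintype.sum_bool _).trans ?_
    rw [add_comm, intUnits_smul_add, intUnits_mul_smul]
    have hs : ∀ v : Bool, (∑ u : Bool with u < v, (bif u then j else i)) = bif v then i else 0 := by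
      rw [Bool.forall_bool]; constructor <;> simp [Finset.sum_filter]
    refine congrArg₂ (· + ·) (congrArg₂ (· • ·) ?_ ?_) (congrArg₂ (· • ·) ?_ ?_)
    · refine congrArg Int.negOnePow ?_
      refine (congrArg₂ (· + ·) (?_ : _ = p) (hs false)).trans (add_zero p)
      change p * ((Fintype.card Unit : ℕ) : ℤ) = p
      simp
    · refine congrArg _ (funext fun v => ?_)
      cases v <;> rfl
    · rw [← Int.negOnePow_add]
      refine congrArg Int.negOnePow ?_
      refine congrArg₂ (· + ·) ?_ (hs true)
      change p * ((Fintype.card Unit : ℕ) : ℤ) = p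
      simp
    · refine congrArg _ (funext fun v => ?_)
      cases v <;> rfl
  · rw [glueP, dif_neg h]; simp

theorem d_selfGlueP (e : Fin m ≃ Bool ⊕ Fin n) {i : ℤ} {x : P.obj m b}
    (hx : x ∈ (P.obj m b).gr i) :
    (P.obj n b').d (selfGlueP P e b b' x) =
      p.negOnePow • selfGlueP P e b b' ((P.obj m b).d x) := by
  by_cases h : b + 1 = b' ∧ 2 < 2 * b + m
  · rw [selfGlueP_apply e h.1 h.2, selfGlueP_apply e h.1 h.2]
    have := P.comp_d (StableGraph.loopGraph e h.1 h.2) (fun _ => i) (fun _ => x) fun _ => hx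
    rw [this]
    refine (Fintype.sum_unique (ι := Unit) _).trans ?_
    refine congrArg₂ (· • ·) (congrArg Int.negOnePow ?_) rfl
    change p * ((Fintype.card Unit : ℕ) : ℤ) + (∑ u : Unit with u < (), i) = p
    simp
  · rw [selfGlueP, dif_neg h]; simp

end

end GlueP

/-! ## Equivariance of the compositions along graphs with one edge -/

theorem koszulSign_refl {ι : Type} [Fintype ι] [LinearOrder ι] (deg : ι → ℤ) :
    koszulSign (Equiv.refl ι) deg = 1 :=
  koszulSign_eq_one_of_strictMono _ (fun _ _ h => h) deg

theorem koszulSign_boolNot (deg : Bool → ℤ) :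
    koszulSign Equiv.boolNot deg = (deg false * deg true).negOnePow := by
  simp [koszulSign, Fintype.prod_prod_type]

/-- Bijections of the flags at both vertices. -/
def bothFlags {n₁ n₂ n₁' n₂' : ℕ} (g₁ : Fin n₁ ≃ Fin n₁') (g₂ : Fin n₂ ≃ Fin n₂') :
    ∀ v : Bool, Fin (bif v then n₂ else n₁) ≃ Fin (bif v then n₂' else n₁')
  | false => g₁
  | true => g₂

/-- The identification of the flags when the two vertices are exchanged. -/
def exchangeFlags (n₁ n₂ : ℕ) :
    ∀ v : Bool, Fin (bif v then n₂ else n₁) ≃ Fin (bif !v then n₁ else n₂)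
  | false => Equiv.refl _
  | true => Equiv.refl _

theorem twoVertexFlags_map {n₁ n₂ n₁' n₂' : ℕ} (g₁ : Fin n₁ ≃ Fin n₁') (g₂ : Fin n₂ ≃ Fin n₂')
    (q : Fin n₁ ⊕ Fin n₂) : twoVertexFlags n₁' n₂' (Sum.map g₁ g₂ q) =
      ⟨(twoVertexFlags n₁ n₂ q).1, bothFlags g₁ g₂ _ (twoVertexFlags n₁ n₂ q).2⟩ := by
  cases q <;> rfl

theorem twoVertexFlags_swap {n₁ n₂ : ℕ} (q : Fin n₁ ⊕ Fin n₂) :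
    twoVertexFlags n₂ n₁ (Equiv.sumComm _ _ q) =
      ⟨!(twoVertexFlags n₁ n₂ q).1, exchangeFlags n₁ n₂ _ (twoVertexFlags n₁ n₂ q).2⟩ := by
  cases q <;> rfl

section Equivariance

variable {k : Type u} [Field k] {p : ℤ} {η : ℤˣ} {P : TwistedModularOperad.{u, w} k p η}
  {n₁ n₂ m n b₁ b₂ b b' : ℕ}

theorem JoinsFactors.congr {e e' : Fin n₁ ⊕ Fin n₂ ≃ Bool ⊕ Fin n}
    {g₁ : Equiv.Perm (Fin n₁)} {g₂ : Equiv.Perm (Fin n₂)} {h : Equiv.Perm (Fin n)}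
    (H : (Equiv.sumCongr g₁ g₂).trans e' = e.trans (Equiv.sumCongr (Equiv.refl _) h))
    (he : JoinsFactors e) : JoinsFactors e' := by
  obtain ⟨⟨i, hi⟩, j, hj⟩ := he
  have H' := fun q => congrArg (fun f => f q) H
  refine ⟨⟨g₁ i, ?_⟩, g₂ j, ?_⟩
  · have := H' (Sum.inl i); simp [hi] at this; exact this
  · have := H' (Sum.inr j); simp [hj] at this; exact this

theorem JoinsFactors.sumComm {e : Fin n₂ ⊕ Fin n₁ ≃ Bool ⊕ Fin n} (he : JoinsFactors e) :
    JoinsFactors (((Equiv.sumComm (Fin n₁) (Fin n₂)).trans e).trans (flipEdge _)) := by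
  obtain ⟨⟨i, hi⟩, j, hj⟩ := he
  exact ⟨⟨j, by simp [flipEdge, hj]⟩, i, by simp [flipEdge, hi]⟩

/-- The hypothesis `H` makes `g₁`, `g₂` and `h` an isomorphism of graphs. It preserves the order of
the vertices and the direction of the edge, so every sign in `comp_iso` is one. -/
theorem glueP_act {e e' : Fin n₁ ⊕ Fin n₂ ≃ Bool ⊕ Fin n}
    {g₁ : Equiv.Perm (Fin n₁)} {g₂ : Equiv.Perm (Fin n₂)} {h : Equiv.Perm (Fin n)}
    (H : (Equiv.sumCongr g₁ g₂).trans e' = e.trans (Equiv.sumCongr (Equiv.refl _) h))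
    (he : JoinsFactors e) {i j : ℤ} {x : P.obj n₁ b₁} {y : P.obj n₂ b₂}
    (hx : x ∈ (P.obj n₁ b₁).gr i) (hy : y ∈ (P.obj n₂ b₂).gr j) :
    glueP P e' b₁ b₂ b (P.act n₁ b₁ g₁ x) (P.act n₂ b₂ g₂ y) =
      P.act n b h (glueP P e b₁ b₂ b x y) := by
  have he' := he.congr H
  by_cases hs : (b₁ + b₂ = b) ∧ 2 < 2 * b₁ + n₁ ∧ 2 < 2 * b₂ + n₂
  swap
  · rw [glueP, dif_neg fun h' => hs ⟨h'.1.2, h'.2⟩, glueP, dif_neg fun h' => hs ⟨h'.1.2, h'.2⟩]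
    simp
  rw [glueP_apply he' hs.1 hs.2.1 hs.2.2, glueP_apply he hs.1 hs.2.1 hs.2.2]
  have H' : ∀ q, e'.symm (Sum.map id h q) = Sum.map g₁ g₂ (e.symm q) := fun q => by
    have := congrArg (fun f => f (e.symm q)) H
    simp only [Equiv.trans_apply, Equiv.apply_symm_apply, Equiv.sumCongr_apply] at this
    rw [Equiv.symm_apply_eq]; exact this.symm
  let φ : (StableGraph.pairGraph e he hs.1 hs.2.1 hs.2.2).Iso
      (StableGraph.pairGraph e' he' hs.1 hs.2.1 hs.2.2) :=
    { vert := Equiv.refl Bool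
      edge := Equiv.refl Unit
      flip := fun _ => false
      leg := h
      flag := bothFlags g₁ g₂
      gen_eq := fun _ => rfl
      glue_leg := fun i => (congrArg (twoVertexFlags n₁ n₂) (H' (Sum.inr i))).trans (twoVertexFlags_map _ _ _)
      glue_edge := fun _ c => by
        rw [Bool.false_xor]
        exact (congrArg (twoVertexFlags n₁ n₂) (H' (Sum.inl c))).trans (twoVertexFlags_map _ _ _) }
  refine (P.comp_iso _ _ φ (fun v : Bool => bif v then j else i) (P.pairLabel x y)
    (P.pairLabel (P.act n₁ b₁ g₁ x) (P.act n₂ b₂ g₂ y))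
    (pairLabel_mem hx hy) (by rintro (_ | _) <;> rfl)).trans ?_
  rw [show koszulSign φ.edge (fun _ => p) = 1 from koszulSign_refl _,
    show koszulSign φ.vert (fun v : Bool => bif v then j else i) = 1 from koszulSign_refl _]
  simp [φ]

/-- The isomorphism exchanges the vertices, which gives the Koszul sign of the labels, and reverses
the only edge, which gives `η`. -/
theorem glueP_sumComm {e : Fin n₂ ⊕ Fin n₁ ≃ Bool ⊕ Fin n} (he : JoinsFactors e)
    {i j : ℤ} {x : P.obj n₁ b₁} {y : P.obj n₂ b₂}
    (hx : x ∈ (P.obj n₁ b₁).gr i) (hy : y ∈ (P.obj n₂ b₂).gr j) :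
    glueP P (((Equiv.sumComm (Fin n₁) (Fin n₂)).trans e).trans (flipEdge _)) b₁ b₂ b x y =
      (η * (i * j).negOnePow) • glueP P e b₂ b₁ b y x := by
  have he' := he.sumComm
  by_cases hs : (b₁ + b₂ = b) ∧ 2 < 2 * b₁ + n₁ ∧ 2 < 2 * b₂ + n₂
  swap
  · rw [glueP, dif_neg fun h' => hs ⟨h'.1.2, h'.2⟩, glueP,
      dif_neg fun h' => hs ⟨(add_comm _ _).trans h'.1.2, h'.2.2, h'.2.1⟩]
    simp
  have hs' : b₂ + b₁ = b := (add_comm _ _).trans hs.1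
  rw [glueP_apply he' hs.1 hs.2.1 hs.2.2, glueP_apply he hs' hs.2.2 hs.2.1]
  let φ : (StableGraph.pairGraph e he hs' hs.2.2 hs.2.1).Iso
      (StableGraph.pairGraph _ he' hs.1 hs.2.1 hs.2.2) :=
    { vert := Equiv.boolNot
      edge := Equiv.refl Unit
      flip := fun _ => true
      leg := Equiv.refl _
      flag := exchangeFlags n₂ n₁
      gen_eq := fun v => by cases v <;> rfl
      glue_leg := fun i => twoVertexFlags_swap (e.symm (Sum.inr i))
      glue_edge := fun _ c => by
        refine Eq.trans ?_ (twoVertexFlags_swap (e.symm (Sum.inl c)))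
        rw [Bool.true_xor]
        change twoVertexFlags n₁ n₂ ((Equiv.sumComm _ _) (e.symm (Sum.inl (!!c)))) = _
        rw [Bool.not_not] }
  refine (P.comp_iso _ _ φ (fun v : Bool => bif v then i else j) (P.pairLabel y x)
    (P.pairLabel x y) (pairLabel_mem hy hx) (by
      rintro (_ | _)
      exacts [(P.transport_refl y).symm, (P.transport_refl x).symm])).trans ?_
  rw [show koszulSign φ.edge (fun _ => p) = 1 from koszulSign_refl _,
    show koszulSign φ.vert (fun v : Bool => bif v then i else j) = _ from koszulSign_boolNot _]
  have : P.act n b φ.leg = 1 := map_one _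
  rw [this]
  refine congrArg₂ (· • ·) ?_ rfl
  rw [one_mul]
  refine congrArg₂ (· * ·) ?_ (congrArg Int.negOnePow (mul_comm _ _))
  exact (Fintype.prod_unique (ι := Unit) _).trans rfl

theorem selfGlueP_act {e e' : Fin m ≃ Bool ⊕ Fin n}
    {g : Equiv.Perm (Fin m)} {h : Equiv.Perm (Fin n)}
    (H : g.trans e' = e.trans (Equiv.sumCongr (Equiv.refl _) h)) {i : ℤ} {x : P.obj m b}
    (hx : x ∈ (P.obj m b).gr i) :
    selfGlueP P e' b b' (P.act m b g x) = P.act n b' h (selfGlueP P e b b' x) := by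
  by_cases hs : b + 1 = b' ∧ 2 < 2 * b + m
  swap
  · rw [selfGlueP, dif_neg hs, selfGlueP, dif_neg hs]; simp
  rw [selfGlueP_apply _ hs.1 hs.2, selfGlueP_apply _ hs.1 hs.2]
  have H' : ∀ q, e'.symm (Sum.map id h q) = g (e.symm q) := fun q => by
    have := congrArg (fun f => f (e.symm q)) H
    simp only [Equiv.trans_apply, Equiv.apply_symm_apply, Equiv.sumCongr_apply] at this
    rw [Equiv.symm_apply_eq]; exact this.symm
  let φ : (StableGraph.loopGraph e hs.1 hs.2).Iso (StableGraph.loopGraph e' hs.1 hs.2) :=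
    { vert := Equiv.refl Unit
      edge := Equiv.refl Unit
      flip := fun _ => false
      leg := h
      flag := fun _ => g
      gen_eq := fun _ => rfl
      glue_leg := fun i => congrArg (Sigma.mk ()) (H' (Sum.inr i))
      glue_edge := fun _ c => by
        rw [Bool.false_xor]
        exact congrArg (Sigma.mk ()) (H' (Sum.inl c)) }
  refine (P.comp_iso _ _ φ (fun _ => i) (fun _ => x) (fun _ => P.act m b g x) (fun _ => hx)
    (fun _ => rfl)).trans ?_
  rw [show koszulSign φ.edge (fun _ => p) = 1 from koszulSign_refl _,
    show koszulSign φ.vert (fun _ => i) = 1 from koszulSign_refl _]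
  simp [φ]

theorem selfGlueP_flipEdge (e : Fin m ≃ Bool ⊕ Fin n) {i : ℤ} {x : P.obj m b}
    (hx : x ∈ (P.obj m b).gr i) :
    selfGlueP P (e.trans (flipEdge _)) b b' x = η • selfGlueP P e b b' x := by
  by_cases hs : b + 1 = b' ∧ 2 < 2 * b + m
  swap
  · rw [selfGlueP, dif_neg hs, selfGlueP, dif_neg hs]; simp
  rw [selfGlueP_apply _ hs.1 hs.2, selfGlueP_apply _ hs.1 hs.2]
  let φ : (StableGraph.loopGraph e hs.1 hs.2).Iso
      (StableGraph.loopGraph (e.trans (flipEdge _)) hs.1 hs.2) :=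
    { vert := Equiv.refl Unit
      edge := Equiv.refl Unit
      flip := fun _ => true
      leg := Equiv.refl _
      flag := fun _ => Equiv.refl _
      gen_eq := fun _ => rfl
      glue_leg := fun i => rfl
      glue_edge := fun _ c => by
        rw [Bool.true_xor]
        change Sigma.mk (β := fun _ : Unit => Fin m) () (e.symm (Sum.inl (!!c))) = _
        rw [Bool.not_not]
        rfl }
  refine (P.comp_iso _ _ φ (fun _ => i) (fun _ => x) (fun _ => x) (fun _ => hx)
    (fun _ => (P.transport_refl x).symm)).trans ?_
  rw [show koszulSign φ.edge (fun _ => p) = 1 from koszulSign_refl _,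
    show koszulSign φ.vert (fun _ => i) = 1 from koszulSign_refl _]
  have : P.act n b' φ.leg = 1 := map_one _
  rw [this]
  refine congrArg₂ (· • ·) ?_ rfl
  rw [one_mul, mul_one]
  exact (Fintype.prod_unique (ι := Unit) _).trans rfl

end Equivariance

/-! ## Compositions along graphs with two edges -/

/-- The Koszul sign of a bijection of three ordered factors which exchanges the last two. -/
theorem koszulSign_swap_last {ι κ : Type} [Fintype ι] [LinearOrder ι] [LinearOrder κ] (e : ι ≃ κ)
    (deg : ι → ℤ) {a b c : ι} (hab : a < b) (hbc : b < c) (hu : ∀ q, q = a ∨ q = b ∨ q = c)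
    (h₁ : e a < e c) (h₂ : e c < e b) : koszulSign e deg = (deg b * deg c).negOnePow := by
  refine (Finset.prod_eq_single (b, c) ?_ fun h => absurd (Finset.mem_univ _) h).trans
    (if_pos ⟨hbc, h₂⟩)
  rintro ⟨q, q'⟩ - hq
  refine if_neg fun h => ?_
  have hac := hab.trans hbc
  have h₃ := h₁.trans h₂
  obtain ⟨h, h'⟩ := h
  simp only at h h'
  obtain rfl | rfl | rfl := hu q <;> obtain rfl | rfl | rfl := hu q'
  · exact lt_irrefl _ h
  · exact lt_asymm h₃ h'
  · exact lt_asymm h₁ h'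
  · exact lt_asymm h hab
  · exact lt_irrefl _ h
  · exact hq rfl
  · exact lt_asymm h hac
  · exact lt_asymm h hbc
  · exact lt_irrefl _ h

theorem sum_lt_of_isMin {α : Type} [Fintype α] [LinearOrder α] (a : α) (ha : ∀ u, ¬ u < a)
    (f : α → ℤ) : ∑ u with u < a, f u = 0 :=
  Finset.sum_eq_zero fun u hu => absurd (Finset.mem_filter.1 hu).2 (ha u)

namespace StableGraph

section SubstGlue

variable {n b : ℕ} (H : StableGraph n b) (Gs : ∀ v : H.Vert, StableGraph (H.val v) (H.gen v))

/-- A flag of one of the graphs which are substituted into `H`, as a flag of the composite. -/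
def substFlag (v : H.Vert) (q : Σ u : (Gs v).Vert, Fin ((Gs v).val u)) :
    Σ x : (H.subst Gs).Vert, Fin ((H.subst Gs).val x) :=
  ⟨toLex ⟨v, q.1⟩, q.2⟩

end SubstGlue

/-- A description of a graph with two edges, the first of which is glued last. -/
structure TwoEdges {n b : ℕ} (G : StableGraph n b) {D : Type}
    (F : D ≃ Bool ⊕ (Bool ⊕ Fin n)) where
  place : D → Σ v, Fin (G.val v)
  edge : Bool ≃ G.Edge
  edge_lt : edge false < edge true
  glue_leg : ∀ i, G.glue (Sum.inl i) = place (F.symm (Sum.inr (Sum.inr i)))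
  glue_outer : ∀ c, G.glue (Sum.inr (edge false, c)) = place (F.symm (Sum.inr (Sum.inl c)))
  glue_inner : ∀ c, G.glue (Sum.inr (edge true, c)) = place (F.symm (Sum.inl c))

end StableGraph

section TwoEdges

variable {k : Type u} [Field k] {p : ℤ} {η : ℤˣ} {P : TwistedModularOperad.{u, w} k p η}

open StableGraph

/-- The data form an isomorphism of graphs which keeps the directions but exchanges the two edges.
Their lines have degree `p`, so the generator of the cocycle changes by `(-1) ^ (p * p) = (-1) ^ p`.
The rest of the sign comes from reordering the labels. -/
theorem comp_swapEdges {n b : ℕ} {G G' : StableGraph n b} {D D' : Type}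
    {F : D ≃ Bool ⊕ (Bool ⊕ Fin n)} {F' : D' ≃ Bool ⊕ (Bool ⊕ Fin n)} (T : G.TwoEdges F)
    (T' : G'.TwoEdges F') (s : D ≃ D') (hF : s.trans F' = F.trans (swapEdges _))
    (vert : G.Vert ≃ G'.Vert) (flag : ∀ v, Fin (G.val v) ≃ Fin (G'.val (vert v)))
    (gen_eq : ∀ v, G.gen v = G'.gen (vert v))
    (place_eq : ∀ d, T'.place (s d) = ⟨vert (T.place d).1, flag _ (T.place d).2⟩)
    (i : G.Vert → ℤ) (x : ∀ v, P.obj (G.val v) (G.gen v)) (x' : ∀ v, P.obj (G'.val v) (G'.gen v))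
    (hx : ∀ v, x v ∈ (P.obj _ _).gr (i v))
    (hx' : ∀ v, x' (vert v) = P.transport (flag v) (gen_eq v) (x v)) :
    P.comp G' x' = (p.negOnePow * koszulSign vert i) • P.comp G x := by
  have hF' : ∀ q, F'.symm q = s (F.symm ((swapEdges _).symm q)) := fun q => by
    rw [Equiv.symm_apply_eq]
    have := congrArg (fun f => f (F.symm ((swapEdges _).symm q))) hF
    simp only [Equiv.trans_apply, Equiv.apply_symm_apply] at this
    exact this.symm
  let φ : G.Iso G' :=
    { vert := vert
      edge := (T.edge.symm.trans Equiv.boolNot).trans T'.edge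
      flip := fun _ => false
      leg := Equiv.refl _
      flag := flag
      gen_eq := gen_eq
      glue_leg := fun q => by
        rw [T.glue_leg, ← place_eq]
        refine (T'.glue_leg q).trans ?_
        rw [hF']; rfl
      glue_edge := fun e c => by
        obtain ⟨e, rfl⟩ := T.edge.surjective e
        rw [Bool.false_xor]
        simp only [Equiv.trans_apply, Equiv.symm_apply_apply]
        cases e
        · rw [T.glue_outer, ← place_eq]
          refine (T'.glue_inner c).trans ?_
          rw [hF']; rfl
        · rw [T.glue_inner, ← place_eq]
          refine (T'.glue_outer c).trans ?_
          rw [hF']; rfl }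
  rw [P.comp_iso _ _ φ i x x' hx hx']
  have hleg : P.act n b φ.leg = 1 := map_one _
  have hedge : koszulSign φ.edge (fun _ => p) = p.negOnePow := by
    refine (Finset.prod_eq_single (T.edge false, T.edge true) ?_
      fun h => absurd (Finset.mem_univ _) h).trans ((if_pos ⟨T.edge_lt, by simpa [φ] using T'.edge_lt⟩).trans ?_)
    · rintro ⟨q, q'⟩ - hq
      obtain ⟨q, rfl⟩ := T.edge.surjective q
      obtain ⟨q', rfl⟩ := T.edge.surjective q'
      refine if_neg fun h => ?_
      have h := h.1
      simp only at h
      cases q <;> cases q'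
      · exact lt_irrefl _ h
      · exact hq rfl
      · exact lt_asymm h T.edge_lt
      · exact lt_irrefl _ h
    · exact Int.negOnePow_eq_of_zmod (by
        push_cast; generalize (p : ZMod 2) = q; revert q; decide)
  have hflip : (∏ e, if φ.flip e then η else 1) = 1 := Finset.prod_eq_one fun _ _ => rfl
  rw [hleg, hedge, hflip, mul_one]
  rfl

variable {n₁ n₂ n₃ m m' n b₁ b₂ b₃ c c' b : ℕ}

theorem stable_of_joinEquiv {e : Fin n₁ ⊕ Fin n₂ ≃ Bool ⊕ Fin n} (h₁ : 2 < 2 * b₁ + n₁)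
    (h₂ : 2 < 2 * b₂ + n₂) (hb : b₁ + b₂ = b) : 2 < 2 * b + n := by
  have := card_of_joinEquiv e
  omega

theorem stable_of_loopEquiv {e : Fin m ≃ Bool ⊕ Fin n} (h : 2 < 2 * b + m) (hb : b + 1 = c) :
    2 < 2 * c + n := by
  have := card_of_loopEquiv e
  omega

section

variable {f' : Fin m ≃ Bool ⊕ Fin m'} {f : Fin m' ≃ Bool ⊕ Fin n} (hb : b + 1 = c)
  (hc : c + 1 = c') (h : 2 < 2 * b + m) (h' : 2 < 2 * c + m')

/-- Two loops at one vertex. -/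
def loopLoopEdges : ((loopGraph f hc h').subst fun _ => loopGraph f' hb h).TwoEdges
    (thenLoopFlags f' f) where
  place d := substFlag (loopGraph f hc h') (fun _ => loopGraph f' hb h) () ⟨(), d⟩
  edge :=
    { toFun := fun q => match q with
        | false => toLex (Sum.inl ())
        | true => toLex (Sum.inr (toLex ⟨(), ()⟩))
      invFun := fun q => match ofLex q with
        | Sum.inl _ => false
        | Sum.inr _ => true
      left_inv := by rintro (_ | _) <;> rfl
      right_inv := by rintro (_ | ⟨_, _⟩) <;> rfl }
  edge_lt := Sum.Lex.inl_lt_inr _ _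
  glue_leg _ := rfl
  glue_outer _ := rfl
  glue_inner _ := rfl

end

section

variable {e : Fin n₁ ⊕ Fin n₂ ≃ Bool ⊕ Fin m} (he : JoinsFactors e) {f : Fin m ≃ Bool ⊕ Fin n}
  (hb : b₁ + b₂ = c) (hc : c + 1 = c') (h₁ : 2 < 2 * b₁ + n₁) (h₂ : 2 < 2 * b₂ + n₂)
  (h : 2 < 2 * c + m)

/-- Two edges between two vertices, or an edge and a loop. -/
def pairLoopEdges : ((loopGraph f hc h).subst fun _ => pairGraph e he hb h₁ h₂).TwoEdges
    (thenLoopFlags e f) where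
  place d := substFlag (loopGraph f hc h) (fun _ => pairGraph e he hb h₁ h₂) ()
    (twoVertexFlags n₁ n₂ d)
  edge :=
    { toFun := fun q => match q with
        | false => toLex (Sum.inl ())
        | true => toLex (Sum.inr (toLex ⟨(), ()⟩))
      invFun := fun q => match ofLex q with
        | Sum.inl _ => false
        | Sum.inr _ => true
      left_inv := by rintro (_ | _) <;> rfl
      right_inv := by rintro (_ | ⟨_, _⟩) <;> rfl }
  edge_lt := Sum.Lex.inl_lt_inr _ _
  glue_leg _ := rfl
  glue_outer _ := rfl
  glue_inner _ := rfl

end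

section

variable {f : Fin m ⊕ Fin n₃ ≃ Bool ⊕ Fin n} (hf : JoinsFactors f) (hc : c + b₃ = b)
  (h : 2 < 2 * c + m) (h₃ : 2 < 2 * b₃ + n₃) (G : StableGraph m c)

/-- The substitution of a graph into the first vertex of a graph with two vertices. -/
def substFirst : ∀ v : (pairGraph f hf hc h h₃).Vert,
    StableGraph ((pairGraph f hf hc h h₃).val v) ((pairGraph f hf hc h h₃).gen v)
  | false => G
  | true => corolla n₃ b₃ h₃

/-- A graph, one leg of which is joined by an edge to another vertex. -/
abbrev graftGraph : StableGraph n b := (pairGraph f hf hc h h₃).subst (substFirst hf hc h h₃ G)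

/-- The flags of the composite which are not on the inner edges. -/
def graftPlace : Fin m ⊕ Fin n₃ →
    Σ v : (graftGraph hf hc h h₃ G).Vert, Fin ((graftGraph hf hc h h₃ G).val v)
  | Sum.inl d => substFlag (pairGraph f hf hc h h₃) (substFirst hf hc h h₃ G) false
      (G.glue (Sum.inl d))
  | Sum.inr d => substFlag (pairGraph f hf hc h h₃) (substFirst hf hc h h₃ G) true ⟨(), d⟩

theorem graftPlace_eq (r : Fin m ⊕ Fin n₃) :
    substFlag (pairGraph f hf hc h h₃) (substFirst hf hc h h₃ G) (twoVertexFlags m n₃ r).1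
      ((substFirst hf hc h h₃ G _).glue (Sum.inl (twoVertexFlags m n₃ r).2)) =
    graftPlace hf hc h h₃ G r := by
  cases r <;> rfl

theorem graftGraph_glue_leg (i : Fin n) : (graftGraph hf hc h h₃ G).glue (Sum.inl i) =
    graftPlace hf hc h h₃ G (f.symm (Sum.inr i)) :=
  graftPlace_eq hf hc h h₃ G (f.symm (Sum.inr i))

theorem graftGraph_glue_outer (q : Bool) :
    (graftGraph hf hc h h₃ G).glue (Sum.inr (toLex (Sum.inl ()), q)) =
      graftPlace hf hc h h₃ G (f.symm (Sum.inl q)) :=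
  graftPlace_eq hf hc h h₃ G (f.symm (Sum.inl q))

/-- The label of the composite. -/
def graftLabel (x : ∀ v, P.obj (G.val v) (G.gen v)) (y : P.obj n₃ b₃) :
    ∀ (v : (pairGraph f hf hc h h₃).Vert) (a : (substFirst hf hc h h₃ G v).Vert),
      P.obj ((substFirst hf hc h h₃ G v).val a) ((substFirst hf hc h h₃ G v).gen a)
  | false => x
  | true => fun _ => y

/-- The degrees of the labels of the composite. -/
def graftDeg (i : G.Vert → ℤ) (j : ℤ) :
    ∀ (v : (pairGraph f hf hc h h₃).Vert), (substFirst hf hc h h₃ G v).Vert → ℤ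
  | false => i
  | true => fun _ => j

theorem graftLabel_mem {x : ∀ v, P.obj (G.val v) (G.gen v)} {y : P.obj n₃ b₃} {i : G.Vert → ℤ}
    {j : ℤ} (hx : ∀ v, x v ∈ (P.obj _ _).gr (i v)) (hy : y ∈ (P.obj n₃ b₃).gr j) :
    ∀ v a, graftLabel hf hc h h₃ G x y v a ∈ (P.obj _ _).gr (graftDeg hf hc h h₃ G i j v a)
  | false => hx
  | true => fun _ => hy

/-- This is associativity with a corolla substituted into the second vertex. The sign of
`comp_assoc` is trivial: the graph at the first vertex has no labels in front of it, and the corolla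
has no edges. -/
theorem glueP_comp {x : ∀ v, P.obj (G.val v) (G.gen v)} {y : P.obj n₃ b₃} {i : G.Vert → ℤ}
    {j : ℤ} (hx : ∀ v, x v ∈ (P.obj _ _).gr (i v)) (hy : y ∈ (P.obj n₃ b₃).gr j) :
    glueP P f c b₃ b (P.comp G x) y = P.comp (graftGraph hf hc h h₃ G)
      (fun q => graftLabel hf hc h h₃ G x y (ofLex q).1 (ofLex q).2) := by
  rw [glueP_apply hf hc h h₃]
  refine Eq.trans ?_ (P.comp_assoc (pairGraph f hf hc h h₃) (substFirst hf hc h h₃ G) _ _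
    (graftLabel_mem hf hc h h₃ G hx hy)).symm
  refine (intUnits_one_smul _).symm.trans (congrArg₂ (· • ·) ?_ ?_)
  · refine (Int.negOnePow_zero).symm.trans (congrArg Int.negOnePow (Eq.symm ?_))
    refine (Fintype.sum_bool _).trans ?_
    refine (congrArg₂ (· + ·) ?_ ?_).trans (add_zero 0)
    · refine mul_eq_zero_of_left ?_ _
      change p * ((Fintype.card Empty : ℕ) : ℤ) = 0
      simp
    · refine mul_eq_zero_of_right _ (sum_lt_of_isMin (α := Bool) false (by decide) _)
  · refine congrArg _ (funext fun v => ?_)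
    cases v
    · rfl
    · exact (P.comp_corolla n₃ b₃ h₃ y).symm

theorem selfGlueP_comp {f : Fin m ≃ Bool ⊕ Fin n} (hc : c + 1 = b) (h : 2 < 2 * c + m)
    {x : ∀ v, P.obj (G.val v) (G.gen v)} {i : G.Vert → ℤ}
    (hx : ∀ v, x v ∈ (P.obj _ _).gr (i v)) :
    selfGlueP P f c b (P.comp G x) = P.comp ((loopGraph f hc h).subst fun _ => G)
      (fun q => x (ofLex q).2) := by
  rw [selfGlueP_apply f hc h]
  refine Eq.trans ?_ (P.comp_assoc (loopGraph f hc h) (fun _ => G) (fun _ => i) (fun _ => x)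
    fun _ => hx).symm
  refine (intUnits_one_smul _).symm.trans (congrArg₂ (· • ·) ?_ rfl)
  refine (Int.negOnePow_zero).symm.trans (congrArg Int.negOnePow (Eq.symm ?_))
  refine Finset.sum_eq_zero fun v _ => mul_eq_zero_of_right _ 
    (sum_lt_of_isMin (α := Unit) () (by decide) _)

end

section

variable {f' : Fin n₁ ≃ Bool ⊕ Fin m} {f : Fin m ⊕ Fin n₂ ≃ Bool ⊕ Fin n} (hf : JoinsFactors f)
  (hb : b₁ + 1 = c) (hc : c + b₂ = c') (h₁ : 2 < 2 * b₁ + n₁) (h₂ : 2 < 2 * b₂ + n₂)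
  (h : 2 < 2 * c + m)

/-- A loop at the first of two vertices, which are joined by an edge. -/
def loopPairEdges : (graftGraph hf hc h h₂ (loopGraph f' hb h₁)).TwoEdges
    (loopThenFlags f' f) where
  place := Sum.elim
    (fun d => substFlag (pairGraph f hf hc h h₂) (substFirst hf hc h h₂ (loopGraph f' hb h₁))
      false ⟨(), d⟩)
    (fun d => substFlag (pairGraph f hf hc h h₂) (substFirst hf hc h h₂ (loopGraph f' hb h₁))
      true ⟨(), d⟩)
  edge :=
    { toFun := fun q => match q with
        | false => toLex (Sum.inl ())
        | true => toLex (Sum.inr (toLex ⟨false, ()⟩))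
      invFun := fun q => match ofLex q with
        | Sum.inl _ => false
        | Sum.inr _ => true
      left_inv := by rintro (_ | _) <;> rfl
      right_inv := by rintro (_ | ⟨_ | _, q⟩); exacts [rfl, rfl, q.elim] }
  edge_lt := Sum.Lex.inl_lt_inr _ _
  glue_leg i := by
    refine (graftGraph_glue_leg hf hc h h₂ _ i).trans ?_
    simp only [loopThenFlags, Equiv.symm_trans_apply, Equiv.sumCongr_symm, Equiv.sumCongr_apply,
      Sum.map_inr]
    cases f.symm (Sum.inr i) <;> rfl
  glue_outer q := by
    refine (graftGraph_glue_outer hf hc h h₂ _ q).trans ?_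
    simp only [loopThenFlags, Equiv.symm_trans_apply, Equiv.sumCongr_symm, Equiv.sumCongr_apply,
      Sum.map_inr]
    cases f.symm (Sum.inl q) <;> rfl
  glue_inner _ := rfl

end

section

variable {f' : Fin n₁ ⊕ Fin n₂ ≃ Bool ⊕ Fin m} (hf' : JoinsFactors f')
  {f : Fin m ⊕ Fin n₃ ≃ Bool ⊕ Fin n} (hf : JoinsFactors f)
  (hb : b₁ + b₂ = c) (hc : c + b₃ = c') (h₁ : 2 < 2 * b₁ + n₁) (h₂ : 2 < 2 * b₂ + n₂)
  (h₃ : 2 < 2 * b₃ + n₃) (h : 2 < 2 * c + m)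

/-- A tree with three vertices. -/
def pairPairEdges : (graftGraph hf hc h h₃ (pairGraph f' hf' hb h₁ h₂)).TwoEdges
    (nestFlags f' f) where
  place := Sum.elim
    (fun d => substFlag (pairGraph f hf hc h h₃) (substFirst hf hc h h₃ (pairGraph f' hf' hb h₁ h₂))
      false (twoVertexFlags n₁ n₂ d))
    (fun d => substFlag (pairGraph f hf hc h h₃) (substFirst hf hc h h₃ (pairGraph f' hf' hb h₁ h₂))
      true ⟨(), d⟩)
  edge :=
    { toFun := fun q => match q with
        | false => toLex (Sum.inl ())
        | true => toLex (Sum.inr (toLex ⟨false, ()⟩))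
      invFun := fun q => match ofLex q with
        | Sum.inl _ => false
        | Sum.inr _ => true
      left_inv := by rintro (_ | _) <;> rfl
      right_inv := by rintro (_ | ⟨_ | _, q⟩); exacts [rfl, rfl, q.elim] }
  edge_lt := Sum.Lex.inl_lt_inr _ _
  glue_leg i := by
    refine (graftGraph_glue_leg hf hc h h₃ _ i).trans ?_
    simp only [nestFlags, Equiv.symm_trans_apply, Equiv.sumCongr_symm, Equiv.sumCongr_apply,
      Sum.map_inr]
    cases f.symm (Sum.inr i) <;> rfl
  glue_outer q := by
    refine (graftGraph_glue_outer hf hc h h₃ _ q).trans ?_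
    simp only [nestFlags, Equiv.symm_trans_apply, Equiv.sumCongr_symm, Equiv.sumCongr_apply,
      Sum.map_inr]
    cases f.symm (Sum.inl q) <;> rfl
  glue_inner _ := rfl

end

end TwoEdges

/-! ## The relations between compositions along graphs with two edges -/

section TwoEdgeRelations

variable {k : Type u} [Field k] {p : ℤ} {η : ℤˣ} {P : TwistedModularOperad.{u, w} k p η}
  {n₁ n₂ n₃ m m' n b₁ b₂ b₃ c d b : ℕ}

open StableGraph

/-- By associativity each side is a composition along a single graph with two edges, and the two
graphs differ by the exchange of the edges. The next three lemmas follow the same pattern; unstable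
labels are zero and make both sides vanish. -/
theorem selfGlueP_selfGlueP {e : Fin n₁ ≃ Bool ⊕ Fin m} {e' : Fin m ≃ Bool ⊕ Fin n}
    {f : Fin n₁ ≃ Bool ⊕ Fin m'} {f' : Fin m' ≃ Bool ⊕ Fin n}
    (H : thenLoopFlags f f' = (thenLoopFlags e e').trans (swapEdges (Fin n)))
    (hb : b₁ + 1 = c) (hc : c + 1 = b) {i : ℤ} {x : P.obj n₁ b₁} (hx : x ∈ (P.obj n₁ b₁).gr i) :
    selfGlueP P f' c b (selfGlueP P f b₁ c x) =
      p.negOnePow • selfGlueP P e' c b (selfGlueP P e b₁ c x) := by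
  by_cases h : 2 < 2 * b₁ + n₁
  swap
  · rw [eq_zero_of_unstable h x]; simp
  have h₁ := stable_of_loopEquiv (e := e) h hb
  have h₂ := stable_of_loopEquiv (e := f) h hb
  rw [selfGlueP_apply e hb h, selfGlueP_apply f hb h]
  rw [selfGlueP_comp (loopGraph e hb h) hc h₁ (i := fun _ => i) fun _ => hx,
    selfGlueP_comp (loopGraph f hb h) hc h₂ (i := fun _ => i) fun _ => hx]
  refine (comp_swapEdges (loopLoopEdges hb hc h h₁) (loopLoopEdges hb hc h h₂) (Equiv.refl _)
    H.symm.symm (Equiv.refl _) (fun _ => Equiv.refl _) (fun _ => rfl) (fun _ => rfl)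
    (fun _ => i) _ _ (fun _ => hx) (fun _ => (P.transport_refl x).symm)).trans ?_
  exact congrArg₂ (· • ·) ((congrArg _ (koszulSign_refl _)).trans (mul_one _)) rfl

theorem selfGlueP_glueP {e : Fin n₁ ⊕ Fin n₂ ≃ Bool ⊕ Fin m} {e' : Fin m ≃ Bool ⊕ Fin n}
    {f : Fin n₁ ⊕ Fin n₂ ≃ Bool ⊕ Fin m'} {f' : Fin m' ≃ Bool ⊕ Fin n}
    (H : thenLoopFlags f f' = (thenLoopFlags e e').trans (swapEdges (Fin n)))
    (he : JoinsFactors e) (hf : JoinsFactors f)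
    (hb : b₁ + b₂ = c) (hc : c + 1 = b) {i j : ℤ} {x : P.obj n₁ b₁} {y : P.obj n₂ b₂}
    (hx : x ∈ (P.obj n₁ b₁).gr i) (hy : y ∈ (P.obj n₂ b₂).gr j) :
    selfGlueP P f' c b (glueP P f b₁ b₂ c x y) =
      p.negOnePow • selfGlueP P e' c b (glueP P e b₁ b₂ c x y) := by
  by_cases h₁ : 2 < 2 * b₁ + n₁
  swap
  · rw [eq_zero_of_unstable h₁ x]; simp
  by_cases h₂ : 2 < 2 * b₂ + n₂
  swap
  · rw [eq_zero_of_unstable h₂ y]; simp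
  have h := stable_of_joinEquiv (e := e) h₁ h₂ hb
  have h' := stable_of_joinEquiv (e := f) h₁ h₂ hb
  rw [glueP_apply he hb h₁ h₂, glueP_apply hf hb h₁ h₂]
  have hm := pairLabel_mem hx hy
  rw [selfGlueP_comp (pairGraph e he hb h₁ h₂) hc h (i := fun v : Bool => bif v then j else i) hm,
    selfGlueP_comp (pairGraph f hf hb h₁ h₂) hc h' (i := fun v : Bool => bif v then j else i) hm]
  refine (comp_swapEdges (pairLoopEdges he hb hc h₁ h₂ h) (pairLoopEdges hf hb hc h₁ h₂ h')
    (Equiv.refl _) H.symm.symm (Equiv.refl _) (fun _ => Equiv.refl _) (fun _ => rfl) (fun _ => rfl)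
    (fun q => bif (ofLex q).2 then j else i) _ _ (fun q => hm (ofLex q).2)
    (fun q => (P.transport_refl _).symm)).trans ?_
  exact congrArg₂ (· • ·) ((congrArg _ (koszulSign_refl _)).trans (mul_one _)) rfl

theorem glueP_selfGlueP {e : Fin n₁ ⊕ Fin n₂ ≃ Bool ⊕ Fin m} {e' : Fin m ≃ Bool ⊕ Fin n}
    {f' : Fin n₁ ≃ Bool ⊕ Fin m'} {f : Fin m' ⊕ Fin n₂ ≃ Bool ⊕ Fin n}
    (H : loopThenFlags f' f = (thenLoopFlags e e').trans (swapEdges (Fin n)))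
    (he : JoinsFactors e) (hf : JoinsFactors f)
    (hb : b₁ + b₂ = c) (hc : c + 1 = b) (hd : b₁ + 1 = d) {i j : ℤ} {x : P.obj n₁ b₁}
    {y : P.obj n₂ b₂} (hx : x ∈ (P.obj n₁ b₁).gr i) (hy : y ∈ (P.obj n₂ b₂).gr j) :
    glueP P f d b₂ b (selfGlueP P f' b₁ d x) y =
      p.negOnePow • selfGlueP P e' c b (glueP P e b₁ b₂ c x y) := by
  by_cases h₁ : 2 < 2 * b₁ + n₁
  swap
  · rw [eq_zero_of_unstable h₁ x]; simp
  by_cases h₂ : 2 < 2 * b₂ + n₂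
  swap
  · rw [eq_zero_of_unstable h₂ y]; simp
  have h := stable_of_joinEquiv (e := e) h₁ h₂ hb
  have h' := stable_of_loopEquiv (e := f') h₁ hd
  have hdb : d + b₂ = b := by omega
  rw [glueP_apply he hb h₁ h₂, selfGlueP_apply f' hd h₁]
  have hm := pairLabel_mem hx hy
  rw [selfGlueP_comp (pairGraph e he hb h₁ h₂) hc h (i := fun v : Bool => bif v then j else i) hm,
    glueP_comp hf hdb h' h₂ (loopGraph f' hd h₁) (i := fun _ => i) (fun _ => hx) hy]
  -- In one graph the vertices come from the graph substituted into the single vertex of a loop, in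
  -- the other they are the two vertices joined by the outer edge. The bijection preserves their
  -- order, so the labels contribute no sign.
  let vert : ((loopGraph e' hc h).subst fun _ => pairGraph e he hb h₁ h₂).Vert ≃
      (graftGraph hf hdb h' h₂ (loopGraph f' hd h₁)).Vert :=
    { toFun := fun q => match ofLex q with
        | ⟨_, false⟩ => toLex ⟨false, ()⟩
        | ⟨_, true⟩ => toLex ⟨true, ()⟩
      invFun := fun q => toLex ⟨(), (ofLex q).1⟩
      left_inv := by rintro ⟨_, _ | _⟩ <;> rfl
      right_inv := by rintro ⟨_ | _, _⟩ <;> rfl }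
  refine (comp_swapEdges (pairLoopEdges he hb hc h₁ h₂ h) (loopPairEdges hf hd hdb h₁ h₂ h')
    (Equiv.refl _) H vert (fun
        | ⟨_, false⟩ => Equiv.refl (Fin n₁)
        | ⟨_, true⟩ => Equiv.refl (Fin n₂)) (by rintro ⟨_, _ | _⟩ <;> rfl)
    (by rintro (_ | _) <;> rfl) (fun q => bif (ofLex q).2 then j else i) _ _
    (fun q => hm (ofLex q).2)
    (by
      rintro ⟨_, _ | _⟩
      exacts [(P.transport_refl x).symm, (P.transport_refl y).symm])).trans ?_
  refine congrArg₂ (· • ·) ((congrArg _ ?_).trans (mul_one _)) rfl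
  refine koszulSign_eq_one_of_strictMono _ ?_ _
  rintro ⟨_, _ | _⟩ ⟨_, _ | _⟩ hq
  · exact absurd hq (lt_irrefl _)
  · exact Sigma.Lex.left _ _ (by decide : false < true)
  · exact absurd hq (lt_asymm (Sigma.Lex.right _ _ (by decide : false < true)))
  · exact absurd hq (lt_irrefl _)

theorem glueP_glueP {e' : Fin n₁ ⊕ Fin n₂ ≃ Bool ⊕ Fin m} {e : Fin m ⊕ Fin n₃ ≃ Bool ⊕ Fin n}
    {f' : Fin n₁ ⊕ Fin n₃ ≃ Bool ⊕ Fin m'} {f : Fin m' ⊕ Fin n₂ ≃ Bool ⊕ Fin n}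
    (H : (swapLastSum _ _ _).trans (nestFlags f' f) = (nestFlags e' e).trans (swapEdges (Fin n)))
    (he' : JoinsFactors e') (he : JoinsFactors e) (hf' : JoinsFactors f') (hf : JoinsFactors f)
    (hc : b₁ + b₂ = c) (hd : b₁ + b₃ = d) (hb : c + b₃ = b) {i j q : ℤ} {x : P.obj n₁ b₁}
    {y : P.obj n₂ b₂} {z : P.obj n₃ b₃} (hx : x ∈ (P.obj n₁ b₁).gr i)
    (hy : y ∈ (P.obj n₂ b₂).gr j) (hz : z ∈ (P.obj n₃ b₃).gr q) :
    glueP P f d b₂ b (glueP P f' b₁ b₃ d x z) y =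
      (p + j * q).negOnePow • glueP P e c b₃ b (glueP P e' b₁ b₂ c x y) z := by
  by_cases h₁ : 2 < 2 * b₁ + n₁
  swap
  · rw [eq_zero_of_unstable h₁ x]; simp
  by_cases h₂ : 2 < 2 * b₂ + n₂
  swap
  · rw [eq_zero_of_unstable h₂ y]; simp
  by_cases h₃ : 2 < 2 * b₃ + n₃
  swap
  · rw [eq_zero_of_unstable h₃ z]; simp
  have h := stable_of_joinEquiv (e := e') h₁ h₂ hc
  have h' := stable_of_joinEquiv (e := f') h₁ h₃ hd
  have hdb : d + b₂ = b := by omega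
  rw [glueP_apply he' hc h₁ h₂, glueP_apply hf' hd h₁ h₃]
  have hm := pairLabel_mem hx hy
  have hm' := pairLabel_mem hx hz
  rw [glueP_comp he hb h h₃ (pairGraph e' he' hc h₁ h₂) (i := fun v : Bool => bif v then j else i)
    hm hz, glueP_comp hf hdb h' h₂ (pairGraph f' hf' hd h₁ h₃)
      (i := fun v : Bool => bif v then q else i) hm' hy]
  let vert : (graftGraph he hb h h₃ (pairGraph e' he' hc h₁ h₂)).Vert ≃
      (graftGraph hf hdb h' h₂ (pairGraph f' hf' hd h₁ h₃)).Vert :=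
    { toFun := fun r => match ofLex r with
        | ⟨false, false⟩ => toLex ⟨false, false⟩
        | ⟨false, true⟩ => toLex ⟨true, ()⟩
        | ⟨true, _⟩ => toLex ⟨false, true⟩
      invFun := fun r => match ofLex r with
        | ⟨false, false⟩ => toLex ⟨false, false⟩
        | ⟨false, true⟩ => toLex ⟨true, ()⟩
        | ⟨true, _⟩ => toLex ⟨false, true⟩
      left_inv := by rintro ⟨_ | _, _ | _⟩ <;> rfl
      right_inv := by rintro ⟨_ | _, _ | _⟩ <;> rfl }
  refine (comp_swapEdges (pairPairEdges he' he hc hb h₁ h₂ h₃ h)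
    (pairPairEdges hf' hf hd hdb h₁ h₃ h₂ h') (swapLastSum _ _ _) H vert
    (fun
        | ⟨false, false⟩ => Equiv.refl (Fin n₁)
        | ⟨false, true⟩ => Equiv.refl (Fin n₂)
        | ⟨true, _⟩ => Equiv.refl (Fin n₃))
    (by rintro ⟨_ | _, _ | _⟩ <;> rfl) (by rintro ((_ | _) | _) <;> rfl)
    (fun r => graftDeg he hb h h₃ (pairGraph e' he' hc h₁ h₂)
      (fun v : Bool => bif v then j else i) q (ofLex r).1 (ofLex r).2) _ _
    (fun r => graftLabel_mem he hb h h₃ (pairGraph e' he' hc h₁ h₂) hm hz _ _)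
    (by
      rintro ⟨_ | _, _ | _⟩
      exacts [(P.transport_refl x).symm, (P.transport_refl y).symm,
        (P.transport_refl z).symm])).trans ?_
  refine congrArg₂ (· • ·) ?_ rfl
  rw [Int.negOnePow_add]
  refine congrArg _ ?_
  -- These vertices carry `x`, `y`, `z`, in this order. On the other side the order is `x`, `z`,
  -- `y`, which accounts for `(-1) ^ (j * q)`.
  let va : (graftGraph he hb h h₃ (pairGraph e' he' hc h₁ h₂)).Vert := toLex ⟨false, false⟩
  let vb : (graftGraph he hb h h₃ (pairGraph e' he' hc h₁ h₂)).Vert := toLex ⟨false, true⟩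
  let vc : (graftGraph he hb h h₃ (pairGraph e' he' hc h₁ h₂)).Vert := toLex ⟨true, ()⟩
  refine koszulSign_swap_last _ _ (a := va) (b := vb) (c := vc) (Sigma.Lex.right _ _ (by decide : false < true))
    (Sigma.Lex.left _ _ (by decide : false < true)) ?_
    (Sigma.Lex.right _ _ (by decide : false < true)) (Sigma.Lex.left _ _ (by decide : false < true))
  rintro ⟨_ | _, _ | _⟩
  exacts [Or.inl rfl, Or.inr (Or.inl rfl), Or.inr (Or.inr rfl)]

end TwoEdgeRelations

/-! ## Contractions of tensors with values in the operad -/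

theorem neg_eq_negOnePow_smul {M : Type*} [AddCommGroup M] (x : M) :
    -x = (1 : ℤ).negOnePow • x := by
  rw [Int.negOnePow_one, Units.smul_def, Units.val_neg, Units.val_one, neg_smul, one_smul]

namespace TensorProduct

variable {k : Type*} [Field k] {M N L : Type*} [AddCommGroup M] [Module k M] [AddCommGroup N]
  [Module k N] [AddCommGroup L] [Module k L]

theorem map_intUnits_smul (f : M ⊗[k] N →ₗ[k] L) (s : ℤˣ) (x : M ⊗[k] N) :
    f (s • x) = s • f x :=
  LinearMap.map_intUnits_smul f s x

/-- The signs in `termSwap` act through the integer action on a left tensor factor, which has to be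
identified with multiplication by a scalar of `k`. -/
theorem left_int_smul {M N : Type*} [AddCommMonoid M] [AddCommMonoid N] [Module k M]
    [Module k N] [DistribMulAction ℤ M] [SMulCommClass k ℤ M]
    (h : ∀ (n : ℤ) (x : M), n • x = (n : k) • x) (n : ℤ) (w : M ⊗[k] N) :
    (TensorProduct.leftHasSMul.smul n w : M ⊗[k] N) = (n : k) • w := by
  induction w using TensorProduct.induction_on with
  | zero => exact (smul_zero n).trans (smul_zero _).symm
  | tmul x y => exact (TensorProduct.smul_tmul' n x y).trans (by rw [h]; rfl)
  | add x y hx hy =>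
    rw [smul_add, ← hx, ← hy]
    exact smul_add n x y

end TensorProduct

section Terms

variable {k : Type u} [Field k] {l : ℤ} {η : ℤˣ} {V : ChainCx.{u, v} k}
  {B : InnerProd V l η} {P : TwistedModularOperad.{u, w} k (l - 1) η}
  {n₁ n₂ n₃ m m' n b₁ b₂ b₃ c d b b' : ℕ} {i j q : ℤ}

section Homogeneous

variable {M : Type*} [AddCommGroup M] [Module k M]

theorem tmul_mem_termGr {a : ℤ} {X : TPow V (Fin n)} {y : P.obj n b}
    (hX : X ∈ tensGr V (Fin n) a) (hy : y ∈ (P.obj n b).gr j) (h : a + j = i) :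
    X ⊗ₜ[k] y ∈ termGr V P n b i := by
  refine (tensGr_le_iff (S := (termGr V P n b i).comap ((TensorProduct.mk k _ _).flip y))).2
    (fun x deg hx ha => ?_) hX
  exact Submodule.subset_span ⟨x, y, deg, j, hx, hy, by rw [ha, h], rfl⟩

theorem termGr_le {S : Submodule k (Term V P n b)}
    (h : ∀ (a j : ℤ) (X : TPow V (Fin n)) (y : P.obj n b), X ∈ tensGr V (Fin n) a →
      y ∈ (P.obj n b).gr j → a + j = i → X ⊗ₜ[k] y ∈ S) : termGr V P n b i ≤ S := by
  refine Submodule.span_le.2 ?_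
  rintro t ⟨x, y, deg, j, hx, hy, hd, rfl⟩
  exact h _ j _ _ (tprod_mem_tensGr hx rfl) hy hd

theorem termGr_ext {f g : Term V P n b →ₗ[k] M}
    (h : ∀ (a j : ℤ) (X : TPow V (Fin n)) (y : P.obj n b), X ∈ tensGr V (Fin n) a →
      y ∈ (P.obj n b).gr j → a + j = i → f (X ⊗ₜ y) = g (X ⊗ₜ y)) {t : Term V P n b}
    (ht : t ∈ termGr V P n b i) : f t = g t :=
  termGr_le (S := LinearMap.eqLocus f g) h ht

theorem termGr_ext₂ {f g : Term V P n₁ b₁ →ₗ[k] Term V P n₂ b₂ →ₗ[k] M}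
    (h : ∀ (a i' : ℤ) (X : TPow V (Fin n₁)) (x : P.obj n₁ b₁) (c j' : ℤ) (Y : TPow V (Fin n₂))
      (y : P.obj n₂ b₂), X ∈ tensGr V (Fin n₁) a → x ∈ (P.obj n₁ b₁).gr i' → a + i' = i →
      Y ∈ tensGr V (Fin n₂) c → y ∈ (P.obj n₂ b₂).gr j' → c + j' = j →
      f (X ⊗ₜ x) (Y ⊗ₜ y) = g (X ⊗ₜ x) (Y ⊗ₜ y))
    {s : Term V P n₁ b₁} {t : Term V P n₂ b₂}
    (hs : s ∈ termGr V P n₁ b₁ i) (ht : t ∈ termGr V P n₂ b₂ j) : f s t = g s t :=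
  termGr_ext (f := f.flip t) (g := g.flip t) (fun a i' X x hX hx hi =>
    termGr_ext (f := f (X ⊗ₜ x)) (g := g (X ⊗ₜ x))
      (fun c j' Y y hY hy hj => h a i' X x c j' Y y hX hx hi hY hy hj) ht) hs

end Homogeneous

variable (B P) in
/-- The contraction of two elements along an identification of the flags. -/
def termGlue (e : Fin n₁ ⊕ Fin n₂ ≃ Bool ⊕ Fin n) (b₁ b₂ b : ℕ) :
    Term V P n₁ b₁ →ₗ[k] Term V P n₂ b₂ →ₗ[k] Term V P n b :=
  (TensorProduct.mk k (Term V P n₁ b₁) (Term V P n₂ b₂)).compr₂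
    (TensorProduct.map
      (glueE B e ∘ₗ TensorProduct.map (tensSgn V n₁ (l - 1)) (tensSgn V n₂ (l - 1)))
      (TensorProduct.lift (glueP P e b₁ b₂ b)) ∘ₗ termSwap V P n₁ n₂ b₁ b₂)

variable (B P) in
/-- The contraction of an element along an identification of the flags. -/
def termSelfGlue (e : Fin m ≃ Bool ⊕ Fin n) (b b' : ℕ) : Term V P m b →ₗ[k] Term V P n b' :=
  TensorProduct.map (selfGlueE B e ∘ₗ tensSgn V m (l - 1)) (selfGlueP P e b b')

theorem termPair_tmul (s : Term V P (n₁ + 1) b₁) (t : Term V P (n₂ + 1) b₂) :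
    termPair B P n₁ n₂ b₁ b₂ (s ⊗ₜ t) = termGlue B P (pairFlags n₁ n₂) b₁ b₂ (b₁ + b₂) s t := by
  rw [termPair, pairP_eq]; rfl

theorem termLoop_eq (n b : ℕ) :
    termLoop B P n b = termSelfGlue B P (loopFlags n) b (b + 1) := by
  rw [termLoop, loopP_eq]; rfl

theorem termSwap_tmul {c i : ℤ} {X : TPow V (Fin n₁)} {Y : TPow V (Fin n₂)} {x : P.obj n₁ b₁}
    {y : P.obj n₂ b₂} (hx : x ∈ (P.obj n₁ b₁).gr i) (hY : Y ∈ tensGr V (Fin n₂) c) :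
    termSwap V P n₁ n₂ b₁ b₂ ((X ⊗ₜ x) ⊗ₜ (Y ⊗ₜ y)) =
      (i * c).negOnePow • ((X ⊗ₜ[k] Y) ⊗ₜ[k] (x ⊗ₜ[k] y)) := by
  have h : ∀ α γ : Fin 2, TensorProduct.map (TensorProduct.map (LinearMap.id (R := k))
      ((P.obj n₁ b₁).par α)) (TensorProduct.map (tensPar V n₂ γ) (LinearMap.id (R := k)))
        ((X ⊗ₜ[k] x) ⊗ₜ[k] (Y ⊗ₜ[k] y)) =
      if α = parity i ∧ γ = parity c then (X ⊗ₜ[k] x) ⊗ₜ[k] (Y ⊗ₜ[k] y) else 0 := fun α γ => by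
    rw [TensorProduct.map_tmul, TensorProduct.map_tmul, TensorProduct.map_tmul,
      ChainCx.par_of_mem _ hx, tensPar_of_mem hY]
    by_cases hα : α = parity i
    · by_cases hγ : γ = parity c
      · simp [hα, hγ]
      · simp [hγ]
    · simp [hα]
  -- The sign acts through two nested left factors and finally through the integer action on the
  -- tensor power of `V`.
  have hs : ∀ (s : ℤˣ) (f : Term V P n₁ b₁ ⊗[k] Term V P n₂ b₂ →ₗ[k]
      Term V P n₁ b₁ ⊗[k] Term V P n₂ b₂) z, (s • f) z = ((s : ℤ) : k) • f z := fun s f z => by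
    rw [Units.smul_def]
    refine TensorProduct.left_int_smul (fun n x => TensorProduct.left_int_smul
      (fun n x => ?_) n x) (s : ℤ) (f z)
    rw [← zsmul_one (R := k)]
    exact (@smul_one_smul _ ℤ k _ _ _ PiTensorProduct.hasSMul' PiTensorProduct.isScalarTower' n
      x).symm
  rw [termSwap, LinearMap.comp_apply, LinearMap.sum_apply, Finset.sum_eq_single (parity i),
    LinearMap.sum_apply, Finset.sum_eq_single (parity c), hs, h, if_pos ⟨rfl, rfl⟩, map_smul]
  · refine Eq.trans ?_ (intUnits_smul_eq_cast_smul (k := k) (i * c).negOnePow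
      ((X ⊗ₜ[k] Y) ⊗ₜ[k] (x ⊗ₜ[k] y))).symm
    rw [LinearEquiv.coe_coe, TensorProduct.tensorTensorTensorComm_tmul]
    congr 3
    refine Int.negOnePow_eq_of_zmod ?_
    rw [Int.cast_mul, Int.cast_mul, intCast_parity, intCast_parity]
  · intro γ _ hγ
    rw [hs, h, if_neg fun h => hγ h.2, smul_zero]
  · simp
  · intro α _ hα
    rw [LinearMap.sum_apply]
    refine Finset.sum_eq_zero fun γ _ => ?_
    rw [hs, h, if_neg fun h => hα h.1, smul_zero]
  · simp

theorem termGlue_tmul (e : Fin n₁ ⊕ Fin n₂ ≃ Bool ⊕ Fin n) {a c i : ℤ} {X : TPow V (Fin n₁)}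
    {Y : TPow V (Fin n₂)} {x : P.obj n₁ b₁} {y : P.obj n₂ b₂} (hX : X ∈ tensGr V (Fin n₁) a)
    (hx : x ∈ (P.obj n₁ b₁).gr i) (hY : Y ∈ tensGr V (Fin n₂) c) :
    termGlue B P e b₁ b₂ b (X ⊗ₜ x) (Y ⊗ₜ y) =
      (i * c + (l - 1) * (a + c)).negOnePow • (glueE B e (X ⊗ₜ Y) ⊗ₜ glueP P e b₁ b₂ b x y) := by
  rw [termGlue, LinearMap.compr₂_apply, TensorProduct.mk_apply, LinearMap.comp_apply,
    termSwap_tmul hx hY, TensorProduct.map_intUnits_smul, TensorProduct.map_tmul,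
    LinearMap.comp_apply, TensorProduct.map_tmul, tensSgn_of_mem hX, tensSgn_of_mem hY,
    TensorProduct.intUnits_smul_tmul, TensorProduct.tmul_intUnits_smul,
    TensorProduct.map_intUnits_smul, TensorProduct.map_intUnits_smul, TensorProduct.lift.tmul,
    TensorProduct.intUnits_smul_tmul, TensorProduct.intUnits_smul_tmul, intUnits_mul_smul,
    intUnits_mul_smul, ← Int.negOnePow_add, ← Int.negOnePow_add, mul_add]
  congr 2; ring

theorem termSelfGlue_tmul (e : Fin m ≃ Bool ⊕ Fin n) {a : ℤ} {X : TPow V (Fin m)} {x : P.obj m b}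
    (hX : X ∈ tensGr V (Fin m) a) :
    termSelfGlue B P e b b' (X ⊗ₜ x) =
      ((l - 1) * a).negOnePow • (selfGlueE B e X ⊗ₜ selfGlueP P e b b' x) := by
  rw [termSelfGlue, TensorProduct.map_tmul, LinearMap.comp_apply, tensSgn_of_mem hX,
    LinearMap.map_intUnits_smul, TensorProduct.intUnits_smul_tmul]

theorem termAct_tmul (g : Equiv.Perm (Fin n)) (X : TPow V (Fin n)) (x : P.obj n b) :
    termAct V P n b g (X ⊗ₜ x) = koszulMap V g X ⊗ₜ P.act n b g x := rfl

theorem termD_tmul {a : ℤ} {X : TPow V (Fin n)} (hX : X ∈ tensGr V (Fin n) a) (x : P.obj n b) :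
    termD V P n b (X ⊗ₜ x) =
      tensD V n X ⊗ₜ x + a.negOnePow • (X ⊗ₜ (P.obj n b).d x) := by
  rw [termD, LinearMap.add_apply, TensorProduct.map_tmul, TensorProduct.map_tmul,
    tensSgn_of_mem hX, TensorProduct.intUnits_smul_tmul, one_mul]; rfl

theorem termGlue_mem (e : Fin n₁ ⊕ Fin n₂ ≃ Bool ⊕ Fin n) {s : Term V P n₁ b₁}
    {t : Term V P n₂ b₂} (hs : s ∈ termGr V P n₁ b₁ i) (ht : t ∈ termGr V P n₂ b₂ j) :
    termGlue B P e b₁ b₂ b s t ∈ termGr V P n b (i + j - 1) := by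
  refine termGr_le (S := (termGr V P n b (i + j - 1)).comap ((termGlue B P e b₁ b₂ b).flip t))
    (fun a i' X x hX hx hi => ?_) hs
  refine termGr_le (S := (termGr V P n b (i + j - 1)).comap (termGlue B P e b₁ b₂ b (X ⊗ₜ x)))
    (fun c j' Y y hY hy hj => ?_) ht
  rw [Submodule.mem_comap, termGlue_tmul e hX hx hY]
  exact Submodule.intUnits_smul_mem _ _ (tmul_mem_termGr (glueE_mem e hX hY) (glueP_mem e hx hy)
    (by omega))

theorem termSelfGlue_mem (e : Fin m ≃ Bool ⊕ Fin n) {s : Term V P m b}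
    (hs : s ∈ termGr V P m b i) : termSelfGlue B P e b b' s ∈ termGr V P n b' (i - 1) := by
  refine termGr_le (S := (termGr V P n b' (i - 1)).comap (termSelfGlue B P e b b'))
    (fun a i' X x hX hx hi => ?_) hs
  rw [Submodule.mem_comap, termSelfGlue_tmul e hX]
  exact Submodule.intUnits_smul_mem _ _ (tmul_mem_termGr (selfGlueE_mem e hX) (selfGlueP_mem e hx)
    (by omega))

theorem termAct_mem (g : Equiv.Perm (Fin n)) {s : Term V P n b} (hs : s ∈ termGr V P n b i) :
    termAct V P n b g s ∈ termGr V P n b i := by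
  refine termGr_le (S := (termGr V P n b i).comap (termAct V P n b g))
    (fun a i' X x hX hx hi => ?_) hs
  exact tmul_mem_termGr (koszulMap_mem g hX) (P.act_mem n b g i' x hx) hi

theorem termD_mem {s : Term V P n b} (hs : s ∈ termGr V P n b i) :
    termD V P n b s ∈ termGr V P n b (i - 1) := by
  refine termGr_le (S := (termGr V P n b (i - 1)).comap (termD V P n b))
    (fun a i' X x hX hx hi => ?_) hs
  rw [Submodule.mem_comap, termD_tmul hX]
  exact add_mem (tmul_mem_termGr (tensD_eq (V := V) n ▸ tensDiff_mem hX) hx (by omega))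
    (Submodule.intUnits_smul_mem _ _ (tmul_mem_termGr hX ((P.obj n b).d_mem i' x hx) (by omega)))

theorem termAct_mul (g h : Equiv.Perm (Fin n)) {s : Term V P n b} (hs : s ∈ termGr V P n b i) :
    termAct V P n b (g * h) s = termAct V P n b g (termAct V P n b h s) := by
  refine termGr_ext (g := termAct V P n b g ∘ₗ termAct V P n b h) (fun a i' X x hX hx hi => ?_) hs
  rw [LinearMap.comp_apply, termAct_tmul, termAct_tmul, termAct_tmul, map_mul]
  exact congrArg₂ (· ⊗ₜ[k] ·) (koszulMap_trans h g hX) rfl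

theorem termAct_termD (g : Equiv.Perm (Fin n)) {s : Term V P n b} (hs : s ∈ termGr V P n b i) :
    termAct V P n b g (termD V P n b s) = termD V P n b (termAct V P n b g s) := by
  refine termGr_ext (f := termAct V P n b g ∘ₗ termD V P n b)
    (g := termD V P n b ∘ₗ termAct V P n b g) (fun a i' X x hX hx hi => ?_) hs
  rw [LinearMap.comp_apply, LinearMap.comp_apply, termAct_tmul, termD_tmul hX,
    termD_tmul (koszulMap_mem g hX), map_add, LinearMap.map_intUnits_smul, termAct_tmul,
    termAct_tmul, P.act_d, tensD_eq, koszulMap_tensDiff g hX]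

theorem termD_termD [CharZero k] {s : Term V P n b} (hs : s ∈ termGr V P n b i) :
    termD V P n b (termD V P n b s) = 0 := by
  refine termGr_ext (f := termD V P n b ∘ₗ termD V P n b) (g := 0) (fun a i' X x hX hx hi => ?_) hs
  have hX' : tensD V n X ∈ tensGr V (Fin n) (a - 1) := tensDiff_mem hX
  rw [LinearMap.comp_apply, termD_tmul hX, map_add, LinearMap.map_intUnits_smul, termD_tmul hX,
    termD_tmul hX', (P.obj n b).d_d, TensorProduct.tmul_zero, intUnits_smul_zero, add_zero,
    LinearMap.zero_apply, tensD_eq, tensDiff_tensDiff hX, TensorProduct.zero_tmul, zero_add,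
    Int.negOnePow_sub, Int.negOnePow_one, mul_neg, mul_one, intUnits_neg_smul, neg_add_cancel]

theorem termGlue_act {e e' : Fin n₁ ⊕ Fin n₂ ≃ Bool ⊕ Fin n}
    {g₁ : Equiv.Perm (Fin n₁)} {g₂ : Equiv.Perm (Fin n₂)} {h : Equiv.Perm (Fin n)}
    (H : (Equiv.sumCongr g₁ g₂).trans e' = e.trans (Equiv.sumCongr (Equiv.refl _) h))
    (he : JoinsFactors e) {s : Term V P n₁ b₁} {t : Term V P n₂ b₂}
    (hs : s ∈ termGr V P n₁ b₁ i) (ht : t ∈ termGr V P n₂ b₂ j) :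
    termGlue B P e' b₁ b₂ b (termAct V P n₁ b₁ g₁ s) (termAct V P n₂ b₂ g₂ t) =
      termAct V P n b h (termGlue B P e b₁ b₂ b s t) := by
  rw [← LinearMap.compr₂_apply, ← LinearMap.compl₁₂_apply]
  refine termGr_ext₂ (fun a i' X x c j' Y y hX hx hi hY hy hj => ?_) hs ht
  rw [LinearMap.compl₁₂_apply, LinearMap.compr₂_apply, termAct_tmul, termAct_tmul,
    termGlue_tmul _ (koszulMap_mem g₁ hX) (P.act_mem _ _ _ _ _ hx) (koszulMap_mem g₂ hY),
    termGlue_tmul _ hX hx hY, LinearMap.map_intUnits_smul, termAct_tmul, glueE_koszulMap _ _ _ hX hY,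
    H, koszulMap_glueE _ _ hX hY, glueP_act H he hx hy]

theorem termSelfGlue_act {e e' : Fin m ≃ Bool ⊕ Fin n}
    {g : Equiv.Perm (Fin m)} {h : Equiv.Perm (Fin n)}
    (H : g.trans e' = e.trans (Equiv.sumCongr (Equiv.refl _) h))
    {s : Term V P m b} (hs : s ∈ termGr V P m b i) :
    termSelfGlue B P e' b b' (termAct V P m b g s) =
      termAct V P n b' h (termSelfGlue B P e b b' s) := by
  refine termGr_ext (f := termSelfGlue B P e' b b' ∘ₗ termAct V P m b g)
    (g := termAct V P n b' h ∘ₗ termSelfGlue B P e b b') (fun a i' X x hX hx hi => ?_) hs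
  rw [LinearMap.comp_apply, LinearMap.comp_apply, termAct_tmul,
    termSelfGlue_tmul _ (koszulMap_mem g hX), termSelfGlue_tmul _ hX,
    LinearMap.map_intUnits_smul, termAct_tmul, selfGlueE_koszulMap _ _ hX, H,
    koszulMap_selfGlueE _ _ hX, selfGlueP_act H hx]

/-- The factor `η` appears once from `B` and once from `P` and cancels; this is the reason for
matching the symmetry of `B` with the cocycle. The remaining exponents add up to `i * j` modulo 2.
-/
theorem termGlue_sumComm {e : Fin n₂ ⊕ Fin n₁ ≃ Bool ⊕ Fin n} (he : JoinsFactors e)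
    {s : Term V P n₁ b₁} {t : Term V P n₂ b₂}
    (hs : s ∈ termGr V P n₁ b₁ i) (ht : t ∈ termGr V P n₂ b₂ j) :
    termGlue B P (((Equiv.sumComm (Fin n₁) (Fin n₂)).trans e).trans (flipEdge _)) b₁ b₂ b s t =
      (i * j).negOnePow • termGlue B P e b₂ b₁ b t s := by
  have h := intUnits_smul_eq_cast_smul (k := k) (i * j).negOnePow (termGlue B P e b₂ b₁ b t s)
  rw [h, ← LinearMap.flip_apply (termGlue B P e b₂ b₁ b), ← LinearMap.smul_apply, ← LinearMap.smul_apply]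
  refine termGr_ext₂ (fun a i' X x c j' Y y hX hx hi hY hy hj => ?_) hs ht
  rw [LinearMap.smul_apply, LinearMap.smul_apply, LinearMap.flip_apply,
    ← intUnits_smul_eq_cast_smul, termGlue_tmul _ hX hx hY, termGlue_tmul _ hY hy hX, glueE_sumComm _ hX hY,
    glueP_sumComm he hx hy, TensorProduct.intUnits_smul_tmul, TensorProduct.tmul_intUnits_smul,
    intUnits_mul_smul, intUnits_mul_smul, intUnits_mul_smul]
  refine congrArg₂ (· • ·) ?_ rfl
  rw [show ∀ s t u : ℤˣ, s * (η * t) * (η * u) = (η * η) * (s * t * u) from fun s t u => by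
    ac_rfl, Int.units_mul_self, one_mul, ← Int.negOnePow_add, ← Int.negOnePow_add,
    ← Int.negOnePow_add]
  subst hi hj
  apply Int.negOnePow_eq_of_zmod
  push_cast
  generalize (i' : ZMod 2) = i', (j' : ZMod 2) = j', (a : ZMod 2) = a, (c : ZMod 2) = c,
    (l : ZMod 2) = l
  revert i' j' a c l
  decide

/-- Again the two factors `η` cancel, so that the direction of a loop is irrelevant. -/
theorem termSelfGlue_flipEdge (e : Fin m ≃ Bool ⊕ Fin n) {s : Term V P m b}
    (hs : s ∈ termGr V P m b i) :
    termSelfGlue B P (e.trans (flipEdge _)) b b' s = termSelfGlue B P e b b' s := by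
  refine termGr_ext (fun a i' X x hX hx hi => ?_) hs
  rw [termSelfGlue_tmul _ hX, termSelfGlue_tmul _ hX, selfGlueE_flipEdge _ hX,
    selfGlueP_flipEdge _ hx, TensorProduct.intUnits_smul_tmul, TensorProduct.tmul_intUnits_smul,
    intUnits_mul_smul η η, Int.units_mul_self, intUnits_one_smul]

end Terms

/-! ## The relations between contractions -/

section TermRelations

variable {k : Type u} [Field k] {l : ℤ} {η : ℤˣ} {V : ChainCx.{u, v} k}
  {B : InnerProd V l η} {P : TwistedModularOperad.{u, w} k (l - 1) η}
  {n₁ n₂ n₃ m m' n b₁ b₂ b₃ c d b b' : ℕ} {i j q : ℤ}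

theorem termGr_ext₃ {M : Type*} [AddCommGroup M] [Module k M]
    {f g : Term V P n₁ b₁ →ₗ[k] Term V P n₂ b₂ →ₗ[k] Term V P n₃ b₃ →ₗ[k] M}
    (h : ∀ (a i' : ℤ) (X : TPow V (Fin n₁)) (x : P.obj n₁ b₁) (c j' : ℤ) (Y : TPow V (Fin n₂))
      (y : P.obj n₂ b₂) (d q' : ℤ) (Z : TPow V (Fin n₃)) (z : P.obj n₃ b₃),
      X ∈ tensGr V (Fin n₁) a → x ∈ (P.obj n₁ b₁).gr i' → a + i' = i →
      Y ∈ tensGr V (Fin n₂) c → y ∈ (P.obj n₂ b₂).gr j' → c + j' = j →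
      Z ∈ tensGr V (Fin n₃) d → z ∈ (P.obj n₃ b₃).gr q' → d + q' = q →
      f (X ⊗ₜ x) (Y ⊗ₜ y) (Z ⊗ₜ z) = g (X ⊗ₜ x) (Y ⊗ₜ y) (Z ⊗ₜ z))
    {s : Term V P n₁ b₁} {t : Term V P n₂ b₂} {r : Term V P n₃ b₃}
    (hs : s ∈ termGr V P n₁ b₁ i) (ht : t ∈ termGr V P n₂ b₂ j) (hr : r ∈ termGr V P n₃ b₃ q) :
    f s t r = g s t r :=
  termGr_ext (f := (f.flip t).flip r) (g := (g.flip t).flip r) (fun a i' X x hX hx hi =>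
    termGr_ext₂ (f := f (X ⊗ₜ x)) (g := g (X ⊗ₜ x))
      (fun c j' Y y d q' Z z hY hy hj hZ hz hq =>
        h a i' X x c j' Y y d q' Z z hX hx hi hY hy hj hZ hz hq) ht hr) hs

/-- The exchange of the edges costs `(-1) ^ l` on the tensors and `(-1) ^ (l - 1)` on the operad,
while the Koszul signs between the two are the same for both orders. This is the anticommutation of
contractions; the next three lemmas are its versions for the other graphs with two edges. -/
theorem termSelfGlue_termSelfGlue {e : Fin n₁ ≃ Bool ⊕ Fin m} {e' : Fin m ≃ Bool ⊕ Fin n}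
    {f : Fin n₁ ≃ Bool ⊕ Fin m'} {f' : Fin m' ≃ Bool ⊕ Fin n}
    (H : thenLoopFlags f f' = (thenLoopFlags e e').trans (swapEdges (Fin n)))
    (hb : b₁ + 1 = c) (hc : c + 1 = b) {s : Term V P n₁ b₁} (hs : s ∈ termGr V P n₁ b₁ i) :
    termSelfGlue B P f' c b (termSelfGlue B P f b₁ c s) =
      -termSelfGlue B P e' c b (termSelfGlue B P e b₁ c s) := by
  refine termGr_ext (f := termSelfGlue B P f' c b ∘ₗ termSelfGlue B P f b₁ c)
    (g := -(termSelfGlue B P e' c b ∘ₗ termSelfGlue B P e b₁ c)) (fun a i' X x hX hx hi => ?_) hs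
  rw [LinearMap.neg_apply, LinearMap.comp_apply, LinearMap.comp_apply, termSelfGlue_tmul _ hX,
    termSelfGlue_tmul _ hX, LinearMap.map_intUnits_smul, LinearMap.map_intUnits_smul,
    termSelfGlue_tmul _ (selfGlueE_mem f hX), termSelfGlue_tmul _ (selfGlueE_mem e hX),
    selfGlueE_selfGlueE H hX, selfGlueP_selfGlueP H hb hc hx, TensorProduct.intUnits_smul_tmul,
    TensorProduct.tmul_intUnits_smul, neg_eq_negOnePow_smul]
  simp only [intUnits_mul_smul, ← Int.negOnePow_add]
  refine congrArg₂ (· • ·) (Int.negOnePow_eq_of_zmod ?_) rfl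
  push_cast
  generalize (a : ZMod 2) = a, (l : ZMod 2) = l
  revert a l
  decide

theorem termSelfGlue_termGlue {e : Fin n₁ ⊕ Fin n₂ ≃ Bool ⊕ Fin m} {e' : Fin m ≃ Bool ⊕ Fin n}
    {f : Fin n₁ ⊕ Fin n₂ ≃ Bool ⊕ Fin m'} {f' : Fin m' ≃ Bool ⊕ Fin n}
    (H : thenLoopFlags f f' = (thenLoopFlags e e').trans (swapEdges (Fin n)))
    (he : JoinsFactors e) (hf : JoinsFactors f) (hb : b₁ + b₂ = c) (hc : c + 1 = b)
    {s : Term V P n₁ b₁} {t : Term V P n₂ b₂} (hs : s ∈ termGr V P n₁ b₁ i)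
    (ht : t ∈ termGr V P n₂ b₂ j) :
    termSelfGlue B P f' c b (termGlue B P f b₁ b₂ c s t) =
      -termSelfGlue B P e' c b (termGlue B P e b₁ b₂ c s t) := by
  rw [← neg_one_smul k]
  refine termGr_ext₂ (f := (termGlue B P f b₁ b₂ c).compr₂ (termSelfGlue B P f' c b))
    (g := (-1 : k) • (termGlue B P e b₁ b₂ c).compr₂ (termSelfGlue B P e' c b))
    (fun a i' X x g j' Y y hX hx hi hY hy hj => ?_) hs ht
  rw [LinearMap.smul_apply, LinearMap.smul_apply, neg_one_smul, LinearMap.compr₂_apply, LinearMap.compr₂_apply,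
    termGlue_tmul _ hX hx hY, termGlue_tmul _ hX hx hY,
    LinearMap.map_intUnits_smul, LinearMap.map_intUnits_smul,
    termSelfGlue_tmul _ (glueE_mem f hX hY), termSelfGlue_tmul _ (glueE_mem e hX hY),
    selfGlueE_glueE H hX hY, selfGlueP_glueP H he hf hb hc hx hy,
    TensorProduct.intUnits_smul_tmul,
    TensorProduct.tmul_intUnits_smul, neg_eq_negOnePow_smul]
  simp only [intUnits_mul_smul, ← Int.negOnePow_add]
  refine congrArg₂ (· • ·) (Int.negOnePow_eq_of_zmod ?_) rfl
  push_cast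
  generalize (a : ZMod 2) = a, (g : ZMod 2) = g, (l : ZMod 2) = l, (i' : ZMod 2) = i'
  revert a g l i'
  decide

theorem termGlue_termSelfGlue {e : Fin n₁ ⊕ Fin n₂ ≃ Bool ⊕ Fin m} {e' : Fin m ≃ Bool ⊕ Fin n}
    {f' : Fin n₁ ≃ Bool ⊕ Fin m'} {f : Fin m' ⊕ Fin n₂ ≃ Bool ⊕ Fin n}
    (H : loopThenFlags f' f = (thenLoopFlags e e').trans (swapEdges (Fin n)))
    (he : JoinsFactors e) (hf : JoinsFactors f) (hb : b₁ + b₂ = c) (hc : c + 1 = b)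
    (hd : b₁ + 1 = d) {s : Term V P n₁ b₁} {t : Term V P n₂ b₂} (hs : s ∈ termGr V P n₁ b₁ i)
    (ht : t ∈ termGr V P n₂ b₂ j) :
    termGlue B P f d b₂ b (termSelfGlue B P f' b₁ d s) t =
      -termSelfGlue B P e' c b (termGlue B P e b₁ b₂ c s t) := by
  rw [← neg_one_smul k]
  refine termGr_ext₂ (f := (termGlue B P f d b₂ b) ∘ₗ termSelfGlue B P f' b₁ d)
    (g := (-1 : k) • (termGlue B P e b₁ b₂ c).compr₂ (termSelfGlue B P e' c b))
    (fun a i' X x g j' Y y hX hx hi hY hy hj => ?_) hs ht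
  rw [LinearMap.smul_apply, LinearMap.smul_apply, neg_one_smul, LinearMap.comp_apply, LinearMap.compr₂_apply,
    termGlue_tmul _ hX hx hY, termSelfGlue_tmul _ hX, LinearMap.map_intUnits_smul₂,
    LinearMap.map_intUnits_smul, termSelfGlue_tmul _ (glueE_mem e hX hY),
    termGlue_tmul _ (selfGlueE_mem f' hX) (selfGlueP_mem f' hx) hY,
    selfGlueE_glueE_eq_glueE_selfGlueE H hX hY, glueP_selfGlueP H he hf hb hc hd hx hy,
    TensorProduct.intUnits_smul_tmul,
    TensorProduct.tmul_intUnits_smul, neg_eq_negOnePow_smul]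
  simp only [intUnits_mul_smul, ← Int.negOnePow_add]
  refine congrArg₂ (· • ·) (Int.negOnePow_eq_of_zmod ?_) rfl
  push_cast
  generalize (a : ZMod 2) = a, (g : ZMod 2) = g, (l : ZMod 2) = l, (i' : ZMod 2) = i'
  revert a g l i'
  decide

theorem termGlue_termGlue {e' : Fin n₁ ⊕ Fin n₂ ≃ Bool ⊕ Fin m}
    {e : Fin m ⊕ Fin n₃ ≃ Bool ⊕ Fin n} {f' : Fin n₁ ⊕ Fin n₃ ≃ Bool ⊕ Fin m'}
    {f : Fin m' ⊕ Fin n₂ ≃ Bool ⊕ Fin n}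
    (H : (swapLastSum _ _ _).trans (nestFlags f' f) = (nestFlags e' e).trans (swapEdges (Fin n)))
    (he' : JoinsFactors e') (he : JoinsFactors e) (hf' : JoinsFactors f') (hf : JoinsFactors f)
    (hc : b₁ + b₂ = c) (hd : b₁ + b₃ = d) (hb : c + b₃ = b)
    {s : Term V P n₁ b₁} {t : Term V P n₂ b₂} {r : Term V P n₃ b₃}
    (hs : s ∈ termGr V P n₁ b₁ i) (ht : t ∈ termGr V P n₂ b₂ j) (hr : r ∈ termGr V P n₃ b₃ q) :
    termGlue B P f d b₂ b (termGlue B P f' b₁ b₃ d s r) t =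
      (1 + j * q).negOnePow • termGlue B P e c b₃ b (termGlue B P e' b₁ b₂ c s t) r := by
  have h := intUnits_smul_eq_cast_smul (k := k) (1 + j * q).negOnePow
    (termGlue B P e c b₃ b (termGlue B P e' b₁ b₂ c s t) r)
  rw [h]
  refine termGr_ext₃
    (f := (LinearMap.lflip (R₀ := k)).toLinearMap ∘ₗ ((termGlue B P f' b₁ b₃ d).compr₂ (termGlue B P f d b₂ b)))
    (g := (((1 + j * q).negOnePow : ℤ) : k) •
      (termGlue B P e' b₁ b₂ c).compr₂ (termGlue B P e c b₃ b))
    (fun a i' X x g j' Y y a' q' Z z hX hx hi hY hy hj hZ hz hq => ?_) hs ht hr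
  rw [LinearMap.smul_apply, LinearMap.smul_apply, LinearMap.smul_apply, LinearMap.comp_apply,
    LinearEquiv.coe_coe, LinearMap.lflip_apply, LinearMap.flip_apply, LinearMap.compr₂_apply,
    LinearMap.compr₂_apply, ← intUnits_smul_eq_cast_smul, termGlue_tmul _ hX hx hY, termGlue_tmul _ hX hx hZ,
    LinearMap.map_intUnits_smul₂, LinearMap.map_intUnits_smul₂,
    termGlue_tmul _ (glueE_mem f' hX hZ) (glueP_mem f' hx hz) hY,
    termGlue_tmul _ (glueE_mem e' hX hY) (glueP_mem e' hx hy) hZ,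
    glueE_glueE H hX hY hZ, glueP_glueP H he' he hf' hf hc hd hb hx hy hz,
    TensorProduct.intUnits_smul_tmul, TensorProduct.tmul_intUnits_smul]
  simp only [intUnits_mul_smul, ← Int.negOnePow_add]
  refine congrArg₂ (· • ·) (Int.negOnePow_eq_of_zmod ?_) rfl
  subst hi hj hq
  push_cast
  generalize (a : ZMod 2) = a, (g : ZMod 2) = g, (l : ZMod 2) = l, (i' : ZMod 2) = i',
    (a' : ZMod 2) = a', (j' : ZMod 2) = j', (q' : ZMod 2) = q'
  revert a g l i' a' j' q'
  decide

/-- The sign is that of a differential passing an operation of degree `-l + (l - 1) = -1` which is a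
chain map on both factors. -/
theorem termD_termGlue (e : Fin n₁ ⊕ Fin n₂ ≃ Bool ⊕ Fin n) {s : Term V P n₁ b₁}
    {t : Term V P n₂ b₂} (hs : s ∈ termGr V P n₁ b₁ i) (ht : t ∈ termGr V P n₂ b₂ j) :
    termD V P n b (termGlue B P e b₁ b₂ b s t) =
      -termGlue B P e b₁ b₂ b (termD V P n₁ b₁ s) t +
        -(i.negOnePow • termGlue B P e b₁ b₂ b s (termD V P n₂ b₂ t)) := by
  have h := intUnits_smul_eq_cast_smul (k := k) i.negOnePow
    (termGlue B P e b₁ b₂ b s (termD V P n₂ b₂ t))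
  rw [h, ← neg_one_smul k, ← neg_one_smul k (((i.negOnePow : ℤ) : k) • _)]
  refine termGr_ext₂ (f := (termGlue B P e b₁ b₂ b).compr₂ (termD V P n b))
    (g := (-1 : k) • (termGlue B P e b₁ b₂ b ∘ₗ termD V P n₁ b₁) + (-1 : k) •
      (((i.negOnePow : ℤ) : k) • (termGlue B P e b₁ b₂ b).compl₂ (termD V P n₂ b₂)))
    (fun a i' X x g j' Y y hX hx hi hY hy hj => ?_) hs ht
  have hX' : tensD V n₁ X ∈ tensGr V (Fin n₁) (a - 1) := tensDiff_mem hX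
  have hY' : tensD V n₂ Y ∈ tensGr V (Fin n₂) (g - 1) := tensDiff_mem hY
  rw [LinearMap.add_apply, LinearMap.add_apply, LinearMap.smul_apply, LinearMap.smul_apply,
    LinearMap.smul_apply, LinearMap.smul_apply, LinearMap.smul_apply, LinearMap.smul_apply,
    neg_one_smul, neg_one_smul, LinearMap.comp_apply, LinearMap.compr₂_apply,
    LinearMap.compl₂_apply, ← intUnits_smul_eq_cast_smul, termGlue_tmul _ hX hx hY,
    LinearMap.map_intUnits_smul, termD_tmul (glueE_mem e hX hY), termD_tmul hX, termD_tmul hY,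
    map_add, map_add, LinearMap.add_apply, LinearMap.map_intUnits_smul,
    LinearMap.map_intUnits_smul₂, termGlue_tmul _ hX' hx hY, termGlue_tmul _ hX hx hY',
    termGlue_tmul _ hX ((P.obj _ _).d_mem _ _ hx) hY, termGlue_tmul _ hX hx hY,
    tensD_glueE e hX hY, d_glueP e hx hy]
  simp only [TensorProduct.intUnits_smul_tmul, TensorProduct.tmul_intUnits_smul,
    TensorProduct.add_tmul, TensorProduct.tmul_add, intUnits_smul_add,
    neg_eq_negOnePow_smul, intUnits_mul_smul, ← Int.negOnePow_add]
  subst hi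
  refine (add_add_add_comm _ _ _ _).trans
    (congrArg₂ (· + ·) (congrArg₂ (· + ·) ?_ ?_) (congrArg₂ (· + ·) ?_ ?_))
  all_goals
    refine congrArg₂ (· • ·) (Int.negOnePow_eq_of_zmod ?_) rfl
    push_cast
    generalize (a : ZMod 2) = a, (g : ZMod 2) = g, (l : ZMod 2) = l, (i' : ZMod 2) = i'
    revert a g l i'
    decide

theorem termD_termSelfGlue (e : Fin m ≃ Bool ⊕ Fin n) {s : Term V P m b}
    (hs : s ∈ termGr V P m b i) :
    termD V P n b' (termSelfGlue B P e b b' s) = -termSelfGlue B P e b b' (termD V P m b s) := by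
  refine termGr_ext (f := termD V P n b' ∘ₗ termSelfGlue B P e b b')
    (g := -(termSelfGlue B P e b b' ∘ₗ termD V P m b)) (fun a i' X x hX hx hi => ?_) hs
  have hX' : tensD V m X ∈ tensGr V (Fin m) (a - 1) := tensDiff_mem hX
  rw [LinearMap.neg_apply, LinearMap.comp_apply, LinearMap.comp_apply, termSelfGlue_tmul _ hX,
    LinearMap.map_intUnits_smul, termD_tmul (selfGlueE_mem e hX), termD_tmul hX, map_add,
    LinearMap.map_intUnits_smul, termSelfGlue_tmul _ hX', termSelfGlue_tmul _ hX,
    tensD_selfGlueE e hX, d_selfGlueP e hx]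
  simp only [TensorProduct.intUnits_smul_tmul, TensorProduct.tmul_intUnits_smul,
    intUnits_smul_add, neg_eq_negOnePow_smul, intUnits_mul_smul, ← Int.negOnePow_add]
  refine congrArg₂ (· + ·) ?_ ?_
  all_goals
    refine congrArg₂ (· • ·) (Int.negOnePow_eq_of_zmod ?_) rfl
    push_cast
    generalize (a : ZMod 2) = a, (l : ZMod 2) = l
    revert a l
    decide

end TermRelations

/-! ## Positions of the flags of an edge -/

/-- A bijection which preserves the first summands pointwise is the sum of the identity and a
bijection of the second summands. -/
theorem exists_eq_sumCongr {α β γ : Type} (e : α ⊕ β ≃ α ⊕ γ)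
    (h : ∀ a, e (Sum.inl a) = Sum.inl a) :
    ∃ f : β ≃ γ, e = Equiv.sumCongr (Equiv.refl α) f := by
  have h' : ∀ a, e.symm (Sum.inl a) = Sum.inl a := fun a => by rw [Equiv.symm_apply_eq, h]
  have h₁ : ∀ b, ∃ c, e (Sum.inr b) = Sum.inr c := fun b => by
    cases hb : e (Sum.inr b) with
    | inl a => exact absurd (e.injective (hb.trans (h a).symm)) Sum.inr_ne_inl
    | inr c => exact ⟨c, rfl⟩
  have h₂ : ∀ c, ∃ b, e.symm (Sum.inr c) = Sum.inr b := fun c => by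
    cases hc : e.symm (Sum.inr c) with
    | inl a => exact absurd (e.symm.injective (hc.trans (h' a).symm)) Sum.inr_ne_inl
    | inr b => exact ⟨b, rfl⟩
  choose f hf using h₁
  choose g hg using h₂
  refine ⟨⟨f, g, fun b => ?_, fun c => ?_⟩, Equiv.ext ?_⟩
  · have := hg (f b)
    rw [← hf, Equiv.symm_apply_apply] at this
    exact (Sum.inr_injective this).symm
  · have := hf (g c)
    rw [← hg, Equiv.apply_symm_apply] at this
    exact (Sum.inr_injective this).symm
  · rintro (a | b)
    · exact h a
    · exact hf b

/-- Every renumbering of legs used below comes from here: gluings with the same flags on the edge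
can differ only in the numbering of the other flags. -/
theorem exists_trans_sumCongr {α β γ δ : Type} (e : δ ≃ α ⊕ β) (e' : δ ≃ α ⊕ γ)
    (h : ∀ a, e.symm (Sum.inl a) = e'.symm (Sum.inl a)) :
    ∃ f : β ≃ γ, e' = e.trans (Equiv.sumCongr (Equiv.refl α) f) := by
  obtain ⟨f, hf⟩ := exists_eq_sumCongr (e.symm.trans e') fun a => by
    rw [Equiv.trans_apply, h, Equiv.apply_symm_apply]
  refine ⟨f, ?_⟩
  rw [← hf, ← Equiv.trans_assoc, Equiv.self_trans_symm, Equiv.refl_trans]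

theorem swapEdges_trans_swapEdges (γ : Type) :
    (swapEdges γ).trans (swapEdges γ) = Equiv.refl _ := by
  ext q
  rcases q with c | c | c <;> rfl

/-- The edge joins the flag `p` of the first factor to the flag `q` of the second. -/
def Joins {α β γ : Type} (e : α ⊕ β ≃ Bool ⊕ γ) (p : α) (q : β) : Prop :=
  e (Sum.inl p) = Sum.inl false ∧ e (Sum.inr q) = Sum.inl true

section Positions

variable {α β γ δ : Type}

theorem Joins.joinsFactors {e : α ⊕ β ≃ Bool ⊕ γ} {p : α} {q : β} (h : Joins e p q) :
    JoinsFactors e :=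
  ⟨⟨p, h.1⟩, q, h.2⟩

theorem JoinsFactors.exists_joins {e : α ⊕ β ≃ Bool ⊕ γ} (h : JoinsFactors e) :
    ∃ p q, Joins e p q :=
  let ⟨⟨p, hp⟩, q, hq⟩ := h
  ⟨p, q, hp, hq⟩

theorem Joins.exists_perm {e : α ⊕ β ≃ Bool ⊕ γ} {e' : α ⊕ β ≃ Bool ⊕ δ} {p : α} {q : β}
    {g₁ : Equiv.Perm α} {g₂ : Equiv.Perm β} (h : Joins e p q) (h' : Joins e' (g₁ p) (g₂ q)) :
    ∃ f : γ ≃ δ, (Equiv.sumCongr g₁ g₂).trans e' = e.trans (Equiv.sumCongr (Equiv.refl _) f) := by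
  refine exists_trans_sumCongr e ((Equiv.sumCongr g₁ g₂).trans e') ?_
  rintro (_ | _)
  · rw [← h.1, Equiv.symm_apply_apply, eq_comm, Equiv.symm_apply_eq]
    exact h'.1.symm
  · rw [← h.2, Equiv.symm_apply_apply, eq_comm, Equiv.symm_apply_eq]
    exact h'.2.symm

theorem Joins.sumCongr_trans {e : α ⊕ β ≃ Bool ⊕ γ} {p : α} {q : β} {g₁ : Equiv.Perm α}
    {g₂ : Equiv.Perm β} (h : Joins e (g₁ p) (g₂ q)) :
    Joins ((Equiv.sumCongr g₁ g₂).trans e) p q := h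

theorem Joins.sumComm {e : α ⊕ β ≃ Bool ⊕ γ} {p : α} {q : β} (h : Joins e p q) :
    Joins (((Equiv.sumComm β α).trans e).trans (flipEdge γ)) q p :=
  ⟨by simp [flipEdge, h.2], by simp [flipEdge, h.1]⟩

/-- The loop is directed from the flag `p` to the flag `q`. -/
def LoopAt (e : α ≃ Bool ⊕ γ) (p q : α) : Prop := e p = Sum.inl false ∧ e q = Sum.inl true

theorem LoopAt.ne {e : α ≃ Bool ⊕ γ} {p q : α} (h : LoopAt e p q) : p ≠ q := by
  rintro rfl
  have := h.1.symm.trans h.2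
  simp at this

theorem exists_loopAt (e : α ≃ Bool ⊕ γ) : ∃ p q, LoopAt e p q :=
  ⟨e.symm (Sum.inl false), e.symm (Sum.inl true), by simp [LoopAt]⟩

theorem LoopAt.exists_perm {e : α ≃ Bool ⊕ γ} {e' : α ≃ Bool ⊕ δ} {p q : α}
    {g : Equiv.Perm α} (h : LoopAt e p q) (h' : LoopAt e' (g p) (g q)) :
    ∃ f : γ ≃ δ, g.trans e' = e.trans (Equiv.sumCongr (Equiv.refl _) f) := by
  refine exists_trans_sumCongr e (g.trans e') ?_
  rintro (_ | _)
  · rw [← h.1, Equiv.symm_apply_apply, eq_comm, Equiv.symm_apply_eq]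
    exact h'.1.symm
  · rw [← h.2, Equiv.symm_apply_apply, eq_comm, Equiv.symm_apply_eq]
    exact h'.2.symm

theorem LoopAt.flipEdge {e : α ≃ Bool ⊕ γ} {p q : α} (h : LoopAt e p q) :
    LoopAt (e.trans (flipEdge γ)) q p :=
  ⟨by simp [_root_.flipEdge, h.2], by simp [_root_.flipEdge, h.1]⟩

/-- The symmetric group is doubly transitive. -/
theorem exists_perm_apply_eq_two [DecidableEq α] {p q p' q' : α} (h : p ≠ q) (h' : p' ≠ q') :
    ∃ g : Equiv.Perm α, g p = p' ∧ g q = q' := by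
  refine ⟨Equiv.swap (Equiv.swap p p' q) q' * Equiv.swap p p', ?_, ?_⟩
  · rw [Equiv.Perm.mul_apply, Equiv.swap_apply_left]
    exact Equiv.swap_apply_of_ne_of_ne
      (fun hq => h ((Equiv.swap p p').injective ((Equiv.swap_apply_left p p').trans hq))) h'
  · rw [Equiv.Perm.mul_apply, Equiv.swap_apply_left]

theorem exists_loopAt_of_ne [DecidableEq α] (e : α ≃ Bool ⊕ γ) {p q : α} (h : p ≠ q) :
    ∃ e' : α ≃ Bool ⊕ γ, LoopAt e' p q := by
  obtain ⟨p', q', h'⟩ := exists_loopAt e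
  obtain ⟨g, hp, hq⟩ := exists_perm_apply_eq_two h h'.ne
  exact ⟨g.trans e, by rw [Equiv.trans_apply, hp, h'.1], by rw [Equiv.trans_apply, hq, h'.2]⟩

theorem JoinsFactors.exists_joins_left [DecidableEq α] {e : α ⊕ β ≃ Bool ⊕ γ}
    (h : JoinsFactors e) (p : α) : ∃ (e' : α ⊕ β ≃ Bool ⊕ γ) (q : β), Joins e' p q := by
  obtain ⟨p', q', h'⟩ := h.exists_joins
  exact ⟨(Equiv.sumCongr (Equiv.swap p p') (Equiv.refl β)).trans e, q',
    Joins.sumCongr_trans (by rwa [Equiv.swap_apply_left])⟩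

/-- The flag of the result comes from the first factor. -/
def FromLeft (e : α ⊕ β ≃ Bool ⊕ γ) (r : γ) : Prop := ∃ p, e (Sum.inl p) = Sum.inr r

theorem fromLeft_or (e : α ⊕ β ≃ Bool ⊕ γ) (r : γ) :
    FromLeft e r ∨ FromLeft (((Equiv.sumComm β α).trans e).trans (flipEdge γ)) r := by
  cases h : e.symm (Sum.inr r) with
  | inl p => exact Or.inl ⟨p, by rw [← h, Equiv.apply_symm_apply]⟩
  | inr q =>
    refine Or.inr ⟨q, ?_⟩
    have : e (Sum.inr q) = Sum.inr r := by rw [← h, Equiv.apply_symm_apply]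
    simp [flipEdge, this]

-- Exactly one flag of the first factor lies on the edge. The count compares the flags of the first
-- factor on both sides of `e`.
open Classical in
theorem card_fromLeft {n₁ n₂ m : ℕ} {e : Fin n₁ ⊕ Fin n₂ ≃ Bool ⊕ Fin m} (he : JoinsFactors e) :
    (Finset.univ.filter (FromLeft e)).card = n₁ - 1 := by
  obtain ⟨p, q, h⟩ := he.exists_joins
  have hs : ∑ s : Fin n₁ ⊕ Fin n₂, (if s.isLeft then 1 else 0) =
      ∑ s : Bool ⊕ Fin m, (if (e.symm s).isLeft then 1 else 0) :=
    (Equiv.sum_comp e.symm _).symm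
  have h₁ : e.symm (Sum.inl false) = Sum.inl p := by rw [Equiv.symm_apply_eq, h.1]
  have h₂ : e.symm (Sum.inl true) = Sum.inr q := by rw [Equiv.symm_apply_eq, h.2]
  rw [Fintype.sum_sum_type, Fintype.sum_sum_type, Fintype.sum_bool, h₁, h₂] at hs
  have hc : ∑ r : Fin m, (if (e.symm (Sum.inr r)).isLeft then 1 else 0) =
      (Finset.univ.filter (FromLeft e)).card := by
    rw [Finset.card_filter]
    refine Finset.sum_congr rfl fun r _ => ?_
    refine if_congr ?_ rfl rfl
    rw [Sum.isLeft_iff]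
    exact exists_congr fun s => by rw [Equiv.symm_apply_eq, eq_comm]
  rw [hc] at hs
  simp at hs
  omega

end Positions

/-! ## Sums over permutations -/

/-- Double counting: by transitivity the sum over the group does not depend on the starting point,
so one may sum over all starting points and exchange the two sums. -/
theorem card_smul_sum_perm {k : Type*} [Field k] {M : Type*} [AddCommGroup M] [Module k M]
    {G X : Type*} [Group G] [Fintype G] [MulAction G X] (s : Finset X)
    (hs : ∀ (g : G) (x : X), x ∈ s → g • x ∈ s)
    (ht : ∀ x ∈ s, ∀ y ∈ s, ∃ g : G, g • x = y) (F : X → M) {x₀ : X} (hx₀ : x₀ ∈ s) :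
    (s.card : k) • ∑ g : G, F (g • x₀) = (Fintype.card G : k) • ∑ x ∈ s, F x := by
  have h₁ : ∀ x ∈ s, ∑ g : G, F (g • x) = ∑ g : G, F (g • x₀) := fun x hx => by
    obtain ⟨h, rfl⟩ := ht x₀ hx₀ x hx
    simp only [← mul_smul]
    exact Equiv.sum_comp (Equiv.mulRight h) fun g => F (g • x₀)
  have h₂ : ∀ g : G, ∑ x ∈ s, F (g • x) = ∑ x ∈ s, F x := fun g => by
    refine Finset.sum_bij' (fun x _ => g • x) (fun x _ => g⁻¹ • x) (fun x hx => hs g x hx)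
      (fun x hx => hs g⁻¹ x hx) ?_ ?_ fun _ _ => rfl
    · intro x _; simp
    · intro x _; simp
  calc (s.card : k) • ∑ g : G, F (g • x₀) = ∑ x ∈ s, ∑ g : G, F (g • x) := by
        rw [Finset.sum_congr rfl h₁, Finset.sum_const, Nat.cast_smul_eq_nsmul]
    _ = ∑ g : G, ∑ x ∈ s, F (g • x) := Finset.sum_comm
    _ = _ := by
        rw [Finset.sum_congr rfl fun g _ => h₂ g, Finset.sum_const, Finset.card_univ,
          Nat.cast_smul_eq_nsmul]

section SumPerm

variable {k : Type*} [Field k] [CharZero k] {M : Type*} [AddCommGroup M] [Module k M]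

/-- The factor `(m - 1)!` is the number of permutations with a prescribed value at `x₀`. For two
prescribed values, in the next lemma, it is `(m - 2)!`. -/
theorem sum_perm_apply {m : ℕ} (F : Fin m → M) (x₀ : Fin m) :
    ∑ g : Equiv.Perm (Fin m), F (g x₀) = ((m - 1).factorial : k) • ∑ x, F x := by
  have hm : (m : k) ≠ 0 := Nat.cast_ne_zero.2 (Fin.pos x₀).ne'
  have h := card_smul_sum_perm (k := k) (G := Equiv.Perm (Fin m)) Finset.univ
    (fun _ _ _ => Finset.mem_univ _) (fun x _ y _ => ⟨Equiv.swap x y, Equiv.swap_apply_left x y⟩)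
    F (Finset.mem_univ x₀)
  rw [Finset.card_univ, Fintype.card_perm, Fintype.card_fin,
    ← Nat.mul_factorial_pred (Fin.pos x₀).ne', Nat.cast_mul, mul_smul] at h
  exact smul_right_injective M hm h

theorem sum_perm_apply_two {m : ℕ} (F : Fin m → Fin m → M) {x₀ y₀ : Fin m} (h₀ : x₀ ≠ y₀) :
    ∑ g : Equiv.Perm (Fin m), F (g x₀) (g y₀) =
      ((m - 2).factorial : k) • ∑ x ∈ (Finset.univ : Finset (Fin m)).offDiag, F x.1 x.2 := by
  have h2 : 2 ≤ m := by
    have := x₀.2; have := y₀.2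
    by_contra h
    exact h₀ (Fin.ext (by omega))
  obtain ⟨m, rfl⟩ := Nat.exists_eq_add_of_le' h2
  have h := card_smul_sum_perm (k := k) (G := Equiv.Perm (Fin (m + 2)))
    (Finset.univ : Finset (Fin (m + 2))).offDiag
    (fun g x hx => by
      rw [Finset.mem_offDiag] at hx ⊢
      exact ⟨Finset.mem_univ _, Finset.mem_univ _, fun h => hx.2.2 (g.injective h)⟩)
    (fun x hx y hy => by
      rw [Finset.mem_offDiag] at hx hy
      obtain ⟨g, h, h'⟩ := exists_perm_apply_eq_two hx.2.2 hy.2.2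
      exact ⟨g, Prod.ext h h'⟩)
    (fun x => F x.1 x.2) (x₀ := (x₀, y₀)) (by simp [Finset.mem_offDiag, h₀])
  rw [Finset.offDiag_card, Finset.card_univ, Fintype.card_perm, Fintype.card_fin,
    show (m + 2) * (m + 2) - (m + 2) = (m + 2) * (m + 1) by
      rw [← Nat.mul_sub_one]; rfl,
    show (m + 2).factorial = (m + 2) * (m + 1) * m.factorial by
      rw [Nat.factorial_succ, Nat.factorial_succ, mul_assoc], Nat.cast_mul ((m + 2) * (m + 1)),
    mul_smul] at h
  exact smul_right_injective M (Nat.cast_ne_zero.2 (by positivity)) h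

end SumPerm

/-! ## Symmetrized elements -/

section Averages

variable {k : Type u} [Field k] {l : ℤ} {η : ℤˣ} {V : ChainCx.{u, v} k}
  {B : InnerProd V l η} {P : TwistedModularOperad.{u, w} k (l - 1) η}
  {n₁ n₂ n₃ m n b₁ b₂ b₃ c b b' : ℕ} {i j q : ℤ}

variable (V P) in
/-- The sum of the translates of an element of `V ^ ⊗ n ⊗ P((n,b))`. -/
def avg (n b : ℕ) : Term V P n b →ₗ[k] Terms V P :=
  incl V P n b ∘ₗ ∑ g : Equiv.Perm (Fin n), termAct V P n b g

variable (V P) in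
/-- The invariant elements of degree `i`. -/
def invGr (n b : ℕ) (i : ℤ) : Submodule k (Term V P n b) where
  carrier := {t | t ∈ termGr V P n b i ∧ ∀ g, termAct V P n b g t = t}
  zero_mem' := ⟨zero_mem _, fun g => map_zero _⟩
  add_mem' hs ht := ⟨add_mem hs.1 ht.1, fun g => by rw [map_add, hs.2, ht.2]⟩
  smul_mem' c s hs := ⟨Submodule.smul_mem _ c hs.1, fun g => by rw [map_smul, hs.2]⟩

theorem sum_termAct_mem {t : Term V P n b} (ht : t ∈ termGr V P n b i) :
    ∑ g : Equiv.Perm (Fin n), termAct V P n b g t ∈ invGr V P n b i := by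
  refine ⟨sum_mem fun g _ => termAct_mem g ht, fun h => ?_⟩
  rw [map_sum, ← Equiv.sum_comp (Equiv.mulLeft h) fun g => termAct V P n b g t]
  exact Finset.sum_congr rfl fun g _ => (termAct_mul h g ht).symm

theorem avg_apply (t : Term V P n b) :
    avg V P n b t = incl V P n b (∑ g : Equiv.Perm (Fin n), termAct V P n b g t) := by
  rw [avg, LinearMap.comp_apply, LinearMap.sum_apply]

theorem avg_intUnits_smul (s : ℤˣ) (t : Term V P n b) :
    avg V P n b (s • t) = s • avg V P n b t := by
  rw [intUnits_smul_eq_cast_smul (k := k), intUnits_smul_eq_cast_smul (k := k), map_smul]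

theorem avg_termAct (g : Equiv.Perm (Fin n)) {t : Term V P n b} (ht : t ∈ termGr V P n b i) :
    avg V P n b (termAct V P n b g t) = avg V P n b t := by
  rw [avg_apply, avg_apply, ← Equiv.sum_comp (Equiv.mulRight g) fun h => termAct V P n b h t]
  exact congrArg _ (Finset.sum_congr rfl fun h _ => (termAct_mul h g ht).symm)

theorem avg_of_mem_invGr {t : Term V P n b} (ht : t ∈ invGr V P n b i) :
    avg V P n b t = (n.factorial : k) • incl V P n b t := by
  rw [avg_apply, Finset.sum_congr rfl fun g _ => ht.2 g, Finset.sum_const, Finset.card_univ,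
    Fintype.card_perm, Fintype.card_fin, ← Nat.cast_smul_eq_nsmul k, map_smul]

theorem incl_mem_FGr {t : Term V P n b} (ht : t ∈ invGr V P n b i) :
    incl V P n b t ∈ FGr V P i := by
  intro r
  by_cases h : (n, b) = r
  · subst h
    rw [incl, DirectSum.lof_eq_of, DirectSum.of_eq_same]
    exact ht
  · rw [incl, DirectSum.lof_eq_of, DirectSum.of_eq_of_ne _ _ _ (Ne.symm h)]
    exact (invGr V P r.1 r.2 i).zero_mem

theorem avg_mem_FGr {t : Term V P n b} (ht : t ∈ termGr V P n b i) :
    avg V P n b t ∈ FGr V P i := by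
  rw [avg_apply]
  exact incl_mem_FGr (sum_termAct_mem ht)

theorem FGr_le {S : Submodule k (Terms V P)}
    (h : ∀ (n b : ℕ) (t : Term V P n b), t ∈ invGr V P n b i → incl V P n b t ∈ S) :
    FGr V P i ≤ S := by
  classical
  intro m hm
  rw [← DirectSum.sum_support_of m]
  exact sum_mem fun r _ => h r.1 r.2 (m r) (hm r)

section Ext

variable {M : Type*} [AddCommMonoid M] [Module k M]

theorem FGr_ext {f g : Terms V P →ₗ[k] M}
    (h : ∀ (n b : ℕ) (t : Term V P n b), t ∈ invGr V P n b i →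
      f (incl V P n b t) = g (incl V P n b t)) {x : Terms V P} (hx : x ∈ FGr V P i) :
    f x = g x :=
  FGr_le (S := LinearMap.eqLocus f g) h hx

theorem FGr_ext₂ {f g : Terms V P →ₗ[k] Terms V P →ₗ[k] M}
    (h : ∀ (n₁ b₁ : ℕ) (s : Term V P n₁ b₁) (n₂ b₂ : ℕ) (t : Term V P n₂ b₂),
      s ∈ invGr V P n₁ b₁ i → t ∈ invGr V P n₂ b₂ j →
      f (incl V P n₁ b₁ s) (incl V P n₂ b₂ t) = g (incl V P n₁ b₁ s) (incl V P n₂ b₂ t))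
    {x y : Terms V P} (hx : x ∈ FGr V P i) (hy : y ∈ FGr V P j) : f x y = g x y :=
  FGr_ext (f := f.flip y) (g := g.flip y) (fun n₁ b₁ s hs =>
    FGr_ext (f := f (incl V P n₁ b₁ s)) (g := g (incl V P n₁ b₁ s))
      (fun n₂ b₂ t ht => h n₁ b₁ s n₂ b₂ t hs ht) hy) hx

end Ext

/-! ### Symmetrized contractions -/

/-- Invariance of `t` allows its flag on the edge to be moved freely, and the resulting renumbering
of the legs is absorbed by the sum over permutations. Thus only the flag of the first factor
matters, and moving it by `g` is compensated by letting `g` act on `s`. -/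
theorem avg_termGlue_of_joins {e e' : Fin n₁ ⊕ Fin n₂ ≃ Bool ⊕ Fin n} {p : Fin n₁} {r r' : Fin n₂}
    {g : Equiv.Perm (Fin n₁)} (h : Joins e p r) (h' : Joins e' (g p) r') {s : Term V P n₁ b₁}
    {t : Term V P n₂ b₂} (hs : s ∈ termGr V P n₁ b₁ i) (ht : t ∈ invGr V P n₂ b₂ j) :
    avg V P n b (termGlue B P e' b₁ b₂ b (termAct V P n₁ b₁ g s) t) =
      avg V P n b (termGlue B P e b₁ b₂ b s t) := by
  obtain ⟨f, hf⟩ := h.exists_perm (g₁ := g) (g₂ := Equiv.swap r r') (e' := e')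
    (by rwa [Equiv.swap_apply_left])
  have := termGlue_act (B := B) (P := P) (b := b) hf h.joinsFactors hs ht.1
  rw [ht.2] at this
  rw [this, avg_termAct f (termGlue_mem e hs ht.1)]

/-- If both elements are invariant, any flag of each can be moved to any other, so the symmetrized
contraction does not depend on the gluing at all. -/
theorem avg_termGlue_eq {e e' : Fin n₁ ⊕ Fin n₂ ≃ Bool ⊕ Fin n} (he : JoinsFactors e)
    (he' : JoinsFactors e') {s : Term V P n₁ b₁} {t : Term V P n₂ b₂}
    (hs : s ∈ invGr V P n₁ b₁ i) (ht : t ∈ invGr V P n₂ b₂ j) :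
    avg V P n b (termGlue B P e' b₁ b₂ b s t) = avg V P n b (termGlue B P e b₁ b₂ b s t) := by
  obtain ⟨p, r, h⟩ := he.exists_joins
  obtain ⟨p', r', h'⟩ := he'.exists_joins
  have := avg_termGlue_of_joins (B := B) (b := b) (g := Equiv.swap p p') h
    (by rwa [Equiv.swap_apply_left]) hs.1 ht
  rwa [hs.2] at this

theorem exists_act_termSelfGlue (f f' : Fin m ≃ Bool ⊕ Fin n) {s : Term V P m b}
    (hs : s ∈ invGr V P m b i) : ∃ h : Equiv.Perm (Fin n), termSelfGlue B P f' b b' s =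
      termAct V P n b' h (termSelfGlue B P f b b' s) := by
  obtain ⟨p, r, hf⟩ := exists_loopAt f
  obtain ⟨p', r', hf'⟩ := exists_loopAt f'
  obtain ⟨g, hp, hr⟩ := exists_perm_apply_eq_two hf.ne hf'.ne
  subst hp hr
  obtain ⟨h, H⟩ := hf.exists_perm hf'
  have := termSelfGlue_act (B := B) (P := P) (b' := b') H hs.1
  rw [hs.2] at this
  exact ⟨h, this⟩

theorem termSelfGlue_mem_invGr (f : Fin m ≃ Bool ⊕ Fin n) {s : Term V P m b}
    (hs : s ∈ invGr V P m b i) : termSelfGlue B P f b b' s ∈ invGr V P n b' (i - 1) := by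
  refine ⟨termSelfGlue_mem f hs.1, fun h => ?_⟩
  -- The permutation `g` of all flags fixes the two ends of the loop and acts by `h` on the others.
  have := termSelfGlue_act (B := B) (P := P) (b' := b') (e := f) (e' := f) (h := h)
    (g := (f.trans (Equiv.sumCongr (Equiv.refl _) h)).trans f.symm)
    (by rw [Equiv.trans_assoc, Equiv.symm_trans_self, Equiv.trans_refl]) hs.1
  rw [hs.2] at this
  exact this.symm

/-- Double transitivity moves the loop to any other pair of flags at the cost of a permutation of
the legs, and the contraction is already invariant; unlike for two factors, no symmetrization is
needed. -/
theorem termSelfGlue_eq (f f' : Fin m ≃ Bool ⊕ Fin n) {s : Term V P m b}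
    (hs : s ∈ invGr V P m b i) :
    termSelfGlue B P f' b b' s = termSelfGlue B P f b b' s := by
  obtain ⟨h, H⟩ := exists_act_termSelfGlue (B := B) (b' := b') f f' hs
  rw [H, (termSelfGlue_mem_invGr f hs).2]

theorem avg_termSelfGlue_of_loopAt {e e' : Fin m ≃ Bool ⊕ Fin n} {p r : Fin m}
    {g : Equiv.Perm (Fin m)} (h : LoopAt e p r) (h' : LoopAt e' (g p) (g r)) {s : Term V P m b}
    (hs : s ∈ termGr V P m b i) :
    avg V P n b' (termSelfGlue B P e' b b' (termAct V P m b g s)) =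
      avg V P n b' (termSelfGlue B P e b b' s) := by
  obtain ⟨f, hf⟩ := h.exists_perm h'
  rw [termSelfGlue_act (B := B) (P := P) (b' := b') hf hs, avg_termAct f (termSelfGlue_mem e hs)]

/-! ### The operations on the summands -/

theorem totalD_incl (t : Term V P n b) :
    totalD V P (incl V P n b t) = incl V P n b (termD V P n b t) :=
  DirectSum.toModule_lof (R := k) (φ := fun r : ℕ × ℕ =>
    incl V P r.1 r.2 ∘ₗ termD V P r.1 r.2) (n, b) t

theorem totalLoop_incl_eq_aux (t : Term V P n b) :
    totalLoop B P (incl V P n b t) = totalLoopAux B P n b t :=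
  DirectSum.toModule_lof (R := k) (φ := fun r : ℕ × ℕ => totalLoopAux B P r.1 r.2) (n, b) t

theorem totalPair_incl_incl_eq_aux (s : Term V P n₁ b₁) (t : Term V P n₂ b₂) :
    totalPair B P (incl V P n₁ b₁ s) (incl V P n₂ b₂ t) = totalPairAux B P n₁ b₁ n₂ b₂ s t := by
  have h₁ := DirectSum.toModule_lof (R := k) (φ := fun r₁ : ℕ × ℕ =>
    (DirectSum.toModule k (ℕ × ℕ) (Term V P r₁.1 r₁.2 →ₗ[k] Terms V P) fun r₂ =>
      (totalPairAux B P r₁.1 r₁.2 r₂.1 r₂.2).flip).flip) (n₁, b₁) s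
  have h₂ := DirectSum.toModule_lof (R := k) (φ := fun r₂ : ℕ × ℕ =>
      (totalPairAux B P n₁ b₁ r₂.1 r₂.2).flip) (n₂, b₂) t
  exact (congrArg (fun f => f (incl V P n₂ b₂ t)) h₁).trans (congrArg (fun f => f s) h₂)

theorem totalLoop_incl_of_lt (hn : n < 2) (t : Term V P n b) :
    totalLoop B P (incl V P n b t) = 0 := by
  rw [totalLoop_incl_eq_aux]
  match n, hn with
  | 0, _ => rfl
  | 1, _ => rfl

theorem totalPair_incl_zero_left (t : Term V P 0 b) (x : Terms V P) :
    totalPair B P (incl V P 0 b t) x = 0 := by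
  have : totalPair B P (incl V P 0 b t) = 0 := by
    refine DirectSum.linearMap_ext _ fun r => LinearMap.ext fun s => ?_
    exact (totalPair_incl_incl_eq_aux t s).trans rfl
  rw [this, LinearMap.zero_apply]

theorem totalPair_incl_zero_right (t : Term V P 0 b) (x : Terms V P) :
    totalPair B P x (incl V P 0 b t) = 0 := by
  have : (totalPair B P).flip (incl V P 0 b t) = 0 := by
    refine DirectSum.linearMap_ext _ fun r => LinearMap.ext fun s => ?_
    refine (totalPair_incl_incl_eq_aux s t).trans ?_
    obtain ⟨n, b'⟩ := r
    cases n <;> rfl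
  rw [← LinearMap.flip_apply, this, LinearMap.zero_apply]

theorem totalLoop_incl (f : Fin m ≃ Bool ⊕ Fin n) (hb : b + 1 = b') {t : Term V P m b}
    (ht : t ∈ invGr V P m b i) :
    totalLoop B P (incl V P m b t) = incl V P n b' (termSelfGlue B P f b b' t) := by
  obtain rfl := card_of_loopEquiv f
  subst hb
  rw [totalLoop_incl_eq_aux, totalLoopAux, LinearMap.comp_apply, termLoop_eq]
  exact congrArg _ (termSelfGlue_eq _ _ ht)

/-- The identification `pairFlags` of the definition may be replaced by any other. The factorials
are those of `n₁ - 1` and `n₂ - 1` because here `n₁` and `n₂` include the flags on the edge. -/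
theorem totalPair_incl (e : Fin n₁ ⊕ Fin n₂ ≃ Bool ⊕ Fin n) (he : JoinsFactors e)
    (hb : b₁ + b₂ = b) {s : Term V P n₁ b₁} {t : Term V P n₂ b₂} (hs : s ∈ invGr V P n₁ b₁ i)
    (ht : t ∈ invGr V P n₂ b₂ j) :
    totalPair B P (incl V P n₁ b₁ s) (incl V P n₂ b₂ t) =
      (((n₁ - 1).factorial : k) * ((n₂ - 1).factorial : k))⁻¹ •
        avg V P n b (termGlue B P e b₁ b₂ b s t) := by
  subst hb
  obtain ⟨⟨p, -⟩, r, -⟩ := id he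
  obtain ⟨n₁, rfl⟩ := Nat.exists_eq_succ_of_ne_zero (Fin.pos p).ne'
  obtain ⟨n₂, rfl⟩ := Nat.exists_eq_succ_of_ne_zero (Fin.pos r).ne'
  obtain rfl : n = n₁ + n₂ := by have := card_of_joinEquiv e; omega
  rw [totalPair_incl_incl_eq_aux, ← avg_termGlue_eq he (joinsFactors_pairFlags n₁ n₂) hs ht,
    ← termPair_tmul]
  change incl V P (n₁ + n₂) (b₁ + b₂) (termPairSym B P n₁ n₂ b₁ b₂ (s ⊗ₜ t)) = _
  rw [termPairSym, LinearMap.comp_apply, LinearMap.smul_apply, map_smul]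
  rfl

theorem exists_joinsFactors (h₁ : n₁ ≠ 0) (h₂ : n₂ ≠ 0) :
    ∃ e : Fin n₁ ⊕ Fin n₂ ≃ Bool ⊕ Fin (n₁ + n₂ - 2), JoinsFactors e := by
  obtain ⟨n₁, rfl⟩ := Nat.exists_eq_succ_of_ne_zero h₁
  obtain ⟨n₂, rfl⟩ := Nat.exists_eq_succ_of_ne_zero h₂
  rw [show n₁ + 1 + (n₂ + 1) - 2 = n₁ + n₂ by omega]
  exact ⟨_, joinsFactors_pairFlags n₁ n₂⟩

theorem exists_loopEquiv (h : 2 ≤ m) : Nonempty (Fin m ≃ Bool ⊕ Fin (m - 2)) := by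
  obtain ⟨m, rfl⟩ := Nat.exists_eq_add_of_le' h
  exact ⟨loopFlags m⟩

/-! ### The operations applied to symmetrized elements -/

variable [CharZero k]

/-- Permuting `t` before gluing amounts to choosing the flag of `t` at which it is glued. Each flag
is chosen by `(m - 1)!` permutations, which cancels one of the two factorials in the bracket. -/
theorem totalPair_avg_incl (E : Fin m → (Fin m ⊕ Fin n₃ ≃ Bool ⊕ Fin n))
    (hE : ∀ r, ∃ p, Joins (E r) r p) (hb : c + b₃ = b) {t : Term V P m c}
    {z : Term V P n₃ b₃} (ht : t ∈ termGr V P m c i) (hz : z ∈ invGr V P n₃ b₃ q) :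
    totalPair B P (avg V P m c t) (incl V P n₃ b₃ z) =
      ((n₃ - 1).factorial : k)⁻¹ •
        ∑ r, avg V P n b (termGlue B P (E r) c b₃ b t z) := by
  rcases Nat.eq_zero_or_pos m with rfl | hm
  · rw [avg_apply, totalPair_incl_zero_left, Finset.univ_eq_empty, Finset.sum_empty, smul_zero]
  choose p hp using hE
  let r₀ : Fin m := ⟨0, hm⟩
  -- The sum is reindexed by inverses: gluing the translate of `t` by `g⁻¹` at `r₀` is gluing `t`
  -- itself at `g r₀`.
  rw [avg_apply, totalPair_incl (E r₀) (hp r₀).joinsFactors hb (sum_termAct_mem ht) hz, map_sum,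
    LinearMap.sum_apply, map_sum, ← Equiv.sum_comp (Equiv.inv (Equiv.Perm (Fin m))),
    Finset.sum_congr rfl fun g _ => avg_termGlue_of_joins (g := Equiv.inv _ g) (hp (g r₀))
      (by rw [Equiv.inv_apply, Equiv.Perm.inv_def, Equiv.symm_apply_apply]; exact hp r₀) ht hz,
    sum_perm_apply (k := k) (fun r => avg V P n b (termGlue B P (E r) c b₃ b t z)) r₀, smul_smul,
    mul_inv_rev, mul_assoc, inv_mul_cancel₀ (Nat.cast_ne_zero.2 (Nat.factorial_ne_zero _)), mul_one]

/-- Here a permutation chooses an ordered pair of distinct flags, each pair being chosen `(m - 2)! =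
n!` times. -/
theorem totalLoop_avg (E : Fin m → Fin m → (Fin m ≃ Bool ⊕ Fin n))
    (hE : ∀ p r, p ≠ r → LoopAt (E p r) p r) (hb : b + 1 = b') {t : Term V P m b}
    (ht : t ∈ termGr V P m b i) :
    totalLoop B P (avg V P m b t) = ∑ x ∈ (Finset.univ : Finset (Fin m)).offDiag,
      avg V P n b' (termSelfGlue B P (E x.1 x.2) b b' t) := by
  rcases lt_or_ge m 2 with hm | hm
  · rw [avg_apply, totalLoop_incl_of_lt hm, Finset.sum_eq_zero]
    intro x hx
    rw [Finset.mem_offDiag] at hx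
    exact absurd (Fin.ext (by have := x.1.2; have := x.2.2; omega)) hx.2.2
  let p₀ : Fin m := ⟨0, by omega⟩
  let r₀ : Fin m := ⟨1, by omega⟩
  have h₀ : p₀ ≠ r₀ := by simp [p₀, r₀]
  have hm' := card_of_loopEquiv (E p₀ r₀)
  have hn : (n.factorial : k) ≠ 0 := Nat.cast_ne_zero.2 (Nat.factorial_ne_zero _)
  have hi := termSelfGlue_mem_invGr (B := B) (b' := b') (E p₀ r₀) (sum_termAct_mem ht)
  -- Multiplication by `n!` turns the inclusion of an invariant element into `avg`, to which the
  -- translation lemma applies.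
  refine smul_right_injective _ hn ?_
  change (n.factorial : k) • _ = (n.factorial : k) • _
  rw [avg_apply, totalLoop_incl (E p₀ r₀) hb (sum_termAct_mem ht), ← avg_of_mem_invGr hi, map_sum,
    map_sum, ← Equiv.sum_comp (Equiv.inv (Equiv.Perm (Fin m))),
    Finset.sum_congr rfl fun g _ => avg_termSelfGlue_of_loopAt (g := Equiv.inv _ g)
      (hE (g p₀) (g r₀) (g.injective.ne h₀))
      (by rw [Equiv.inv_apply, Equiv.Perm.inv_def, Equiv.symm_apply_apply, Equiv.symm_apply_apply]
          exact hE _ _ h₀) ht,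
    sum_perm_apply_two (k := k)
      (fun p r => avg V P n b' (termSelfGlue B P (E p r) b b' t)) h₀,
    show m - 2 = n by omega]

end Averages

/-! ## The Jacobi identity -/

section Nested

variable {k : Type u} [Field k] {l : ℤ} {η : ℤˣ} {V : ChainCx.{u, v} k}
  {B : InnerProd V l η} {P : TwistedModularOperad.{u, w} k (l - 1) η}
  {n₁ n₂ n₃ m n b₁ b₂ b₃ c b b' : ℕ} {i j q : ℤ}

variable (B) in
/-- `x` is a symmetrized double contraction of `s`, `t`, `r` in which both edges are attached
to `s`. -/
def IsNest (s : Term V P n₁ b₁) (t : Term V P n₂ b₂) (r : Term V P n₃ b₃) (x : Terms V P) : Prop :=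
  ∃ (m n c b : ℕ) (e' : Fin n₁ ⊕ Fin n₂ ≃ Bool ⊕ Fin m) (e : Fin m ⊕ Fin n₃ ≃ Bool ⊕ Fin n)
    (p p₁ : Fin n₁) (p' : Fin n₂) (a : Fin m) (a' : Fin n₃), b₁ + b₂ = c ∧ c + b₃ = b ∧
    Joins e' p p' ∧ e' (Sum.inl p₁) = Sum.inr a ∧ Joins e a a' ∧
    x = avg V P n b (termGlue B P e c b₃ b (termGlue B P e' b₁ b₂ c s t) r)

theorem ne_of_eq_inr {α β γ : Type} {e : α ⊕ β ≃ Bool ⊕ γ} {p p₁ : α} {p' : β} {a : γ}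
    (h : Joins e p p') (h₁ : e (Sum.inl p₁) = Sum.inr a) : p ≠ p₁ := by
  rintro rfl
  exact Sum.inl_ne_inr (h.1.symm.trans h₁)

/-- Double transitivity moves the two flags of `s` on the edges to any other two. The choices on `t`
and `r` are irrelevant by invariance, and the numbering of the legs is absorbed by the
symmetrization. -/
theorem IsNest.unique {s : Term V P n₁ b₁} {t : Term V P n₂ b₂} {r : Term V P n₃ b₃}
    {x y : Terms V P} (hs : s ∈ invGr V P n₁ b₁ i) (ht : t ∈ invGr V P n₂ b₂ j)
    (hr : r ∈ invGr V P n₃ b₃ q) (hx : IsNest B s t r x) (hy : IsNest B s t r y) : x = y := by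
  obtain ⟨m, n, c, b, e', e, p, p₁, p', a, a', rfl, rfl, he', ha, he, rfl⟩ := hx
  obtain ⟨m', n', c, b, f', f, o, o₁, o', d, d', rfl, rfl, hf', hd, hf, rfl⟩ := hy
  obtain rfl : m = m' := by
    have := card_of_joinEquiv e'; have := card_of_joinEquiv f'; omega
  obtain rfl : n = n' := by
    have := card_of_joinEquiv e; have := card_of_joinEquiv f; omega
  obtain ⟨g, ho, ho₁⟩ := exists_perm_apply_eq_two (ne_of_eq_inr he' ha) (ne_of_eq_inr hf' hd)
  subst ho ho₁
  obtain ⟨h, H⟩ := he'.exists_perm (g₁ := g) (g₂ := Equiv.swap p' o') (e' := f')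
    (by rwa [Equiv.swap_apply_left])
  -- The intermediate leg which comes from `p₁` has to be followed, since the second edge is
  -- attached there.
  have hda : h a = d := by
    have := Equiv.congr_fun H (Sum.inl p₁)
    simp only [Equiv.trans_apply, Equiv.sumCongr_apply, Sum.map_inl, ha, hd, Sum.map_inr] at this
    exact (Sum.inr_injective this).symm
  have h₁ := termGlue_act (B := B) (P := P) (b := b₁ + b₂) H he'.joinsFactors hs.1 ht.1
  rw [hs.2, ht.2] at h₁
  subst hda
  rw [h₁, avg_termGlue_of_joins he hf (termGlue_mem _ hs.1 ht.1) hr]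

/-- The same tree, glued in the other order: first `r` to `s`, then `t` to the result. The sign is
that of `termGlue_termGlue`. -/
theorem IsNest.swap {s : Term V P n₁ b₁} {t : Term V P n₂ b₂} {r : Term V P n₃ b₃} {x : Terms V P}
    (hs : s ∈ invGr V P n₁ b₁ i) (ht : t ∈ invGr V P n₂ b₂ j) (hr : r ∈ invGr V P n₃ b₃ q)
    (hx : IsNest B s t r x) : IsNest B s r t ((1 + j * q).negOnePow • x) := by
  obtain ⟨m, n, c, b, e', e, p, p₁, p', a, a', hc, hb, he', ha, he, rfl⟩ := hx
  obtain ⟨f₀, hf₀⟩ := exists_joinsFactors (Fin.pos p₁).ne' (Fin.pos a').ne'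
  obtain ⟨o, o', ho⟩ := hf₀.exists_joins
  let f' := (Equiv.sumCongr (Equiv.swap p₁ o) (Equiv.swap a' o')).trans f₀
  have hf' : Joins f' p₁ a' := Joins.sumCongr_trans (by simpa using ho)
  -- `N` is the double gluing with the factors and the edges exchanged. The first gluing `f'` is any
  -- one which joins `p₁` to `a'`; the second one `f` is then determined by `N`.
  let N := (swapLastSum _ _ _).symm.trans ((nestFlags e' e).trans (swapEdges (Fin n)))
  have hN : ∀ y, N (swapLastSum _ _ _ y) = swapEdges _ (nestFlags e' e y) := fun y => by
    simp only [N, Equiv.trans_apply, Equiv.symm_apply_apply]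
  have hp : N (Sum.inl (Sum.inl p)) = Sum.inr (Sum.inl false) := by
    refine (hN (Sum.inl (Sum.inl p))).trans ?_
    simp [nestFlags, he'.1, swapEdges]
  have hp' : N (Sum.inr p') = Sum.inr (Sum.inl true) := by
    refine (hN (Sum.inl (Sum.inr p'))).trans ?_
    simp [nestFlags, he'.2, swapEdges]
  have hp₁ : N (Sum.inl (Sum.inl p₁)) = Sum.inl false := by
    refine (hN (Sum.inl (Sum.inl p₁))).trans ?_
    simp [nestFlags, ha, he.1, swapEdges]
  have ha' : N (Sum.inl (Sum.inr a')) = Sum.inl true := by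
    refine (hN (Sum.inr a')).trans ?_
    simp [nestFlags, he.2, swapEdges]
  obtain ⟨f, hf⟩ := exists_trans_sumCongr
    ((Equiv.sumCongr f' (Equiv.refl (Fin n₂))).trans (Equiv.sumAssoc _ _ _)) N (by
      rintro (_ | _)
      · rw [← hp₁, Equiv.symm_apply_apply, Equiv.symm_apply_eq]
        simp [hf'.1]
      · rw [← ha', Equiv.symm_apply_apply, Equiv.symm_apply_eq]
        simp [hf'.2])
  obtain ⟨d, hd⟩ : ∃ d, f' (Sum.inl p) = Sum.inr d := by
    cases h : f' (Sum.inl p) with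
    | inr d => exact ⟨d, rfl⟩
    | inl z =>
      cases z
      · exact absurd (Sum.inl_injective (f'.injective (h.trans hf'.1.symm)))
          (ne_of_eq_inr he' ha)
      · exact absurd (f'.injective (h.trans hf'.2.symm)) Sum.inl_ne_inr
  have hfd : Joins f d p' := by
    constructor
    · have := (Equiv.congr_fun hf (Sum.inl (Sum.inl p))).symm.trans hp
      simpa [hd] using this
    · have := (Equiv.congr_fun hf (Sum.inr p')).symm.trans hp'
      simpa using this
  have H : (swapLastSum _ _ _).trans (nestFlags f' f) =
      (nestFlags e' e).trans (swapEdges (Fin n)) := by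
    have : nestFlags f' f = N := hf.symm
    rw [this, ← Equiv.trans_assoc, Equiv.self_trans_symm, Equiv.refl_trans]
  refine ⟨_, n, _, b, f', f, p₁, p, a', d, p', rfl, by omega, hf', hd, hfd, ?_⟩
  rw [termGlue_termGlue H he'.joinsFactors he.joinsFactors hf'.joinsFactors hfd.joinsFactors hc rfl
    hb hs.1 ht.1 hr.1, avg_intUnits_smul]

open Classical in
variable (B) in
/-- The symmetrized double contraction in which both edges are attached to `s`. -/
def nest (s : Term V P n₁ b₁) (t : Term V P n₂ b₂) (r : Term V P n₃ b₃) : Terms V P :=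
  -- The value zero occurs for instance if `s` has only one flag; then the coefficient `n₁ - 1` in
  -- `totalPair_totalPair_incl` is zero too.
  if h : ∃ x, IsNest B s t r x then h.choose else 0

theorem IsNest.nest_eq {s : Term V P n₁ b₁} {t : Term V P n₂ b₂} {r : Term V P n₃ b₃}
    {x : Terms V P} (hs : s ∈ invGr V P n₁ b₁ i) (ht : t ∈ invGr V P n₂ b₂ j)
    (hr : r ∈ invGr V P n₃ b₃ q) (hx : IsNest B s t r x) : nest B s t r = x := by
  have h : ∃ x, IsNest B s t r x := ⟨x, hx⟩
  rw [nest, dif_pos h]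
  exact h.choose_spec.unique hs ht hr hx

theorem nest_swap {s : Term V P n₁ b₁} {t : Term V P n₂ b₂} {r : Term V P n₃ b₃}
    (hs : s ∈ invGr V P n₁ b₁ i) (ht : t ∈ invGr V P n₂ b₂ j) (hr : r ∈ invGr V P n₃ b₃ q) :
    nest B s r t = (1 + j * q).negOnePow • nest B s t r := by
  by_cases h : ∃ x, IsNest B s t r x
  · obtain ⟨x, hx⟩ := h
    rw [hx.nest_eq hs ht hr, (hx.swap hs ht hr).nest_eq hs hr ht]
  · have h' : ¬ ∃ x, IsNest B s r t x := fun ⟨x, hx⟩ => h ⟨_, hx.swap hs hr ht⟩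
    rw [nest, nest, dif_neg h, dif_neg h', intUnits_smul_zero]

variable [CharZero k]

/-- The leg which is joined to `r` comes either from `s`, in `n₁ - 1` cases, or from `t`, in `n₂ -
1` cases. In the second case `s` and `t` are exchanged, so that both edges are attached to the first
argument. -/
theorem totalPair_totalPair_incl (h₁ : n₁ ≠ 0) (h₂ : n₂ ≠ 0) (h₃ : n₃ ≠ 0)
    {s : Term V P n₁ b₁} {t : Term V P n₂ b₂} {r : Term V P n₃ b₃}
    (hs : s ∈ invGr V P n₁ b₁ i) (ht : t ∈ invGr V P n₂ b₂ j) (hr : r ∈ invGr V P n₃ b₃ q) :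
    totalPair B P (totalPair B P (incl V P n₁ b₁ s) (incl V P n₂ b₂ t)) (incl V P n₃ b₃ r) =
      (((n₁ - 1).factorial : k) * ((n₂ - 1).factorial : k) * ((n₃ - 1).factorial : k))⁻¹ •
        (((n₁ - 1 : ℕ) : k) • nest B s t r +
          ((n₂ - 1 : ℕ) : k) • (i * j).negOnePow • nest B t s r) := by
  classical
  obtain ⟨e, he⟩ := exists_joinsFactors h₁ h₂
  have hE : ∀ a : Fin (n₁ + n₂ - 2), ∃ f : Fin (n₁ + n₂ - 2) ⊕ Fin n₃ ≃
      Bool ⊕ Fin (n₁ + n₂ - 2 + n₃ - 2), ∃ a', Joins f a a' := fun a => by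
    obtain ⟨f, hf⟩ := exists_joinsFactors (Fin.pos a).ne' h₃
    exact hf.exists_joins_left a
  choose E hE using hE
  have hm := termGlue_mem (B := B) (b := b₁ + b₂) e hs.1 ht.1
  have hval : ∀ a, avg V P _ (b₁ + b₂ + b₃) (termGlue B P (E a) (b₁ + b₂) b₃ (b₁ + b₂ + b₃)
      (termGlue B P e b₁ b₂ (b₁ + b₂) s t) r) =
        if FromLeft e a then nest B s t r else (i * j).negOnePow • nest B t s r := fun a => by
    obtain ⟨a', ha'⟩ := hE a
    split_ifs with ha
    · obtain ⟨p₁, hp₁⟩ := ha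
      obtain ⟨p, p', hp⟩ := he.exists_joins
      exact (IsNest.nest_eq hs ht hr
        ⟨_, _, _, _, e, E a, p, p₁, p', a, a', rfl, rfl, hp, hp₁, ha', rfl⟩).symm
    · obtain ⟨p₁, hp₁⟩ := (fromLeft_or e a).resolve_left ha
      obtain ⟨p, p', hp⟩ := he.exists_joins
      have hc := termGlue_sumComm (B := B) (P := P) (b₁ := b₂) (b₂ := b₁) (b := b₁ + b₂) he ht.1 hs.1
      have := IsNest.nest_eq (B := B) ht hs hr
        ⟨_, _, b₁ + b₂, _, _, E a, p', p₁, p, a, a', add_comm _ _, rfl, hp.sumComm, hp₁, ha', rfl⟩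
      rw [this, hc, LinearMap.map_intUnits_smul₂, avg_intUnits_smul, intUnits_mul_smul,
        mul_comm j i, Int.units_mul_self, intUnits_one_smul]
  rw [totalPair_incl e he rfl hs ht, map_smul, LinearMap.smul_apply,
    totalPair_avg_incl E hE rfl hm hr, smul_smul, ← mul_inv, Finset.sum_congr rfl fun a _ => hval a,
    Finset.sum_ite, Finset.sum_const, Finset.sum_const, card_fromLeft he,
    ← Nat.cast_smul_eq_nsmul k, ← Nat.cast_smul_eq_nsmul k]
  have hcard : (Finset.univ.filter fun a => ¬ FromLeft e a).card = n₂ - 1 := by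
    have := Finset.card_filter_add_card_filter_not (s := Finset.univ) (FromLeft e)
    rw [card_fromLeft he, Finset.card_univ, Fintype.card_fin] at this
    omega
  rw [hcard]

/-- Expansion gives six nests, two for every choice of the middle element. The two have equal
coefficients up to sign, and `nest_swap` shows that they cancel. -/
theorem totalPair_jacobi {x y z : Terms V P} (hx : x ∈ FGr V P i) (hy : y ∈ FGr V P j)
    (hz : z ∈ FGr V P q) :
    totalPair B P (totalPair B P x y) z +
      (j * q).negOnePow • totalPair B P (totalPair B P x z) y +
      (i * j + i * q).negOnePow • totalPair B P (totalPair B P y z) x = 0 := by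
  rw [intUnits_smul_eq_cast_smul (k := k), intUnits_smul_eq_cast_smul (k := k)]
  set C := totalPair B P with hC
  set ε := (((j * q).negOnePow : ℤ) : k)
  set ε' := (((i * j + i * q).negOnePow : ℤ) : k)
  refine FGr_ext (f := C.flip z ∘ₗ C.flip y + ε • C.flip y ∘ₗ C.flip z + ε' • C (C y z)) (g := 0)
    (fun n₁ b₁ s hs => ?_) hx
  refine FGr_ext (f := C.flip z ∘ₗ C (incl V P n₁ b₁ s) + ε • C (C (incl V P n₁ b₁ s) z) +
    ε' • C.flip (incl V P n₁ b₁ s) ∘ₗ C.flip z) (g := 0) (fun n₂ b₂ t ht => ?_) hy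
  refine FGr_ext (f := C (C (incl V P n₁ b₁ s) (incl V P n₂ b₂ t)) +
    ε • C.flip (incl V P n₂ b₂ t) ∘ₗ C (incl V P n₁ b₁ s) +
    ε' • C.flip (incl V P n₁ b₁ s) ∘ₗ C (incl V P n₂ b₂ t)) (g := 0) (fun n₃ b₃ r hr => ?_) hz
  change C (C (incl V P n₁ b₁ s) (incl V P n₂ b₂ t)) (incl V P n₃ b₃ r) +
    ε • C (C (incl V P n₁ b₁ s) (incl V P n₃ b₃ r)) (incl V P n₂ b₂ t) +
    ε' • C (C (incl V P n₂ b₂ t) (incl V P n₃ b₃ r)) (incl V P n₁ b₁ s) = 0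
  rcases eq_or_ne n₁ 0 with rfl | h₁
  · simp only [hC, totalPair_incl_zero_left, totalPair_incl_zero_right, map_zero,
      LinearMap.zero_apply, smul_zero, add_zero]
  rcases eq_or_ne n₂ 0 with rfl | h₂
  · simp only [hC, totalPair_incl_zero_left, totalPair_incl_zero_right, map_zero,
      LinearMap.zero_apply, smul_zero, add_zero]
  rcases eq_or_ne n₃ 0 with rfl | h₃
  · simp only [hC, totalPair_incl_zero_right, map_zero, LinearMap.zero_apply, smul_zero, add_zero]
  rw [totalPair_totalPair_incl h₁ h₂ h₃ hs ht hr, totalPair_totalPair_incl h₁ h₃ h₂ hs hr ht,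
    totalPair_totalPair_incl h₂ h₃ h₁ ht hr hs, nest_swap hs ht hr, nest_swap ht hs hr,
    nest_swap hr hs ht]
  simp only [ε, ε', intUnits_smul_eq_cast_smul (k := k), Int.negOnePow_add, Units.val_mul,
    Int.cast_mul, Int.negOnePow_one, Units.val_neg, Units.val_one, Int.cast_neg, Int.cast_one]
  have hsq : ∀ a : ℤ, ((a.negOnePow : ℤ) : k) ^ 2 = 1 := fun a => by
    rw [sq, ← Int.cast_mul, ← Units.val_mul, Int.units_mul_self, Units.val_one, Int.cast_one]
  have h₁₂ := hsq (i * j)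
  have h₁₃ := hsq (i * q)
  have h₂₃ := hsq (j * q)
  -- From here on the three signs are just scalars with square one, and the cancellation is an
  -- identity of polynomials in them.
  generalize (((i * j).negOnePow : ℤ) : k) = u at *
  generalize (((i * q).negOnePow : ℤ) : k) = v at *
  generalize (((j * q).negOnePow : ℤ) : k) = w at *
  rw [mul_right_comm _ (((n₃ - 1).factorial : k)), ← mul_rotate (((n₁ - 1).factorial : k))]
  match_scalars
  all_goals
    ring_nf
    simp only [h₁₂, h₁₃, h₂₃, mul_one, sub_self]

end Nested

/-! ## The identities between the operations on `F` -/

section Identities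

variable {k : Type u} [Field k] {l : ℤ} {η : ℤˣ} {V : ChainCx.{u, v} k}
  {B : InnerProd V l η} {P : TwistedModularOperad.{u, w} k (l - 1) η}
  {n₁ n₂ n₃ m n b₁ b₂ b₃ c b b' : ℕ} {i j q : ℤ} {x y : Terms V P}

theorem termD_mem_invGr {t : Term V P n b} (ht : t ∈ invGr V P n b i) :
    termD V P n b t ∈ invGr V P n b (i - 1) :=
  ⟨termD_mem ht.1, fun g => by rw [termAct_termD g ht.1, ht.2]⟩

theorem totalD_avg {t : Term V P n b} (ht : t ∈ termGr V P n b i) :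
    totalD V P (avg V P n b t) = avg V P n b (termD V P n b t) := by
  rw [avg_apply, avg_apply, totalD_incl, map_sum]
  exact congrArg _ (Finset.sum_congr rfl fun g _ => (termAct_termD g ht).symm)

theorem totalD_mem (hx : x ∈ FGr V P i) : totalD V P x ∈ FGr V P (i - 1) :=
  FGr_le (S := (FGr V P (i - 1)).comap (totalD V P))
    (fun n b t ht => by
      rw [Submodule.mem_comap, totalD_incl]
      exact incl_mem_FGr (termD_mem_invGr ht)) hx

theorem totalLoop_mem (hx : x ∈ FGr V P i) : totalLoop B P x ∈ FGr V P (i - 1) :=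
  FGr_le (S := (FGr V P (i - 1)).comap (totalLoop B P))
    (fun n b t ht => by
      rw [Submodule.mem_comap]
      rcases lt_or_ge n 2 with hn | hn
      · rw [totalLoop_incl_of_lt hn]
        exact zero_mem _
      · obtain ⟨f⟩ := exists_loopEquiv hn
        rw [totalLoop_incl f rfl ht]
        exact incl_mem_FGr (termSelfGlue_mem_invGr f ht)) hx

theorem totalPair_mem (hx : x ∈ FGr V P i) (hy : y ∈ FGr V P j) :
    totalPair B P x y ∈ FGr V P (i + j - 1) := by
  refine FGr_le (S := (FGr V P (i + j - 1)).comap ((totalPair B P).flip y))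
    (fun n₁ b₁ s hs => ?_) hx
  refine FGr_le (S := (FGr V P (i + j - 1)).comap (totalPair B P (incl V P n₁ b₁ s)))
    (fun n₂ b₂ t ht => ?_) hy
  rw [Submodule.mem_comap]
  rcases eq_or_ne n₁ 0 with rfl | h₁
  · rw [totalPair_incl_zero_left]; exact zero_mem _
  rcases eq_or_ne n₂ 0 with rfl | h₂
  · rw [totalPair_incl_zero_right]; exact zero_mem _
  obtain ⟨e, he⟩ := exists_joinsFactors h₁ h₂
  rw [totalPair_incl e he rfl hs ht]
  exact Submodule.smul_mem _ _ (avg_mem_FGr (termGlue_mem e hs.1 ht.1))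

theorem totalPair_symm (hx : x ∈ FGr V P i) (hy : y ∈ FGr V P j) :
    totalPair B P x y = (i * j).negOnePow • totalPair B P y x := by
  rw [intUnits_smul_eq_cast_smul (k := k)]
  refine FGr_ext₂ (f := totalPair B P)
    (g := (((i * j).negOnePow : ℤ) : k) • (totalPair B P).flip)
    (fun n₁ b₁ s n₂ b₂ t hs ht => ?_) hx hy
  rw [LinearMap.smul_apply, LinearMap.smul_apply, LinearMap.flip_apply]
  rcases eq_or_ne n₁ 0 with rfl | h₁
  · rw [totalPair_incl_zero_left, totalPair_incl_zero_right, smul_zero]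
  rcases eq_or_ne n₂ 0 with rfl | h₂
  · rw [totalPair_incl_zero_left, totalPair_incl_zero_right, smul_zero]
  obtain ⟨e, he⟩ := exists_joinsFactors h₂ h₁
  obtain ⟨p, p', hp⟩ := he.exists_joins
  rw [totalPair_incl _ hp.sumComm.joinsFactors (add_comm b₁ b₂) hs ht,
    totalPair_incl e he rfl ht hs, termGlue_sumComm he hs.1 ht.1, avg_intUnits_smul,
    intUnits_smul_eq_cast_smul (k := k), smul_comm,
    mul_comm ((n₁ - 1).factorial : k)]

theorem totalD_totalPair (hx : x ∈ FGr V P i) (hy : y ∈ FGr V P j) :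
    totalD V P (totalPair B P x y) = -totalPair B P (totalD V P x) y -
      i.negOnePow • totalPair B P x (totalD V P y) := by
  refine (FGr_ext₂ (f := (totalPair B P).compr₂ (totalD V P))
    (g := (-1 : k) • (totalPair B P) ∘ₗ (totalD V P) +
      (-1 : k) • ((i.negOnePow : ℤ) : k) • (totalPair B P).compl₂ (totalD V P))
    (fun n₁ b₁ s n₂ b₂ t hs ht => ?_) hx hy).trans (by
      rw [intUnits_smul_eq_cast_smul (k := k)]
      change (-1 : k) • totalPair B P (totalD V P x) y +
        (-1 : k) • ((i.negOnePow : ℤ) : k) • totalPair B P x (totalD V P y) = _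
      module)
  change totalD V P (totalPair B P (incl V P n₁ b₁ s) (incl V P n₂ b₂ t)) =
    (-1 : k) • totalPair B P (totalD V P (incl V P n₁ b₁ s)) (incl V P n₂ b₂ t) +
    (-1 : k) • ((i.negOnePow : ℤ) : k) •
      totalPair B P (incl V P n₁ b₁ s) (totalD V P (incl V P n₂ b₂ t))
  rw [totalD_incl, totalD_incl]
  rcases eq_or_ne n₁ 0 with rfl | h₁
  · simp only [totalPair_incl_zero_left, map_zero, smul_zero, add_zero]
  rcases eq_or_ne n₂ 0 with rfl | h₂
  · simp only [totalPair_incl_zero_right, map_zero, smul_zero, add_zero]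
  obtain ⟨e, he⟩ := exists_joinsFactors h₁ h₂
  rw [totalPair_incl e he rfl hs ht, totalPair_incl e he rfl (termD_mem_invGr hs) ht,
    totalPair_incl e he rfl hs (termD_mem_invGr ht), map_smul,
    totalD_avg (termGlue_mem e hs.1 ht.1), termD_termGlue e hs.1 ht.1, map_add, map_neg, map_neg,
    avg_intUnits_smul, intUnits_smul_eq_cast_smul (k := k)]
  module

theorem totalD_totalLoop (hx : x ∈ FGr V P i) :
    totalD V P (totalLoop B P x) = -totalLoop B P (totalD V P x) := by
  rw [← neg_one_smul k]
  refine FGr_ext (f := totalD V P ∘ₗ totalLoop B P)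
    (g := (-1 : k) • (totalLoop B P ∘ₗ totalD V P)) (fun n b t ht => ?_) hx
  change totalD V P (totalLoop B P (incl V P n b t)) =
    (-1 : k) • totalLoop B P (totalD V P (incl V P n b t))
  rw [totalD_incl]
  rcases lt_or_ge n 2 with hn | hn
  · rw [totalLoop_incl_of_lt hn, totalLoop_incl_of_lt hn, map_zero, smul_zero]
  · obtain ⟨f⟩ := exists_loopEquiv hn
    rw [totalLoop_incl f rfl ht, totalLoop_incl f rfl (termD_mem_invGr ht), totalD_incl,
      termD_termSelfGlue f ht.1, map_neg]
    exact (neg_one_smul k (_ : Terms V P)).symm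

/-! ### Loops on an edge -/

theorem eq_inr_of_loopAt {α γ : Type} {e : α ≃ Bool ⊕ γ} {p p' a : α}
    (h : LoopAt e p p') (hp : p ≠ a) (hp' : p' ≠ a) : ∃ d, e a = Sum.inr d := by
  cases h₁ : e a with
  | inr d => exact ⟨d, rfl⟩
  | inl z =>
    cases z
    · exact absurd (e.injective (h.1.trans h₁.symm)) hp
    · exact absurd (e.injective (h.2.trans h₁.symm)) hp'

/-- Both ends of the loop lie on `s`, so the loop may be contracted before the edge, at the cost of
the sign `-1`. The factorials undo the normalization of the bracket; the first is `(n₁ - 3)!`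
because the loop removes two flags of `s` and the edge a third. -/
theorem avg_termSelfGlue_termGlue_left {e : Fin n₁ ⊕ Fin n₂ ≃ Bool ⊕ Fin m}
    {e' : Fin m ≃ Bool ⊕ Fin n} {p r r' : Fin n₁} {p' : Fin n₂} {a a' : Fin m}
    (he : Joins e p p') (hr : e (Sum.inl r) = Sum.inr a) (hr' : e (Sum.inl r') = Sum.inr a')
    (he' : LoopAt e' a a') (hc : b₁ + b₂ = c) (hb : c + 1 = b) {s : Term V P n₁ b₁}
    {t : Term V P n₂ b₂} (hs : s ∈ invGr V P n₁ b₁ i) (ht : t ∈ invGr V P n₂ b₂ j) [CharZero k] :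
    avg V P n b (termSelfGlue B P e' c b (termGlue B P e b₁ b₂ c s t)) =
      -((((n₁ - 3).factorial : k) * ((n₂ - 1).factorial : k)) •
        totalPair B P (totalLoop B P (incl V P n₁ b₁ s)) (incl V P n₂ b₂ t)) := by
  have hrr : r ≠ r' := by
    rintro rfl
    exact he'.ne (Sum.inr_injective (hr.symm.trans hr'))
  have hn₁ : 2 ≤ n₁ := by
    by_contra h
    exact hrr (Fin.ext (by have := r.2; have := r'.2; omega))
  obtain ⟨f₀⟩ := exists_loopEquiv hn₁
  obtain ⟨f', hf'⟩ := exists_loopAt_of_ne f₀ hrr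
  let N := (thenLoopFlags e e').trans (swapEdges (Fin n))
  have h₁ : N (Sum.inl p) = Sum.inr (Sum.inl false) := by
    simp [N, thenLoopFlags, he.1, swapEdges]
  have h₂ : N (Sum.inr p') = Sum.inr (Sum.inl true) := by
    simp [N, thenLoopFlags, he.2, swapEdges]
  have h₃ : N (Sum.inl r) = Sum.inl false := by
    simp [N, thenLoopFlags, hr, he'.1, swapEdges]
  have h₄ : N (Sum.inl r') = Sum.inl true := by
    simp [N, thenLoopFlags, hr', he'.2, swapEdges]
  obtain ⟨f, hf⟩ := exists_trans_sumCongr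
    ((Equiv.sumCongr f' (Equiv.refl (Fin n₂))).trans (Equiv.sumAssoc _ _ _)) N (by
      rintro (_ | _)
      · rw [← h₃, Equiv.symm_apply_apply, Equiv.symm_apply_eq]
        simp [hf'.1]
      · rw [← h₄, Equiv.symm_apply_apply, Equiv.symm_apply_eq]
        simp [hf'.2])
  obtain ⟨d, hd⟩ := eq_inr_of_loopAt hf' (ne_of_eq_inr he hr).symm (ne_of_eq_inr he hr').symm
  have hfd : Joins f d p' := by
    constructor
    · have := (Equiv.congr_fun hf (Sum.inl p)).symm.trans h₁
      simpa [hd] using this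
    · have := (Equiv.congr_fun hf (Sum.inr p')).symm.trans h₂
      simpa using this
  have H : loopThenFlags f' f = (thenLoopFlags e e').trans (swapEdges (Fin n)) := hf.symm
  have hne : ((n₁ - 3).factorial : k) * ((n₂ - 1).factorial : k) ≠ 0 :=
    mul_ne_zero (Nat.cast_ne_zero.2 (Nat.factorial_ne_zero _))
      (Nat.cast_ne_zero.2 (Nat.factorial_ne_zero _))
  rw [totalLoop_incl f' rfl hs, totalPair_incl f hfd.joinsFactors (b := b) (by omega)
    (termSelfGlue_mem_invGr f' hs) ht, termGlue_termSelfGlue H he.joinsFactors hfd.joinsFactors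
    hc hb rfl hs.1 ht.1, Nat.sub_sub, smul_inv_smul₀ hne, map_neg]
  exact (neg_neg (_ : Terms V P)).symm

theorem eq_zero_of_eq_neg {k M : Type*} [Field k] [CharZero k] [AddCommGroup M] [Module k M] {x : M}
    (h : x = -x) : x = 0 := by
  have h₂ : (2 : k) • x = 0 := by
    rw [two_smul]
    nth_rewrite 1 [h]
    exact neg_add_cancel x
  exact (smul_eq_zero.1 h₂).resolve_left two_ne_zero

/-- The loop and the edge form a double edge between `s` and `t`. Contracting its edges in the other
order changes the sign, while transpositions of flags, which fix the invariant elements `s` and `t`,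
exchange the two edges. So the symmetrized contraction equals its negative. -/
theorem avg_termSelfGlue_termGlue_mixed {e : Fin n₁ ⊕ Fin n₂ ≃ Bool ⊕ Fin m}
    {e' : Fin m ≃ Bool ⊕ Fin n} {r : Fin n₁} {r' : Fin n₂} {a a' : Fin m}
    (hj : JoinsFactors e) (hr : e (Sum.inl r) = Sum.inr a) (hr' : e (Sum.inr r') = Sum.inr a')
    (he' : LoopAt e' a a') (hc : b₁ + b₂ = c) (hb : c + 1 = b) {s : Term V P n₁ b₁}
    {t : Term V P n₂ b₂} (hs : s ∈ invGr V P n₁ b₁ i) (ht : t ∈ invGr V P n₂ b₂ j) [CharZero k] :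
    avg V P n b (termSelfGlue B P e' c b (termGlue B P e b₁ b₂ c s t)) = 0 := by
  obtain ⟨p, p', he⟩ := hj.exists_joins
  -- `f` glues the pair `r`, `r'` first and puts `p`, `p'` at the positions `a`, `a'`, where `e` has
  -- `r`, `r'`.
  let f := (Equiv.sumCongr (Equiv.swap r p) (Equiv.swap r' p')).trans e
  have hf : Joins f r r' := Joins.sumCongr_trans (by simpa using he)
  let N := (thenLoopFlags e e').trans (swapEdges (Fin n))
  have h₁ : N (Sum.inl p) = Sum.inr (Sum.inl false) := by
    simp [N, thenLoopFlags, he.1, swapEdges]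
  have h₂ : N (Sum.inr p') = Sum.inr (Sum.inl true) := by
    simp [N, thenLoopFlags, he.2, swapEdges]
  have h₃ : N (Sum.inl r) = Sum.inl false := by
    simp [N, thenLoopFlags, hr, he'.1, swapEdges]
  have h₄ : N (Sum.inr r') = Sum.inl true := by
    simp [N, thenLoopFlags, hr', he'.2, swapEdges]
  obtain ⟨f', hf'⟩ := exists_trans_sumCongr f N (by
      rintro (_ | _)
      · rw [← h₃, Equiv.symm_apply_apply, Equiv.symm_apply_eq, hf.1]
      · rw [← h₄, Equiv.symm_apply_apply, Equiv.symm_apply_eq, hf.2])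
  have hfp : f (Sum.inl p) = Sum.inr a := by simp [f, hr]
  have hfp' : f (Sum.inr p') = Sum.inr a' := by simp [f, hr']
  have hl : LoopAt f' a a' := by
    constructor
    · have := (Equiv.congr_fun hf' (Sum.inl p)).symm.trans h₁
      simpa [hfp] using this
    · have := (Equiv.congr_fun hf' (Sum.inr p')).symm.trans h₂
      simpa [hfp'] using this
  have H : thenLoopFlags f f' = (thenLoopFlags e e').trans (swapEdges (Fin n)) := hf'.symm
  have hg := termGlue_act (B := B) (P := P) (b := c) (e := f) (e' := e) (g₁ := Equiv.swap r p)
    (g₂ := Equiv.swap r' p') (h := Equiv.refl _)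
    (by rw [Equiv.sumCongr_refl, Equiv.trans_refl]) hf.joinsFactors hs.1 ht.1
  rw [hs.2, ht.2] at hg
  have hm := termGlue_mem (B := B) (b := c) f hs.1 ht.1
  have h := termSelfGlue_termGlue (B := B) (P := P) H hj hf.joinsFactors hc hb hs.1 ht.1
  refine eq_zero_of_eq_neg (k := k) ?_
  rw [← map_neg, ← h, hg]
  exact avg_termSelfGlue_of_loopAt (g := Equiv.refl _) hl he' hm

theorem totalPair_totalLoop_incl_of_lt (hn : n₁ < 3) {s : Term V P n₁ b₁}
    (hs : s ∈ invGr V P n₁ b₁ i) (y : Terms V P) :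
    totalPair B P (totalLoop B P (incl V P n₁ b₁ s)) y = 0 := by
  rcases lt_or_ge n₁ 2 with h | h
  · rw [totalLoop_incl_of_lt h, map_zero, LinearMap.zero_apply]
  · obtain rfl : n₁ = 2 := by omega
    obtain ⟨f⟩ := exists_loopEquiv h
    rw [totalLoop_incl f rfl hs]
    exact totalPair_incl_zero_left _ _

/-- There are `(n₁ - 1) * (n₁ - 2)` ordered pairs of distinct remaining flags of `s`, and their
number times `(n₁ - 3)!` is `(n₁ - 1)!`. With truncated subtraction this fails for `n₁ < 3`, where
instead the bracket vanishes. -/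
theorem factorial_smul_totalPair_totalLoop {s : Term V P n₁ b₁} (hs : s ∈ invGr V P n₁ b₁ i)
    (y : Terms V P) :
    (((n₁ - 1) * (n₁ - 1) - (n₁ - 1) : ℕ) : k) • ((n₁ - 3).factorial : k) •
        totalPair B P (totalLoop B P (incl V P n₁ b₁ s)) y =
      ((n₁ - 1).factorial : k) • totalPair B P (totalLoop B P (incl V P n₁ b₁ s)) y := by
  rcases lt_or_ge n₁ 3 with h | h
  · rw [totalPair_totalLoop_incl_of_lt h hs, smul_zero, smul_zero, smul_zero]
  · obtain ⟨n, rfl⟩ := Nat.exists_eq_add_of_le' h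
    rw [smul_smul, ← Nat.cast_mul]
    congr 2
    rw [show n + 3 - 1 = n + 2 by omega, Nat.add_sub_cancel, ← Nat.mul_sub_one,
      show (n + 2).factorial = (n + 2) * ((n + 1) * n.factorial) from rfl, ← mul_assoc]
    rfl

theorem eq_neg_smul_of_smul_eq_neg {k M : Type*} [Field k] [AddCommGroup M] [Module k M] {ε : k}
    {x y : M} (hε : ε * ε = 1) (h : ε • x = -y) : x = -(ε • y) := by
  rw [← smul_neg, ← h, smul_smul, hε, one_smul]

theorem smul_neg_add_smul_neg_eq {k M : Type*} [Field k] [AddCommGroup M] [Module k M]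
    {α β γ α' β' γ' : k} {x y : M} (ε : k) (hx : α • β • x = γ • x) (hy : α' • β' • y = γ' • y) :
    α • -((β * γ') • x) + α' • -(ε • (β' * γ) • y) = (γ * γ') • (-x - ε • y) := by
  linear_combination (norm := module) (-γ') • hx - (ε * γ) • hy

/-! ### Operators of square zero and the derivation property of `Δ` -/

variable [CharZero k]

theorem totalD_totalD (hx : x ∈ FGr V P i) : totalD V P (totalD V P x) = 0 :=
  FGr_ext (f := totalD V P ∘ₗ totalD V P) (g := 0) (fun n b t ht => by
    rw [LinearMap.comp_apply, totalD_incl, totalD_incl, termD_termD ht.1, map_zero,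
      LinearMap.zero_apply]) hx

/-- Exchanging the order of two loops changes the sign, but on an invariant element the choice of
the flags of a loop does not matter. Hence the double contraction equals its negative. -/
theorem totalLoop_totalLoop (hx : x ∈ FGr V P i) : totalLoop B P (totalLoop B P x) = 0 := by
  refine FGr_ext (f := totalLoop B P ∘ₗ totalLoop B P) (g := 0) (fun n b t ht => ?_) hx
  rw [LinearMap.comp_apply, LinearMap.zero_apply]
  rcases lt_or_ge n 2 with hn | hn
  · rw [totalLoop_incl_of_lt hn, map_zero]
  obtain ⟨f⟩ := exists_loopEquiv hn
  rw [totalLoop_incl f rfl ht]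
  rcases lt_or_ge (n - 2) 2 with hn' | hn'
  · rw [totalLoop_incl_of_lt hn']
  obtain ⟨f'⟩ := exists_loopEquiv hn'
  rw [totalLoop_incl f' rfl (termSelfGlue_mem_invGr f ht)]
  -- `e` is chosen so that `e` followed by the same `f'` contracts the two pairs of flags of `f` and
  -- `f'` in the opposite order.
  let e := ((thenLoopFlags f f').trans (swapEdges _)).trans
    (Equiv.sumCongr (Equiv.refl Bool) f'.symm)
  have he : thenLoopFlags e f' = (thenLoopFlags f f').trans (swapEdges _) := by
    rw [thenLoopFlags, Equiv.trans_assoc, Equiv.sumCongr_trans, Equiv.symm_trans_self,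
      Equiv.refl_trans, Equiv.sumCongr_refl, Equiv.trans_refl]
  have H : thenLoopFlags f f' = (thenLoopFlags e f').trans (swapEdges _) := by
    rw [he, Equiv.trans_assoc, swapEdges_trans_swapEdges, Equiv.trans_refl]
  have h := termSelfGlue_termSelfGlue (B := B) (P := P) H rfl rfl ht.1
  rw [termSelfGlue_eq f e ht] at h
  rw [eq_zero_of_eq_neg (k := k) h, map_zero]

/-- The left-hand side is a sum over ordered pairs of legs of the glued element. Pairs of legs of
`s` give the first term, pairs of legs of `t` give the second after exchanging the factors, and
mixed pairs contribute zero. -/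
theorem totalLoop_totalPair_incl {s : Term V P n₁ b₁} {t : Term V P n₂ b₂}
    (hs : s ∈ invGr V P n₁ b₁ i) (ht : t ∈ invGr V P n₂ b₂ j) :
    totalLoop B P (totalPair B P (incl V P n₁ b₁ s) (incl V P n₂ b₂ t)) =
      -totalPair B P (totalLoop B P (incl V P n₁ b₁ s)) (incl V P n₂ b₂ t) -
        (((i * j).negOnePow : ℤ) : k) •
          totalPair B P (totalLoop B P (incl V P n₂ b₂ t)) (incl V P n₁ b₁ s) := by
  classical
  rcases eq_or_ne n₁ 0 with rfl | h₁
  · rw [totalPair_incl_zero_left, totalPair_incl_zero_right,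
      totalPair_totalLoop_incl_of_lt (by norm_num) hs, map_zero, neg_zero, smul_zero, sub_zero]
  rcases eq_or_ne n₂ 0 with rfl | h₂
  · rw [totalPair_incl_zero_right, totalPair_incl_zero_right,
      totalPair_totalLoop_incl_of_lt (by norm_num) ht, map_zero, neg_zero, smul_zero, sub_zero]
  obtain ⟨e, he⟩ := exists_joinsFactors h₁ h₂
  rw [totalPair_incl e he rfl hs ht, map_smul]
  rcases lt_or_ge (n₁ + n₂ - 2) 2 with hm | hm
  · rw [avg_apply, totalLoop_incl_of_lt hm, totalPair_totalLoop_incl_of_lt (by omega) hs,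
      totalPair_totalLoop_incl_of_lt (by omega) ht, neg_zero, smul_zero, smul_zero, sub_zero]
  have hE : ∀ a a' : Fin (n₁ + n₂ - 2), ∃ f : Fin (n₁ + n₂ - 2) ≃ Bool ⊕ Fin (n₁ + n₂ - 2 - 2),
      a ≠ a' → LoopAt f a a' := fun a a' => by
    obtain ⟨f⟩ := exists_loopEquiv hm
    by_cases h : a = a'
    · exact ⟨f, fun h' => absurd h h'⟩
    · obtain ⟨f', hf'⟩ := exists_loopAt_of_ne f h
      exact ⟨f', fun _ => hf'⟩
  choose E hE using hE
  rw [totalLoop_avg E hE rfl (termGlue_mem e hs.1 ht.1)]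
  set U := totalPair B P (totalLoop B P (incl V P n₁ b₁ s)) (incl V P n₂ b₂ t) with hU
  set W := totalPair B P (totalLoop B P (incl V P n₂ b₂ t)) (incl V P n₁ b₁ s) with hW
  set ε := (((i * j).negOnePow : ℤ) : k) with hε
  obtain ⟨p, p', hp⟩ := he.exists_joins
  have hR : ∀ a, ¬ FromLeft e a → ∃ r, e (Sum.inr r) = Sum.inr a := fun a ha => by
    cases h : e.symm (Sum.inr a) with
    | inl r => exact absurd ⟨r, by rw [← h, Equiv.apply_symm_apply]⟩ ha
    | inr r => exact ⟨r, by rw [← h, Equiv.apply_symm_apply]⟩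
  have hval : ∀ x ∈ (Finset.univ : Finset (Fin (n₁ + n₂ - 2))).offDiag,
      avg V P _ (b₁ + b₂ + 1) (termSelfGlue B P (E x.1 x.2) (b₁ + b₂) (b₁ + b₂ + 1)
        (termGlue B P e b₁ b₂ (b₁ + b₂) s t)) =
      (if FromLeft e x.1 ∧ FromLeft e x.2 then
        -((((n₁ - 3).factorial : k) * ((n₂ - 1).factorial : k)) • U) else 0) +
      (if ¬ FromLeft e x.1 ∧ ¬ FromLeft e x.2 then
        -(ε • (((n₂ - 3).factorial : k) * ((n₁ - 1).factorial : k)) • W) else 0) := by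
    rintro ⟨a, a'⟩ hx
    rw [Finset.mem_offDiag] at hx
    have hl := hE a a' hx.2.2
    by_cases ha : FromLeft e a <;> by_cases ha' : FromLeft e a'
    · simp only [ha, ha', and_self, if_true, not_true, if_false, add_zero]
      obtain ⟨r, hr⟩ := ha
      obtain ⟨r', hr'⟩ := ha'
      exact avg_termSelfGlue_termGlue_left hp hr hr' hl rfl rfl hs ht
    · simp only [ha, ha', and_false, false_and, if_false, not_true, add_zero]
      obtain ⟨r, hr⟩ := ha
      obtain ⟨r', hr'⟩ := hR a' ha'
      exact avg_termSelfGlue_termGlue_mixed he hr hr' hl rfl rfl hs ht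
    · simp only [ha, ha', and_false, false_and, if_false, not_true, add_zero]
      obtain ⟨r, hr⟩ := hR a ha
      obtain ⟨r', hr'⟩ := ha'
      -- The loop runs from `t` to `s`; reversing it, which changes nothing, reduces this to the
      -- previous case.
      rw [← termSelfGlue_flipEdge _ (termGlue_mem e hs.1 ht.1)]
      exact avg_termSelfGlue_termGlue_mixed he hr' hr hl.flipEdge rfl rfl hs ht
    · simp only [ha, ha', and_self, if_false, not_false_eq_true, if_true, zero_add]
      obtain ⟨r, hr⟩ := (fromLeft_or e a).resolve_left ha
      obtain ⟨r', hr'⟩ := (fromLeft_or e a').resolve_left ha'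
      have hc := termGlue_sumComm (B := B) (P := P) (b₁ := b₂) (b₂ := b₁) (b := b₁ + b₂) he ht.1 hs.1
      have h := avg_termSelfGlue_termGlue_left (B := B) (b := b₁ + b₂ + 1) hp.sumComm hr hr' hl
        (add_comm b₂ b₁) rfl ht hs
      rw [← hW, hc, TensorProduct.map_intUnits_smul, avg_intUnits_smul,
        intUnits_smul_eq_cast_smul (k := k), mul_comm j i, ← hε] at h
      refine eq_neg_smul_of_smul_eq_neg ?_ h
      rw [hε, ← Int.cast_mul, ← Units.val_mul, Int.units_mul_self, Units.val_one, Int.cast_one]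
  have hleft : (Finset.univ.offDiag.filter fun x : Fin (n₁ + n₂ - 2) × Fin (n₁ + n₂ - 2) =>
      FromLeft e x.1 ∧ FromLeft e x.2).card = (n₁ - 1) * (n₁ - 1) - (n₁ - 1) := by
    rw [← card_fromLeft he, ← Finset.offDiag_card]
    congr 1
    ext x
    simp only [Finset.mem_filter, Finset.mem_offDiag, Finset.mem_univ, true_and]
    tauto
  have hcard : (Finset.univ.filter fun a => ¬ FromLeft e a).card = n₂ - 1 := by
    have := Finset.card_filter_add_card_filter_not (s := Finset.univ) (FromLeft e)
    rw [card_fromLeft he, Finset.card_univ, Fintype.card_fin] at this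
    omega
  have hright : (Finset.univ.offDiag.filter fun x : Fin (n₁ + n₂ - 2) × Fin (n₁ + n₂ - 2) =>
      ¬ FromLeft e x.1 ∧ ¬ FromLeft e x.2).card = (n₂ - 1) * (n₂ - 1) - (n₂ - 1) := by
    rw [← hcard, ← Finset.offDiag_card]
    congr 1
    ext x
    simp only [Finset.mem_filter, Finset.mem_offDiag, Finset.mem_univ, true_and]
    tauto
  have hU' := factorial_smul_totalPair_totalLoop (B := B) hs (incl V P n₂ b₂ t)
  have hW' := factorial_smul_totalPair_totalLoop (B := B) ht (incl V P n₁ b₁ s)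
  rw [← hU] at hU'
  rw [← hW] at hW'
  have hne₁ : ((n₁ - 1).factorial : k) ≠ 0 := Nat.cast_ne_zero.2 (Nat.factorial_ne_zero _)
  have hne₂ : ((n₂ - 1).factorial : k) ≠ 0 := Nat.cast_ne_zero.2 (Nat.factorial_ne_zero _)
  rw [Finset.sum_congr rfl hval, Finset.sum_add_distrib, ← Finset.sum_filter, ← Finset.sum_filter,
    Finset.sum_const, Finset.sum_const, hleft, hright, ← Nat.cast_smul_eq_nsmul k,
    ← Nat.cast_smul_eq_nsmul k, inv_smul_eq_iff₀ (mul_ne_zero hne₁ hne₂)]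
  exact smul_neg_add_smul_neg_eq (M := Terms V P) ε hU' hW'

theorem totalLoop_totalPair (hx : x ∈ FGr V P i) (hy : y ∈ FGr V P j) :
    totalLoop B P (totalPair B P x y) = -totalPair B P (totalLoop B P x) y -
      i.negOnePow • totalPair B P x (totalLoop B P y) := by
  refine (FGr_ext₂ (f := (totalPair B P).compr₂ (totalLoop B P))
    (g := (-1 : k) • (totalPair B P) ∘ₗ (totalLoop B P) +
      (-1 : k) • ((i.negOnePow : ℤ) : k) • (totalPair B P).compl₂ (totalLoop B P))
    (fun n₁ b₁ s n₂ b₂ t hs ht => ?_) hx hy).trans (by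
      rw [intUnits_smul_eq_cast_smul (k := k)]
      change (-1 : k) • totalPair B P (totalLoop B P x) y +
        (-1 : k) • ((i.negOnePow : ℤ) : k) • totalPair B P x (totalLoop B P y) = _
      module)
  change totalLoop B P (totalPair B P (incl V P n₁ b₁ s) (incl V P n₂ b₂ t)) =
    (-1 : k) • totalPair B P (totalLoop B P (incl V P n₁ b₁ s)) (incl V P n₂ b₂ t) +
    (-1 : k) • ((i.negOnePow : ℤ) : k) •
      totalPair B P (incl V P n₁ b₁ s) (totalLoop B P (incl V P n₂ b₂ t))
  -- Bringing `Δ` of the second element back to the second place costs `(-1) ^ (i * (j - 1))`, which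
  -- together with `(-1) ^ i` is the sign `(-1) ^ (i * j)` of the preceding lemma.
  rw [totalLoop_totalPair_incl hs ht, totalPair_symm (incl_mem_FGr hs)
    (totalLoop_mem (incl_mem_FGr ht)), intUnits_smul_eq_cast_smul (k := k),
    smul_smul ((i.negOnePow : ℤ) : k), ← Int.cast_mul, ← Units.val_mul, ← Int.negOnePow_add,
    show (i + i * (j - 1)).negOnePow = (i * j).negOnePow by ring_nf]
  module

end Identities

/-! ## The differential graded Lie algebra structures -/

section OddLie

variable {k : Type u} [Field k] {A : Type v} [AddCommGroup A] [Module k A]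

/-- An odd Lie bracket `(-1) ^ (i * j) C` with a differential `(-1) ^ i E` on a graded space `F`
give a differential graded Lie algebra structure on `F[1]`. -/
theorem isDGLieAlgebra_shift {F : ℤ → Submodule k A} {C : A →ₗ[k] A →ₗ[k] A} {E : A →ₗ[k] A}
    (E_mem : ∀ (i : ℤ) (x : A), x ∈ F i → E x ∈ F (i - 1))
    (C_mem : ∀ (i j : ℤ) (x y : A), x ∈ F i → y ∈ F j → C x y ∈ F (i + j - 1))
    (E_E : ∀ (i : ℤ) (x : A), x ∈ F i → E (E x) = 0)
    (C_symm : ∀ (i j : ℤ) (x y : A), x ∈ F i → y ∈ F j → C x y = (i * j).negOnePow • C y x)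
    (C_jacobi : ∀ (i j q : ℤ) (x y z : A), x ∈ F i → y ∈ F j → z ∈ F q →
      C (C x y) z + (j * q).negOnePow • C (C x z) y + (i * j + i * q).negOnePow • C (C y z) x = 0)
    (E_C : ∀ (i j : ℤ) (x y : A), x ∈ F i → y ∈ F j →
      E (C x y) = -C (E x) y - i.negOnePow • C x (E y))
    {d : ℤ → A →ₗ[k] A} (hd : ∀ (i : ℤ) (x : A), d i x = i.negOnePow • E x)
    {br : ℤ → ℤ → A →ₗ[k] A →ₗ[k] A}
    (hbr : ∀ (i j : ℤ) (x y : A), br i j x y = (i * j).negOnePow • C x y) :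
    IsDGLieAlgebra (shiftGr F) (shiftOp d) (shiftBracket br) := by
  have hs : ∀ (i j : ℤ) (x y : A),
      shiftBracket br i j x y = (j + 1 + (i + 1) * (j + 1)).negOnePow • C x y := fun i j x y => by
    change (j + 1).negOnePow • br (i + 1) (j + 1) x y = _
    rw [hbr, intUnits_mul_smul, ← Int.negOnePow_add]
  have ho : ∀ (i : ℤ) (x : A), shiftOp d i x = (i + 1).negOnePow • E x := fun i x => hd _ _
  refine ⟨fun i x hx => ?_, fun i j x y hx hy => ?_, fun i x hx => ?_, fun i j x y hx hy => ?_,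
    fun i j m x y z hx hy hz => ?_, fun i j x y hx hy => ?_⟩
  · rw [ho]
    have := Submodule.intUnits_smul_mem (k := k) _ (i + 1).negOnePow (E_mem _ x hx)
    rwa [shiftGr, show i - 1 + 1 = i + 1 - 1 by ring]
  · rw [hs]
    have := Submodule.intUnits_smul_mem (k := k) _ (j + 1 + (i + 1) * (j + 1)).negOnePow
      (C_mem _ _ x y hx hy)
    rwa [shiftGr, show i + j + 1 = i + 1 + (j + 1) - 1 by ring]
  · rw [ho, ho, LinearMap.map_intUnits_smul, E_E _ x hx, intUnits_smul_zero, intUnits_smul_zero]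
  · rw [hs, hs, C_symm _ _ x y hx hy, neg_eq_negOnePow_smul]
    simp only [intUnits_mul_smul, ← Int.negOnePow_add]
    refine congrArg₂ (· • ·) (Int.negOnePow_eq_of_zmod ?_) rfl
    push_cast
    generalize (i : ZMod 2) = i, (j : ZMod 2) = j
    revert i j
    decide
  -- Symmetry of `C` brings all double brackets to the form nested on the left, in which the
  -- identity `C_jacobi` is stated; only signs remain to be compared.
  · have h₁ := C_symm _ _ x _ hx (C_mem _ _ y z hy hz)
    have h₂ := C_symm _ _ y _ hy (C_mem _ _ x z hx hz)
    have h₃ := C_jacobi _ _ _ x y z hx hy hz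
    rw [add_assoc, add_eq_zero_iff_eq_neg] at h₃
    simp only [hs]
    simp only [LinearMap.map_intUnits_smul₂]
    simp only [LinearMap.map_intUnits_smul, h₁, h₂, h₃]
    simp only [neg_eq_negOnePow_smul, intUnits_smul_add, intUnits_mul_smul, ← Int.negOnePow_add]
    refine Eq.trans ?_ ((congrArg₂ (· + ·) rfl ?_).trans (add_neg_cancel_comm _ _)).symm
    · refine congrArg₂ (· • ·) (Int.negOnePow_eq_of_zmod ?_) rfl
      push_cast
      generalize (i : ZMod 2) = i, (j : ZMod 2) = j, (m : ZMod 2) = m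
      revert i j m
      decide
    · rw [neg_eq_negOnePow_smul, intUnits_mul_smul, ← Int.negOnePow_add]
      refine congrArg₂ (· • ·) (Int.negOnePow_eq_of_zmod ?_) rfl
      push_cast
      generalize (i : ZMod 2) = i, (j : ZMod 2) = j, (m : ZMod 2) = m
      revert i j m
      decide
  · simp only [hs, ho]
    simp only [LinearMap.map_intUnits_smul₂]
    simp only [LinearMap.map_intUnits_smul,
      E_C _ _ x y hx hy, sub_eq_add_neg (-C (E x) y)]
    simp only [neg_eq_negOnePow_smul, intUnits_smul_add, intUnits_mul_smul, ← Int.negOnePow_add]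
    refine congrArg₂ (· + ·) ?_ ?_
    all_goals
      refine congrArg₂ (· • ·) (Int.negOnePow_eq_of_zmod ?_) rfl
      push_cast
      generalize (i : ZMod 2) = i, (j : ZMod 2) = j
      revert i j
      decide

end OddLie

end

/-- The three structures are instances of `isDGLieAlgebra_shift` with the same bracket and with `E`
equal to `-(d_V + d_P)`, to `ξ^{ℰ[V]} ⊗ ξ^P`, and to the sum of these two operators. -/
theorem mainTheorem4 {k : Type u} [Field k] [CharZero k] (l : ℤ) (η : ℤˣ)
    (V : ChainCx.{u, v} k) (B : InnerProd V l η)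
    (P : TwistedModularOperad.{u, w} k (l - 1) η) :
    (∀ m ∈ FGr V P 0, feynmanEq B P m =
      -(diffD V P 0 m + bvDelta B P 0 m + (2⁻¹ : k) • oddBracket B P 0 0 m m)) ∧
    IsDGLieAlgebra (shiftGr (FGr V P)) (shiftOp (A := Terms V P) (diffD V P)) (shiftBracket (A := Terms V P) (oddBracket B P)) ∧
    IsDGLieAlgebra (shiftGr (FGr V P)) (shiftOp (A := Terms V P) (bvDelta B P)) (shiftBracket (A := Terms V P) (oddBracket B P)) ∧
    IsDGLieAlgebra (shiftGr (FGr V P)) (shiftOp (A := Terms V P) fun i => diffD V P i + bvDelta B P i)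
      (shiftBracket (A := Terms V P) (oddBracket B P)) := by
  have hC : ∀ (i j : ℤ) (x y : Terms V P),
      oddBracket B P i j x y = (i * j).negOnePow • totalPair B P x y := fun i j x y => rfl
  -- The exponent `deg m + 1` in the definition of `d` is split into `(-1) ^ deg m` and a constant
  -- `-1`, which is put into the operator `E`.
  have hD : ∀ (i : ℤ) (x : Terms V P),
      diffD V P i x = i.negOnePow • ((-1 : k) • totalD V P) x := fun i x => by
    change (i + 1).negOnePow • totalD V P x = i.negOnePow • (-1 : k) • totalD V P x
    rw [intUnits_smul_eq_cast_smul (k := k), intUnits_smul_eq_cast_smul (k := k), smul_smul,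
      Int.negOnePow_add, Int.negOnePow_one, Units.val_mul, Units.val_neg, Units.val_one,
      Int.cast_mul, Int.cast_neg, Int.cast_one]
  have hL : ∀ (i : ℤ) (x : Terms V P), bvDelta B P i x = i.negOnePow • totalLoop B P x :=
    fun i x => rfl
  refine ⟨fun m _ => ?_, ?_, ?_, ?_⟩
  · rw [hD, hL, hC, feynmanEq, mul_zero, Int.negOnePow_zero, intUnits_one_smul, intUnits_one_smul,
      intUnits_one_smul, LinearMap.smul_apply]
    module
  · refine isDGLieAlgebra_shift (A := Terms V P) (F := FGr V P) (C := totalPair B P)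
      (E := (-1 : k) • totalD V P) (d := diffD V P) (br := oddBracket B P)
      (fun i x hx => Submodule.smul_mem _ _ (totalD_mem hx))
      (fun i j x y => totalPair_mem) (fun i x hx => ?_) (fun i j x y => totalPair_symm)
      (fun i j q x y z => totalPair_jacobi) (fun i j x y hx hy => ?_) hD hC
    · rw [LinearMap.smul_apply, LinearMap.smul_apply, map_smul, totalD_totalD hx, smul_zero,
        smul_zero]
    · rw [LinearMap.smul_apply, totalD_totalPair hx hy, LinearMap.smul_apply, LinearMap.smul_apply,
        map_smul, map_smul, LinearMap.smul_apply, intUnits_smul_eq_cast_smul (k := k),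
        intUnits_smul_eq_cast_smul (k := k)]
      module
  · exact isDGLieAlgebra_shift (A := Terms V P) (F := FGr V P) (C := totalPair B P)
      (E := totalLoop B P) (d := bvDelta B P) (br := oddBracket B P)
      (fun i x => totalLoop_mem) (fun i j x y => totalPair_mem) (fun i x => totalLoop_totalLoop)
      (fun i j x y => totalPair_symm) (fun i j q x y z => totalPair_jacobi)
      (fun i j x y => totalLoop_totalPair) hL hC
  · refine isDGLieAlgebra_shift (A := Terms V P) (F := FGr V P) (C := totalPair B P)
      (E := (-1 : k) • totalD V P + totalLoop B P)
      (d := fun i => diffD V P i + bvDelta B P i) (br := oddBracket B P)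
      (fun i x hx => add_mem (Submodule.smul_mem _ _ (totalD_mem hx)) (totalLoop_mem hx))
      (fun i j x y => totalPair_mem) (fun i x hx => ?_) (fun i j x y => totalPair_symm)
      (fun i j q x y z => totalPair_jacobi) (fun i j x y hx hy => ?_) (fun i x => ?_) hC
    -- The two squares vanish separately, and the mixed terms cancel because the operators
    -- anticommute.
    · have h := totalD_totalLoop (B := B) hx
      simp only [LinearMap.add_apply, LinearMap.smul_apply, map_add, map_smul, totalD_totalD hx,
        totalLoop_totalLoop hx, h]
      module
    · simp only [LinearMap.add_apply, LinearMap.smul_apply, map_add, map_smul,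
        totalD_totalPair hx hy, totalLoop_totalPair hx hy, intUnits_smul_eq_cast_smul (k := k)]
      module
    · rw [LinearMap.add_apply, hD, hL, intUnits_smul_eq_cast_smul (k := k),
        intUnits_smul_eq_cast_smul (k := k), intUnits_smul_eq_cast_smul (k := k),
        LinearMap.add_apply, smul_add]
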